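/- **Setting.** Manifolds are smooth, finite dimensional, Hausdorff and paracompact. Let $G$ be a Lie group with Lie algebra $\mathfrak g$, acting smoothly and properly from the left on a manifold $Q$ (of constant dimension), and assume that all isotropy groups $G_q$ are conjugate in $G$ to one subgroup. Write $\zeta_X(q)=\zeta(q)(X)=\frac{d}{dt}|_0\exp(tX).q$ for the fundamental vector fields, $\mathfrak g_q=\ker\zeta(q)$ for the isotropy Lie algebras, and $\operatorname{Ann}\mathfrak g_q\subseteq\mathfrak g^*$ for their annihilators. The orbit space $Q/G$ carries its smooth structure for which $\pi:Q\to Q/G$ is a submersion. Let $\theta$ be the Liouville form and $\Omega=-d\theta$ the canonical symplectic form on $T^*Q$ (and $\Omega^{Q/G}$ that on $T^*(Q/G)$), and $\mu:T^*Q\to\mathfrak g^*$, $\langle\mu(q,p),X\rangle=\langle p,\zeta_X(q)\rangle$, the momentum map of the cotangent lifted action. Put $\mathrm{Ad}^*(g)\lambda=\lambda\circ \mathrm{Ad}(g^{-1})$. Let $A\in\Omega^1(Q;\mathfrak g)$ be a generalized connection form, i.e. $A:TQ\to\mathfrak g$ is $G$-equivariant and $\zeta\circ A\circ\zeta=\zeta$.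 Let $\mathrm{Curv}^A=dA-\frac12[A,A]^\wedge$, where $[\varphi,\psi]^\wedge(v_1,\dots,v_{l+k})=\frac1{k!\,l!}\sum_s\operatorname{sign}(s)[\varphi(v_{s1},\dots,v_{sl}),\psi(v_{s(l+1)},\dots,v_{s(l+k)})]$, and let $A_q^*(\lambda)=\lambda\circ A_q$. Let $$\mathcal W=(Q\times_{Q/G}T^*(Q/G))\times_Q\bigsqcup_{q\in Q}\operatorname{Ann}\mathfrak g_q=\{(q,\eta,\lambda):\ q\in Q,\ \eta\in T^*_{\pi(q)}(Q/G),\ \lambda\in\operatorname{Ann}\mathfrak g_q\}\subseteq Q\times T^*(Q/G)\times\mathfrak g^*,$$ with projections $p_Q:\mathcal W\to Q$, $(q,\eta,\lambda)\mapsto q$, and $p:\mathcal W\to T^*(Q/G)$, $(q,\eta,\lambda)\mapsto(\pi(q),\eta)$. **Proposition (symplectic structure on $\mathcal W$).** $\mathcal W$ is an embedded submanifold of $Q\times T^*(Q/G)\times\mathfrak g^*$, and $$\psi=\psi(A):\mathcal W\to T^*Q,\qquad (q,\eta,\lambda)\mapsto(q,(T_q\pi)^*\eta+A_q^*(\lambda))$$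 is an isomorphism of bundles over $Q$ (a diffeomorphism over $Q$, linear on fibres). Moreover: 1. $\sigma=\psi^*\Omega$ is a symplectic form on $\mathcal W$. There is an induced smooth $G$-action on $(\mathcal W,\sigma)$ by symplectomorphisms, namely $g.(q,\eta,\lambda)=(g.q,\eta,\mathrm{Ad}^*(g)\lambda)$, and $\psi$ is equivariant for it and the cotangent lifted action on $T^*Q$. This action is Hamiltonian with equivariant momentum map $\mu_A=\mu\circ\psi$, that is, $d\langle\mu_A,X\rangle=\sigma(\zeta^{\mathcal W}_X,\cdot)$ for $X\in\mathfrak g$, where $\zeta^{\mathcal W}_X$ denotes the fundamental vector field on $\mathcal W$; and $\mu_A(q,\eta,\lambda)=\lambda$. 2. $\sigma=p^*\Omega^{Q/G}-dB$, where $B\in\Omega^1(\mathcal W)$ is the smooth form $B=\langle\mu_A,p_Q^*A\rangle$. Moreover $$dB=\langle d\mu_A\stackrel{\wedge}{,}p_Q^*A\rangle+\langle\mu_A,p_Q^*\mathrm{Curv}^A\rangle+\langle\mu_A,\tfrac12[p_Q^*A,p_Q^*A]^\wedge\rangle,$$ where $\langle\cdot\stackrel{\wedge}{,}\cdot\rangle$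 is the exterior multiplication of a $\mathfrak g^*$-valued with a $\mathfrak g$-valued form. Explicitly, let $\xi_1,\xi_2\in T_{(q,\eta,\lambda)}\mathcal W$, $q_i'=Tp_Q(\xi_i)$ and $\lambda_i'=d\mu_A(\xi_i)\in\mathfrak g^*$. If $q_i'=v_i+\zeta_{Z_i}(q)$ with $v_i$ horizontal, i.e. $\zeta(q)(A_q(v_i))=0$ (in particular if $A_q(v_i)=0$), and $Z_i\in\mathfrak g$, then $$dB_{(q,\eta,\lambda)}(\xi_1,\xi_2)=\langle\lambda_1',Z_2\rangle-\langle\lambda_2',Z_1\rangle+\langle\lambda,\mathrm{Curv}^A_q(q_1',q_2')\rangle+\langle\lambda,[Z_1,Z_2]\rangle.$$ -/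

import Mathlib

open scoped Manifold ContDiff Topology
open Bundle

noncomputable section

namespace GaugedCotangent

/-! ### Differential forms on manifolds -/

section Forms

variable {E H M : Type*} [NormedAddCommGroup E] [NormedSpace ℝ E] [TopologicalSpace H]
  (I : ModelWithCorners ℝ E H) [TopologicalSpace M] [ChartedSpace H M]
  {E' H' M' : Type*} [NormedAddCommGroup E'] [NormedSpace ℝ E'] [TopologicalSpace H']
  (I' : ModelWithCorners ℝ E' H') [TopologicalSpace M'] [ChartedSpace H' M']
  {V : Type*} [NormedAddCommGroup V] [NormedSpace ℝ V] {n : ℕ}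

/-- (Not necessarily smooth) `V`-valued differential `n`-forms on the manifold `M`. -/
abbrev Form {E H : Type*} [NormedAddCommGroup E] [NormedSpace ℝ E] [TopologicalSpace H]
    (I : ModelWithCorners ℝ E H) (M : Type*) [TopologicalSpace M] [ChartedSpace H M]
    (V : Type*) [NormedAddCommGroup V] [NormedSpace ℝ V] (n : ℕ) : Type _ :=
  ∀ x : M, TangentSpace I x [⋀^Fin n]→L[ℝ] V

/-- A family of linear maps `α x : T_x M → V`, regarded as a differential 1-form. -/
def oneForm (α : ∀ x : M, TangentSpace I x →L[ℝ] V) : Form I M V 1 :=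
  fun x => ContinuousAlternatingMap.ofSubsingleton ℝ (TangentSpace I x) V (0 : Fin 1) (α x)

/-- A form is smooth if its values on smooth vector fields are smooth functions. -/
def IsSmoothForm [IsManifold I ∞ M] (Φ : Form I M V n) : Prop :=
  ∀ X : Fin n → ∀ x : M, TangentSpace I x,
    (∀ i, ContMDiff I I.tangent ∞ (fun x => (⟨x, X i x⟩ : TangentBundle I M))) →
      ContMDiff I 𝓘(ℝ, V) ∞ (fun x => Φ x (fun i => X i x))

/-- The pull-back `f^* Φ` of a form on `M'` along `f : M → M'`. -/
def pullback (f : M → M') (Φ : Form I' M' V n) : Form I M V n :=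
  fun x => (Φ (f x)).compContinuousLinearMap (mfderiv I I' f x)

/-- The expression of a form in the preferred chart at `x`, a form on the model vector space. -/
def chartRep (Φ : Form I M V n) (x : M) (y : E) : E [⋀^Fin n]→L[ℝ] V :=
  (Φ ((extChartAt I x).symm y)).compContinuousLinearMap
    (mfderivWithin 𝓘(ℝ, E) I (extChartAt I x).symm (Set.range I) y)

/-- The exterior derivative of a form on a manifold: at `x`, write the form in the preferred
chart at `x`, take the exterior derivative in the model vector space, and pull the result back
along the chart. -/
def extD (Φ : Form I M V n) : Form I M V (n + 1) :=
  fun x => (extDerivWithin (chartRep I Φ x) (Set.range I) (extChartAt I x x)).compContinuousLinearMap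
    (mfderiv I 𝓘(ℝ, E) (extChartAt I x) x)

/-- A symplectic form: a smooth, closed, non-degenerate real 2-form. -/
structure IsSymplectic [IsManifold I ∞ M] (Φ : Form I M ℝ 2) : Prop where
  smooth : IsSmoothForm I Φ
  closed : ∀ x, extD I Φ x = 0
  nondegenerate : ∀ (x : M) (u : TangentSpace I x), (∀ v, Φ x ![u, v] = 0) → u = 0

/-- `M` is, via `f`, an embedded submanifold of `M'`: the map `f` is smooth, a homeomorphism onto
its image, and its tangent maps are injective. -/
structure IsEmbeddedVia (f : M → M') : Prop where
  smooth : ContMDiff I I' ∞ f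
  embedding : Topology.IsEmbedding f
  immersive : ∀ x, Function.Injective (mfderiv I I' f x)

end Forms

/-- The exterior product, formed with a pairing `β`, of an alternating map of degree `l` and
one of degree `k`, with the normalization `1 / (k! l!)`. -/
def wedge {T V₁ V₂ V₃ : Type*} [AddCommGroup V₃] [Module ℝ V₃] {l k : ℕ} (β : V₁ → V₂ → V₃)
    (φ : (Fin l → T) → V₁) (χ : (Fin k → T) → V₂) (v : Fin (l + k) → T) : V₃ :=
  (1 / ((k.factorial : ℝ) * (l.factorial : ℝ))) •
    ∑ s : Equiv.Perm (Fin (l + k)), ((Equiv.Perm.sign s : ℤ) : ℝ) •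
      β (φ fun i => v (s (Fin.castAdd k i))) (χ fun j => v (s (Fin.natAdd l j)))

/-! ### Cotangent bundles -/

section Cotangent

variable (E M : Type*) [NormedAddCommGroup E] [NormedSpace ℝ E]
  [TopologicalSpace M] [ChartedSpace E M]

/-- The cotangent space `T_x^* M`. -/
abbrev CotangentSpace (x : M) : Type _ :=
  TangentSpace 𝓘(ℝ, E) x →L[ℝ] Bundle.Trivial M ℝ x

/-- The cotangent bundle `T^* M`; its elements are pairs `⟨x, p⟩` with `p ∈ T_x^* M`. -/
abbrev CotangentBundle : Type _ := TotalSpace (E →L[ℝ] ℝ) (CotangentSpace E M)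

/-- The model with corners of the cotangent bundle. -/
abbrev cotModel : ModelWithCorners ℝ (E × (E →L[ℝ] ℝ)) (ModelProd E (E →L[ℝ] ℝ)) :=
  𝓘(ℝ, E).prod 𝓘(ℝ, E →L[ℝ] ℝ)

variable [IsManifold 𝓘(ℝ, E) ∞ M]

/-- The Liouville form `θ` on `T^* M`: `θ_{(x,p)}(ξ) = ⟨p, Tτ ξ⟩`, where `τ : T^* M → M`. -/
def liouville : Form (cotModel E) (CotangentBundle E M) ℝ 1 :=
  oneForm (cotModel E) fun z : CotangentBundle E M =>
    (z.2 : TangentSpace 𝓘(ℝ, E) z.1 →L[ℝ] ℝ).comp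
      (mfderiv (cotModel E) 𝓘(ℝ, E) (TotalSpace.proj : CotangentBundle E M → M) z)

/-- The canonical symplectic form `Ω = -dθ` on `T^* M`. -/
def canonicalForm : Form (cotModel E) (CotangentBundle E M) ℝ 2 :=
  fun z => -extD (cotModel E) (liouville E M) z

end Cotangent

/-! ### Lie groups and their actions

The Lie algebra `𝔤 = T_1 G` of a Lie group `G` modelled on `EG` is `GroupLieAlgebra 𝓘(ℝ, EG) G`;
its underlying vector space is, by definition, `EG`. -/

section Lie

variable {EG : Type*} [NormedAddCommGroup EG] [NormedSpace ℝ EG]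
  (G : Type*) [TopologicalSpace G] [ChartedSpace EG G] [Group G]

/-- The bracket of the Lie algebra of `G` (defined by left invariant vector fields). -/
def lieBr (X Y : EG) : EG :=
  Bracket.bracket (L := GroupLieAlgebra 𝓘(ℝ, EG) G) (M := GroupLieAlgebra 𝓘(ℝ, EG) G) X Y

variable {G}

/-- The adjoint action `Ad(g)`: the tangent map at `1` of `h ↦ g h g⁻¹`. -/
def Ad (g : G) : EG →L[ℝ] EG := mfderiv 𝓘(ℝ, EG) 𝓘(ℝ, EG) (fun h : G => g * h * g⁻¹) 1

/-- The coadjoint action `Ad^*(g) λ = λ ∘ Ad(g⁻¹)`. -/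
def coAd (g : G) (lam : EG →L[ℝ] ℝ) : EG →L[ℝ] ℝ := lam.comp (Ad g⁻¹)

variable (G)
variable {E H M : Type*} [NormedAddCommGroup E] [NormedSpace ℝ E] [TopologicalSpace H]
  (I : ModelWithCorners ℝ E H) [TopologicalSpace M] [ChartedSpace H M] [MulAction G M]

/-- The infinitesimal action `ζ(x) : 𝔤 → T_x M`, the tangent map at `1` of `g ↦ g • x`; the
fundamental vector field of `X ∈ 𝔤` is `x ↦ ζ(x)(X)`. -/
def zeta (x : M) : EG →L[ℝ] TangentSpace I x :=
  mfderiv 𝓘(ℝ, EG) I (fun g : G => g • x) 1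

/-- `μ` is an equivariant momentum map for the action of `G` on `(M, Φ)`:
`d⟨μ, X⟩ = Φ(ζ_X, ·)` and `μ(g x) = Ad^*(g) μ(x)`. -/
structure IsMomentumMap (Φ : Form I M ℝ 2) (μ : M → (EG →L[ℝ] ℝ)) : Prop where
  smooth : ContMDiff I 𝓘(ℝ, EG →L[ℝ] ℝ) ∞ μ
  hamiltonian : ∀ (X : EG) (x : M) (v : TangentSpace I x),
    mfderiv I 𝓘(ℝ, ℝ) (fun y => μ y X) x v = Φ x ![zeta G I x X, v]
  equivariant : ∀ (g : G) (x : M), μ (g • x) = coAd g (μ x)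

end Lie

/-! ### Generalized connections, and the space `W` -/

section Gauged

variable {EG : Type*} [NormedAddCommGroup EG] [NormedSpace ℝ EG]
  (G : Type*) [TopologicalSpace G] [ChartedSpace EG G] [Group G]
  {E : Type*} [NormedAddCommGroup E] [NormedSpace ℝ E]
  (Q : Type*) [TopologicalSpace Q] [ChartedSpace E Q] [MulAction G Q]

/-- The lift of the action to `T^* Q`: `g (q, p) = (g q, p ∘ (T_q g)⁻¹)`. -/
def cotangentLift {G Q : Type*} [Group G] [TopologicalSpace Q] [ChartedSpace E Q] [MulAction G Q]
    (g : G) (z : CotangentBundle E Q) : CotangentBundle E Q :=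
  ⟨g • z.1, ContinuousLinearMap.comp (z.2 : TangentSpace 𝓘(ℝ, E) z.1 →L[ℝ] ℝ)
    (mfderiv 𝓘(ℝ, E) 𝓘(ℝ, E) (fun x : Q => g • x) z.1).inverse⟩

variable {Q} in
/-- The canonical momentum map `⟨μ(q, p), X⟩ = ⟨p, ζ_X(q)⟩` on `T^* Q`. -/
def momentum (z : CotangentBundle E Q) : EG →L[ℝ] ℝ :=
  ContinuousLinearMap.comp (z.2 : TangentSpace 𝓘(ℝ, E) z.1 →L[ℝ] ℝ) (zeta G 𝓘(ℝ, E) z.1)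

/-- A generalized connection form: a smooth 1-form `A : TQ → 𝔤` which is `G`-equivariant and
satisfies `ζ ∘ A ∘ ζ = ζ`. -/
structure GenConnection (EG : Type*) [NormedAddCommGroup EG] [NormedSpace ℝ EG]
    (G : Type*) [TopologicalSpace G] [ChartedSpace EG G] [Group G]
    (E : Type*) [NormedAddCommGroup E] [NormedSpace ℝ E]
    (Q : Type*) [TopologicalSpace Q] [ChartedSpace E Q] [IsManifold 𝓘(ℝ, E) ∞ Q]
    [MulAction G Q] where
  toFun : ∀ q : Q, TangentSpace 𝓘(ℝ, E) q →L[ℝ] EG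
  smooth : ContMDiff 𝓘(ℝ, E).tangent 𝓘(ℝ, EG) ∞
    (fun v : TangentBundle 𝓘(ℝ, E) Q => toFun v.1 v.2)
  equivariant : ∀ (g : G) (q : Q) (v : TangentSpace 𝓘(ℝ, E) q),
    toFun (g • q) (mfderiv 𝓘(ℝ, E) 𝓘(ℝ, E) (fun x : Q => g • x) q v) = Ad g (toFun q v)
  reproduces : ∀ (q : Q) (X : EG),
    zeta G 𝓘(ℝ, E) q (toFun q (zeta G 𝓘(ℝ, E) q X)) = zeta G 𝓘(ℝ, E) q X

/-- The isotropy Lie algebra `𝔤_q`, the kernel of `ζ(q)`. -/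
def isotropyAlg (EG : Type*) [NormedAddCommGroup EG] [NormedSpace ℝ EG]
    (G : Type*) [TopologicalSpace G] [ChartedSpace EG G] [Group G]
    (E : Type*) [NormedAddCommGroup E] [NormedSpace ℝ E]
    {Q : Type*} [TopologicalSpace Q] [ChartedSpace E Q] [MulAction G Q] (q : Q) :
    Submodule ℝ EG :=
  LinearMap.ker (zeta G 𝓘(ℝ, E) q : EG →L[ℝ] TangentSpace 𝓘(ℝ, E) q).toLinearMap

/-- The annihilator `Ann 𝔤_q` of the isotropy Lie algebra in `𝔤^*`. -/
def annIsotropy (EG : Type*) [NormedAddCommGroup EG] [NormedSpace ℝ EG]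
    (G : Type*) [TopologicalSpace G] [ChartedSpace EG G] [Group G]
    (E : Type*) [NormedAddCommGroup E] [NormedSpace ℝ E]
    {Q : Type*} [TopologicalSpace Q] [ChartedSpace E Q] [MulAction G Q] (q : Q) :
    Submodule ℝ (EG →L[ℝ] ℝ) where
  carrier := {lam | ∀ X ∈ isotropyAlg EG G E q, lam X = 0}
  add_mem' := fun ha hb X hX => by simp [ha X hX, hb X hX]
  zero_mem' := fun X _ => rfl
  smul_mem' := fun c a ha X hX => by simp [ha X hX]

/-- The orbit projection `π : Q → Q/G`. -/
def orbitProj (G : Type*) [Group G] {Q : Type*} [MulAction G Q] (q : Q) : MulAction.orbitRel.Quotient G Q :=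
  Quotient.mk _ q

/-- The space `W = (Q ×_{Q/G} T^*(Q/G)) ×_Q ⨆_q Ann 𝔤_q`, with elements `(q, η, λ)`. -/
@[ext]
structure WSpace (EG : Type*) [NormedAddCommGroup EG] [NormedSpace ℝ EG]
    (G : Type*) [TopologicalSpace G] [ChartedSpace EG G] [Group G]
    (E : Type*) [NormedAddCommGroup E] [NormedSpace ℝ E]
    (Q : Type*) [TopologicalSpace Q] [ChartedSpace E Q] [MulAction G Q]
    (EB : Type*) [NormedAddCommGroup EB] [NormedSpace ℝ EB]
    [ChartedSpace EB (MulAction.orbitRel.Quotient G Q)] where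
  /-- the base point `q ∈ Q` -/
  base : Q
  /-- the covector `η ∈ T^*_{π(q)}(Q/G)` -/
  eta : CotangentSpace EB (MulAction.orbitRel.Quotient G Q) (orbitProj G base)
  /-- the functional `λ ∈ Ann 𝔤_q` -/
  lam : annIsotropy EG G E base

variable {G Q} {EB : Type*} [NormedAddCommGroup EB] [NormedSpace ℝ EB]
  [ChartedSpace EB (MulAction.orbitRel.Quotient G Q)]

/-- The projection `W → T^*(Q/G)`, `(q, η, λ) ↦ (π(q), η)`. -/
def WSpace.toCot (w : WSpace EG G E Q EB) :
    CotangentBundle EB (MulAction.orbitRel.Quotient G Q) :=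
  ⟨orbitProj G w.base, w.eta⟩

/-- The inclusion of `W` into `Q × T^*(Q/G) × 𝔤^*`. -/
def WSpace.incl (w : WSpace EG G E Q EB) :
    Q × CotangentBundle EB (MulAction.orbitRel.Quotient G Q) × (EG →L[ℝ] ℝ) :=
  (w.base, w.toCot, (w.lam : EG →L[ℝ] ℝ))

/-- `W` carries the subspace topology of `Q × T^*(Q/G) × 𝔤^*`. -/
instance [IsManifold 𝓘(ℝ, EB) ∞ (MulAction.orbitRel.Quotient G Q)] :
    TopologicalSpace (WSpace EG G E Q EB) :=
  TopologicalSpace.induced WSpace.incl inferInstance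

variable [IsManifold 𝓘(ℝ, E) ∞ Q] (A : GenConnection EG G E Q)

/-- The generalized connection, as a `𝔤`-valued form. -/
def GenConnection.form : Form 𝓘(ℝ, E) Q EG 1 := oneForm 𝓘(ℝ, E) A.toFun

/-- The curvature `Curv^A = dA - ½ [A, A]^∧`. -/
def GenConnection.curv (q : Q) (v : Fin 2 → TangentSpace 𝓘(ℝ, E) q) : EG :=
  extD 𝓘(ℝ, E) A.form q v - (1 / 2 : ℝ) • wedge (l := 1) (k := 1) (lieBr G) (A.form q) (A.form q) v

/-- The horizontal vectors at `q`, as the kernel of the projection `ζ(q) ∘ A_q` onto the vertical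
space. It contains `ker A_q`, and equals it if the values of `A_q` lie in a complement of `𝔤_q`.
Unlike `ker A_q`, it is always a complement of the vertical space. -/
def GenConnection.hor (q : Q) : Submodule ℝ (TangentSpace 𝓘(ℝ, E) q) :=
  LinearMap.ker ((zeta G 𝓘(ℝ, E) q).comp (A.toFun q)).toLinearMap

/-- The fibre `(η, λ) ↦ (T_q π)^* η + A_q^* λ` of `ψ`, a linear map
`T^*_{π(q)}(Q/G) × Ann 𝔤_q → T_q^* Q`. -/
def psiFib (EB : Type*) [NormedAddCommGroup EB] [NormedSpace ℝ EB]
    [ChartedSpace EB (MulAction.orbitRel.Quotient G Q)] (q : Q) :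
    (CotangentSpace EB (MulAction.orbitRel.Quotient G Q) (orbitProj G q) ×
      annIsotropy EG G E q) →ₗ[ℝ]
      (TangentSpace 𝓘(ℝ, E) q →L[ℝ] ℝ) where
  toFun p := ContinuousLinearMap.comp
      (p.1 : TangentSpace 𝓘(ℝ, EB) (orbitProj G q) →L[ℝ] ℝ)
      (mfderiv 𝓘(ℝ, E) 𝓘(ℝ, EB) (orbitProj G : Q → MulAction.orbitRel.Quotient G Q) q) +
    (p.2 : EG →L[ℝ] ℝ).comp (A.toFun q)
  map_add' x y := by
    ext v
    exact add_add_add_comm _ _ _ _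
  map_smul' c x := by
    ext v
    exact (mul_add _ _ _).symm

/-- The map `ψ : W → T^* Q`, `(q, η, λ) ↦ (q, (T_q π)^* η + A_q^* λ)`. -/
def psi (w : WSpace EG G E Q EB) : CotangentBundle E Q :=
  ⟨w.base, psiFib A EB w.base (w.eta, w.lam)⟩

/-- `μ_A = μ ∘ ψ : W → 𝔤^*`. -/
def muA (w : WSpace EG G E Q EB) : EG →L[ℝ] ℝ := momentum G (psi A w)

variable [IsManifold 𝓘(ℝ, EB) ∞ (MulAction.orbitRel.Quotient G Q)]
  [ChartedSpace (ModelProd E (E →L[ℝ] ℝ)) (WSpace EG G E Q EB)]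

/-- The form `σ = ψ^* Ω` on `W`. -/
def sigma : Form (cotModel E) (WSpace EG G E Q EB) ℝ 2 :=
  pullback (cotModel E) (cotModel E) (psi A) (canonicalForm E Q)

/-- The pull-back of the connection form along `W → Q`. -/
def connW : Form (cotModel E) (WSpace EG G E Q EB) EG 1 :=
  pullback (cotModel E) 𝓘(ℝ, E) WSpace.base A.form

/-- The 1-form `B = ⟨μ_A, A⟩` on `W`. -/
def formB : Form (cotModel E) (WSpace EG G E Q EB) ℝ 1 :=
  fun w => (muA A w).compContinuousAlternatingMap (connW A w)

/-- The derivative `dμ_A`, a `𝔤^*`-valued 1-form on `W`. -/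
def dmuA (w : WSpace EG G E Q EB) : TangentSpace (cotModel E) w →L[ℝ] (EG →L[ℝ] ℝ) :=
  mfderiv (cotModel E) 𝓘(ℝ, EG →L[ℝ] ℝ) (muA A) w

/-- The tangent map of the projection `W → Q`. -/
def dbase (w : WSpace EG G E Q EB) :
    TangentSpace (cotModel E) w →L[ℝ] TangentSpace 𝓘(ℝ, E) w.base :=
  mfderiv (cotModel E) 𝓘(ℝ, E) (WSpace.base : WSpace EG G E Q EB → Q) w

end Gauged

end GaugedCotangent

end

/-! Pairing `ψ(q, η, λ)` with a fundamental vector `ζ_X(q)` returns `λ(X)`: `Tπ` kills that vector,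
and `ζ ∘ A ∘ ζ = ζ` puts `A(ζ_X) - X` into `𝔤_q`, where `λ` vanishes. Hence a covector `p`
determines `λ = p ∘ ζ`, and the remainder `p - λ ∘ A`, which vanishes on fundamental vectors,
determines `η` once it is known to descend along the surjection `Tπ`. This requires that `ker Tπ`
consists of fundamental vectors (`exists_zeta_eq_of_mfderiv_orbitProj_eq_zero`), the analytic core.
A kernel vector is tangent to a curve inside an orbit; properness lifts this curve, along an
ultrafilter, to group elements which may be taken to tend to `1`. If these are chosen of nearly
minimal size, they are of the order of the curve parameter, since otherwise multiplication by
isotropy elements would shorten them (`exists_zeta_eq_of_isLittleO`). Their limiting direction is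
the required `X`.

In frames, `ψ` and its inverse are given by smooth formulas on `Q × T^*(Q/G) × 𝔤^*` and on `T^*Q`.
So `ψ` is a homeomorphism for the subspace topology on `W`, the manifold structure of `T^*Q` is
transported along it, and the inclusion of `W` becomes an embedding.

The symplectic statements rest on `ψ^*θ = p^*θ^{Q/G} + B` (`formBMap_eq`). Naturality of `d` turns
it into `σ = p^*Ω^{Q/G} - dB`. The form `ψ^*θ` is invariant and takes the value `⟨λ, X⟩` on the
fundamental vector of `X`, so Cartan's formula (`extD_invariant_zeta`) is the Hamiltonian property.
The first formula for `dB` is the product rule.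

For the explicit formula write `A(q_i') = Z_i + Y_i` with `Y_i ∈ 𝔤_q`; the terms in `Y_i` have to
cancel. Let `b(X, Y)` be `λ ∘ A` applied to the linearization of `ζ_X` in the direction `ζ_Y(q)`.
Then `⟨λ, [X, Y]⟩ = b(X, Y) - b(Y, X)` (`lam_lieBr`), and differentiating `λ(A(ζ_Y)) = λ(Y)` gives
`⟨λ_i', Y⟩ = b(Y, Z_i)` for `Y ∈ 𝔤_q` (`dmuA_apply_of_zeta_eq_zero`). The latter uses that the
linearization of `ζ_Y` kills horizontal vectors, because the isotropy group fixes them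
(`coframe_mfderiv_smul_of_hor`). -/

set_option linter.unusedSectionVars false

noncomputable section

namespace GaugedCotangent

/-! ### Frames from the preferred charts -/

section Frames

variable {E H M : Type*} [NormedAddCommGroup E] [NormedSpace ℝ E] [TopologicalSpace H]
  (I : ModelWithCorners ℝ E H) [TopologicalSpace M] [ChartedSpace H M] [IsManifold I 1 M]
  {E' H' M' : Type*} [NormedAddCommGroup E'] [NormedSpace ℝ E'] [TopologicalSpace H']
  (I' : ModelWithCorners ℝ E' H') [TopologicalSpace M'] [ChartedSpace H' M'] [IsManifold I' 1 M']

/-- The frame of the tangent bundle at `x` given by the preferred chart at `x₀`. -/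
def frame (x₀ x : M) : E →L[ℝ] TangentSpace I x :=
  (trivializationAt E (TangentSpace I) x₀).symmL ℝ x

/-- The coframe of the tangent bundle at `x` given by the preferred chart at `x₀`. -/
def coframe (x₀ x : M) : TangentSpace I x →L[ℝ] E :=
  (trivializationAt E (TangentSpace I) x₀).continuousLinearMapAt ℝ x

variable {I I'}

lemma coframe_frame {x₀ x : M} (hx : x ∈ (chartAt H x₀).source) (e : E) :
    coframe I x₀ x (frame I x₀ x e) = e :=
  Trivialization.continuousLinearMapAt_symmL _ (by simpa using hx) e

lemma frame_coframe {x₀ x : M} (hx : x ∈ (chartAt H x₀).source) (v : TangentSpace I x) :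
    frame I x₀ x (coframe I x₀ x v) = v :=
  Trivialization.symmL_continuousLinearMapAt _ (by simpa using hx) v

lemma mfderivWithin_symm_eq_frame {x₀ : M} {y : E} (hy : y ∈ (extChartAt I x₀).target) :
    mfderivWithin 𝓘(ℝ, E) I (extChartAt I x₀).symm (Set.range I) y =
      frame I x₀ ((extChartAt I x₀).symm y) := by
  have h := TangentBundle.symmL_trivializationAt (I := I) (x₀ := x₀)
    (x := (extChartAt I x₀).symm y) (by simpa using (extChartAt I x₀).map_target hy)
  rw [(extChartAt I x₀).right_inv hy] at h
  exact h.symm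

lemma mfderiv_chart_eq_coframe {x₀ x : M} (hx : x ∈ (chartAt H x₀).source) :
    mfderiv I 𝓘(ℝ, E) (extChartAt I x₀) x = coframe I x₀ x :=
  (TangentBundle.continuousLinearMapAt_trivializationAt hx).symm

variable [I.Boundaryless]

lemma mfderiv_symm_eq_frame {x₀ : M} {y : E} (hy : y ∈ (extChartAt I x₀).target) :
    mfderiv 𝓘(ℝ, E) I (extChartAt I x₀).symm y = frame I x₀ ((extChartAt I x₀).symm y) := by
  rw [← mfderivWithin_symm_eq_frame hy, I.range_eq_univ, mfderivWithin_univ]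

lemma mdifferentiableAt_chart_symm {x₀ : M} {y : E} (hy : y ∈ (extChartAt I x₀).target) :
    MDifferentiableAt 𝓘(ℝ, E) I (extChartAt I x₀).symm y := by
  have := mdifferentiableWithinAt_extChartAt_symm (I := I) hy
  rwa [I.range_eq_univ, mdifferentiableWithinAt_univ] at this

lemma target_mem_nhds {x₀ : M} {y : E} (hy : y ∈ (extChartAt I x₀).target) :
    (extChartAt I x₀).target ∈ 𝓝 y :=
  (isOpen_extChartAt_target (I := I) x₀).mem_nhds hy

/-- The derivative of a map read in charts. -/
lemma fderiv_readInCharts {f : M → M'} {x₀ : M} {x₀' : M'} {y : E}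
    (hy : y ∈ (extChartAt I x₀).target)
    (hf : MDifferentiableAt I I' f ((extChartAt I x₀).symm y))
    (hx' : f ((extChartAt I x₀).symm y) ∈ (chartAt H' x₀').source) (u : E) :
    fderiv ℝ (fun y => extChartAt I' x₀' (f ((extChartAt I x₀).symm y))) y u =
      coframe I' x₀' _ (mfderiv I I' f ((extChartAt I x₀).symm y)
        (frame I x₀ ((extChartAt I x₀).symm y) u)) := by
  have h1 : MDifferentiableAt I' 𝓘(ℝ, E') (extChartAt I' x₀') (f ((extChartAt I x₀).symm y)) :=
    mdifferentiableAt_extChartAt hx'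
  have h2 := mdifferentiableAt_chart_symm hy
  have h3 : HasMFDerivAt 𝓘(ℝ, E) 𝓘(ℝ, E')
      (fun y => extChartAt I' x₀' (f ((extChartAt I x₀).symm y))) y _ :=
    h1.hasMFDerivAt.comp y (hf.hasMFDerivAt.comp y h2.hasMFDerivAt)
  rw [mfderiv_symm_eq_frame hy, mfderiv_chart_eq_coframe hx'] at h3
  have h4 : HasFDerivAt (fun y => extChartAt I' x₀' (f ((extChartAt I x₀).symm y)))
      (((coframe I' x₀' (f ((extChartAt I x₀).symm y))).comp
        ((mfderiv I I' f ((extChartAt I x₀).symm y)).comp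
          (frame I x₀ ((extChartAt I x₀).symm y))) : E →L[ℝ] E')) y := h3.hasFDerivAt
  rw [h4.fderiv]
  rfl

end Frames

end GaugedCotangent

end

noncomputable section

namespace GaugedCotangent

/-! ### Naturality of the exterior derivative -/

section Naturality

variable {E H M : Type*} [NormedAddCommGroup E] [NormedSpace ℝ E] [TopologicalSpace H]
  {I : ModelWithCorners ℝ E H} [TopologicalSpace M] [ChartedSpace H M] [IsManifold I ∞ M]
  {E' H' M' : Type*} [NormedAddCommGroup E'] [NormedSpace ℝ E'] [TopologicalSpace H']
  {I' : ModelWithCorners ℝ E' H'} [TopologicalSpace M'] [ChartedSpace H' M'] [IsManifold I' ∞ M']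
  {V : Type*} [NormedAddCommGroup V] [NormedSpace ℝ V] {n : ℕ}

lemma minSmoothness_two_le_infty : minSmoothness ℝ 2 ≤ ∞ := by
  simpa using ENat.LEInfty.out

lemma chartRep_apply (Φ : Form I M V n) {x₀ x : M} (hx : x ∈ (chartAt H x₀).source)
    (w : Fin n → E) :
    chartRep I Φ x₀ (extChartAt I x₀ x) w = Φ x (fun i => frame I x₀ x (w i)) := by
  have hx' : x ∈ (extChartAt I x₀).source := by simpa using hx
  have h1 : chartRep I Φ x₀ (extChartAt I x₀ x) w =
      Φ ((extChartAt I x₀).symm (extChartAt I x₀ x))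
        (fun i => frame I x₀ ((extChartAt I x₀).symm (extChartAt I x₀ x)) (w i)) := by
    rw [← mfderivWithin_symm_eq_frame ((extChartAt I x₀).map_source hx')]
    rfl
  rw [h1]
  exact congrArg (fun p => Φ p (fun i => frame I x₀ p (w i))) ((extChartAt I x₀).left_inv hx')

variable [I.Boundaryless] [I'.Boundaryless]

/-- The representatives of a form on a manifold and of its pull-back are related by pull-back
along the map read in charts. -/
lemma chartRep_pullback_eventuallyEq {f : M → M'} {x₀ x : M} {x₀' : M'}
    (hx : x ∈ (chartAt H x₀).source) (hx' : f x ∈ (chartAt H' x₀').source)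
    (hf : ContMDiffAt I I' ∞ f x) (Φ : Form I' M' V n) :
    chartRep I (pullback I I' f Φ) x₀ =ᶠ[𝓝 (extChartAt I x₀ x)] fun y =>
      (chartRep I' Φ x₀' (extChartAt I' x₀' (f ((extChartAt I x₀).symm y)))).compContinuousLinearMap
        (fderiv ℝ (fun y => extChartAt I' x₀' (f ((extChartAt I x₀).symm y))) y) := by
  have hxs : x ∈ (extChartAt I x₀).source := by simpa using hx
  have hc : ContinuousAt (extChartAt I x₀).symm (extChartAt I x₀ x) :=
    continuousAt_extChartAt_symm' hxs
  have e : (extChartAt I x₀).symm (extChartAt I x₀ x) = x := (extChartAt I x₀).left_inv hxs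
  have h1 : ∀ᶠ y in 𝓝 (extChartAt I x₀ x), ContMDiffAt I I' 1 f ((extChartAt I x₀).symm y) := by
    apply hc.eventually
    rw [e]
    have hf1 : ContMDiffAt I I' 1 f x := hf.of_le (by norm_cast)
    exact (contMDiffAt_iff_contMDiffAt_nhds (by simp)).1 hf1
  have h2 : ∀ᶠ y in 𝓝 (extChartAt I x₀ x),
      f ((extChartAt I x₀).symm y) ∈ (chartAt H' x₀').source := by
    have hc' : ContinuousAt (fun y => f ((extChartAt I x₀).symm y)) (extChartAt I x₀ x) := by
      apply ContinuousAt.comp (g := f) _ hc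
      rw [e]; exact hf.continuousAt
    apply hc'.eventually
    simp only [e]
    exact (chartAt H' x₀').open_source.mem_nhds hx'
  filter_upwards [h1, h2, target_mem_nhds ((extChartAt I x₀).map_source hxs)] with y h1 h2 h3
  ext w
  have h4 : (extChartAt I x₀).symm y ∈ (chartAt H x₀).source := by
    simpa using (extChartAt I x₀).map_target h3
  have h5 := chartRep_apply (pullback I I' f Φ) h4 w
  rw [(extChartAt I x₀).right_inv h3] at h5
  rw [h5, ContinuousAlternatingMap.compContinuousLinearMap_apply]
  have h6 := chartRep_apply Φ h2 ((fderiv ℝ (fun y =>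
    extChartAt I' x₀' (f ((extChartAt I x₀).symm y))) y) ∘ w)
  rw [h6]
  simp only [pullback]
  change Φ _ (fun i => mfderiv I I' f _ (frame I x₀ _ (w i))) = _
  congr 1
  ext i
  simp only [Function.comp]
  rw [fderiv_readInCharts h3 (h1.mdifferentiableAt (by simp)) h2, frame_coframe h2]

lemma contDiffAt_readInCharts {f : M → M'} {x₀ x : M} {x₀' : M'}
    (hx : x ∈ (chartAt H x₀).source) (hx' : f x ∈ (chartAt H' x₀').source)
    (hf : ContMDiffAt I I' ∞ f x) :
    ContDiffAt ℝ ∞ (fun y => extChartAt I' x₀' (f ((extChartAt I x₀).symm y)))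
      (extChartAt I x₀ x) := by
  have := ((contMDiffAt_iff_of_mem_source hx hx').1 hf).2
  rwa [I.range_eq_univ, contDiffWithinAt_univ] at this

/-- Naturality of the exterior derivative in the model space, applied to `f` read in charts. The
charts need not be the preferred ones of the points, so that `f = id` compares two charts of one
manifold. -/
lemma extDeriv_chartRep_pullback {f : M → M'} {x₀ x : M} {x₀' : M'}
    (hx : x ∈ (chartAt H x₀).source) (hx' : f x ∈ (chartAt H' x₀').source)
    (hf : ContMDiffAt I I' ∞ f x) (Φ : Form I' M' V n)
    (hΦ : DifferentiableAt ℝ (chartRep I' Φ x₀') (extChartAt I' x₀' (f x)))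
    (v : Fin (n + 1) → E) :
    extDeriv (chartRep I (pullback I I' f Φ) x₀) (extChartAt I x₀ x) v =
      extDeriv (chartRep I' Φ x₀') (extChartAt I' x₀' (f x))
        (fun i => coframe I' x₀' (f x) (mfderiv I I' f x (frame I x₀ x (v i)))) := by
  have hxs : x ∈ (extChartAt I x₀).source := by simpa using hx
  have e : (extChartAt I x₀).symm (extChartAt I x₀ x) = x := (extChartAt I x₀).left_inv hxs
  rw [(chartRep_pullback_eventuallyEq hx hx' hf Φ).extDeriv_eq, extDeriv_pullback (r := ∞)]
  · rw [ContinuousAlternatingMap.compContinuousLinearMap_apply]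
    have h3 := (extChartAt I x₀).map_source hxs
    have key : ∀ u, fderiv ℝ (fun y => extChartAt I' x₀' (f ((extChartAt I x₀).symm y)))
        (extChartAt I x₀ x) u = coframe I' x₀' (f x) (mfderiv I I' f x (frame I x₀ x u)) := by
      intro u
      rw [fderiv_readInCharts h3]
      · exact congrArg (fun p => coframe I' x₀' (f p) (mfderiv I I' f p (frame I x₀ p u))) e
      · rw [e]; exact hf.mdifferentiableAt (by simp)
      · rwa [e]
    rw [e]
    congr 1
    ext i
    exact key (v i)
  · rwa [e]
  · exact contDiffAt_readInCharts hx hx' hf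
  · exact minSmoothness_two_le_infty

lemma pullback_id (Φ : Form I M V n) : pullback I I id Φ = Φ := by
  funext x
  simp only [pullback, mfderiv_id]
  rfl

/-- The exterior derivative can be computed in any preferred chart around the point. -/
lemma extD_apply (Φ : Form I M V n) {x₀ x : M} (hx : x ∈ (chartAt H x₀).source)
    (hΦ : DifferentiableAt ℝ (chartRep I Φ x₀) (extChartAt I x₀ x))
    (v : Fin (n + 1) → TangentSpace I x) :
    extD I Φ x v = extDeriv (chartRep I Φ x₀) (extChartAt I x₀ x)
      (fun i => coframe I x₀ x (v i)) := by
  -- A change of charts is the identity map read in two charts, so chart independence is naturality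
  -- for `id`.
  have h := extDeriv_chartRep_pullback (f := id) (mem_chart_source H x) hx
    contMDiffAt_id Φ hΦ (fun i => coframe I x x (v i))
  rw [pullback_id] at h
  have h2 : extD I Φ x v = extDeriv (chartRep I Φ x) (extChartAt I x x)
      (fun i => coframe I x x (v i)) := by
    simp only [extD]
    rw [I.range_eq_univ, extDerivWithin_univ, mfderiv_chart_eq_coframe (mem_chart_source H x)]
    rfl
  rw [h2, h]
  congr 1
  ext i
  rw [frame_coframe (mem_chart_source H x), mfderiv_id]
  rfl

theorem extD_pullback {f : M → M'} {x : M} (hf : ContMDiffAt I I' ∞ f x) (Φ : Form I' M' V n)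
    (hΦ : DifferentiableAt ℝ (chartRep I' Φ (f x)) (extChartAt I' (f x) (f x)))
    (hΦ' : DifferentiableAt ℝ (chartRep I (pullback I I' f Φ) x) (extChartAt I x x)) :
    extD I (pullback I I' f Φ) x =
      (extD I' Φ (f x)).compContinuousLinearMap (mfderiv I I' f x) := by
  ext v
  rw [extD_apply _ (mem_chart_source H x) hΦ', extDeriv_chartRep_pullback (mem_chart_source H x)
    (mem_chart_source H' (f x)) hf Φ hΦ]
  change _ = extD I' Φ (f x) (fun i => mfderiv I I' f x (v i))
  rw [extD_apply _ (mem_chart_source H' (f x)) hΦ]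
  congr 1
  ext i
  rw [frame_coframe (mem_chart_source H x)]

end Naturality

end GaugedCotangent

end

noncomputable section

namespace GaugedCotangent

/-! ### Smooth one-forms -/

section OneForms

variable {E H M : Type*} [NormedAddCommGroup E] [NormedSpace ℝ E] [TopologicalSpace H]
  {I : ModelWithCorners ℝ E H} [TopologicalSpace M] [ChartedSpace H M] [IsManifold I ∞ M]
  {E' H' M' : Type*} [NormedAddCommGroup E'] [NormedSpace ℝ E'] [TopologicalSpace H']
  {I' : ModelWithCorners ℝ E' H'} [TopologicalSpace M'] [ChartedSpace H' M'] [IsManifold I' ∞ M']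
  {V : Type*} [NormedAddCommGroup V] [NormedSpace ℝ V] {n : ℕ}

variable (E V) in
/-- Linear maps as alternating maps in one variable. -/
def ofSubsing : (E →L[ℝ] V) ≃ₗᵢ[ℝ] E [⋀^Fin 1]→L[ℝ] V :=
  ContinuousAlternatingMap.ofSubsingletonLIE (𝕜 := ℝ) (i := (0 : Fin 1)) (E := E) (F := V)

/-- The expression of a one-form in the preferred chart at `x₀`. -/
def rep1 (α : ∀ x : M, TangentSpace I x →L[ℝ] V) (x₀ : M) (y : E) : E →L[ℝ] V :=
  (α ((extChartAt I x₀).symm y)).comp (frame I x₀ ((extChartAt I x₀).symm y))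

/-- A one-form is smooth if its expressions in the preferred charts are. -/
def SmoothOneForm (α : ∀ x : M, TangentSpace I x →L[ℝ] V) : Prop :=
  ∀ x₀ x : M, x ∈ (chartAt H x₀).source → ContDiffAt ℝ ∞ (rep1 α x₀) (extChartAt I x₀ x)

lemma rep1_apply (α : ∀ x : M, TangentSpace I x →L[ℝ] V) {x₀ x : M}
    (hx : x ∈ (chartAt H x₀).source) (u : E) :
    rep1 α x₀ (extChartAt I x₀ x) u = α x (frame I x₀ x u) := by
  have hx' : x ∈ (extChartAt I x₀).source := by simpa using hx
  exact congrArg (fun p => α p (frame I x₀ p u)) ((extChartAt I x₀).left_inv hx')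

variable [I.Boundaryless] [I'.Boundaryless]

/-- Points near a chart image are presented as images of points `z` of the manifold. Identities in
the varying tangent spaces can then be checked at `z` itself, with no transport between fibres. -/
lemma eventually_chart {x₀ x : M} (hx : x ∈ (chartAt H x₀).source) {P : M → Prop}
    (h : ∀ᶠ z in 𝓝 x, P z) :
    ∀ᶠ y in 𝓝 (extChartAt I x₀ x), ∃ z ∈ (chartAt H x₀).source, y = extChartAt I x₀ z ∧
      (extChartAt I x₀).symm y = z ∧ P z := by
  have hxs : x ∈ (extChartAt I x₀).source := by simpa using hx
  have hc : ContinuousAt (extChartAt I x₀).symm (extChartAt I x₀ x) :=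
    continuousAt_extChartAt_symm' hxs
  have h1 : ∀ᶠ y in 𝓝 (extChartAt I x₀ x), P ((extChartAt I x₀).symm y) := by
    apply hc.eventually
    rwa [(extChartAt I x₀).left_inv hxs]
  filter_upwards [h1, target_mem_nhds ((extChartAt I x₀).map_source hxs)] with y h1 h3
  exact ⟨_, by simpa using (extChartAt I x₀).map_target h3,
    ((extChartAt I x₀).right_inv h3).symm, rfl, h1⟩

lemma chartRep_oneForm (α : ∀ x : M, TangentSpace I x →L[ℝ] V) {x₀ x : M}
    (hx : x ∈ (chartAt H x₀).source) :
    chartRep I (oneForm I α) x₀ =ᶠ[𝓝 (extChartAt I x₀ x)] fun y =>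
      ofSubsing E V (rep1 α x₀ y) := by
  filter_upwards [eventually_chart hx (Filter.Eventually.of_forall fun _ => trivial)]
    with y ⟨z, hz, hy, hyz, _⟩
  ext w
  rw [hy, chartRep_apply _ hz]
  exact (rep1_apply α hz (w 0)).symm

lemma SmoothOneForm.contDiffAt_chartRep {α : ∀ x : M, TangentSpace I x →L[ℝ] V}
    (hα : SmoothOneForm α) {x₀ x : M} (hx : x ∈ (chartAt H x₀).source) :
    ContDiffAt ℝ ∞ (chartRep I (oneForm I α) x₀) (extChartAt I x₀ x) := by
  refine ContDiffAt.congr_of_eventuallyEq ?_ (chartRep_oneForm α hx)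
  exact (ofSubsing E V).contDiff.contDiffAt.comp _
    (hα x₀ x hx)

lemma SmoothOneForm.differentiableAt {α : ∀ x : M, TangentSpace I x →L[ℝ] V}
    (hα : SmoothOneForm α) {x₀ x : M} (hx : x ∈ (chartAt H x₀).source) :
    DifferentiableAt ℝ (rep1 α x₀) (extChartAt I x₀ x) :=
  (hα x₀ x hx).differentiableAt (by simp)

/-- The exterior derivative of a one-form in the preferred chart at `x₀`. -/
lemma extD_oneForm_apply {α : ∀ x : M, TangentSpace I x →L[ℝ] V} (hα : SmoothOneForm α)
    {x₀ x : M} (hx : x ∈ (chartAt H x₀).source) (v : Fin 2 → TangentSpace I x) :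
    extD I (oneForm I α) x v =
      fderiv ℝ (rep1 α x₀) (extChartAt I x₀ x) (coframe I x₀ x (v 0)) (coframe I x₀ x (v 1)) -
      fderiv ℝ (rep1 α x₀) (extChartAt I x₀ x) (coframe I x₀ x (v 1)) (coframe I x₀ x (v 0)) := by
  rw [extD_apply _ hx ((hα.contDiffAt_chartRep hx).differentiableAt (by simp)),
    (chartRep_oneForm α hx).extDeriv_eq, extDeriv_apply]
  · have h : ∀ (u w : E), fderiv ℝ (fun y => rep1 α x₀ y w) (extChartAt I x₀ x) u =
        fderiv ℝ (rep1 α x₀) (extChartAt I x₀ x) u w := by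
      intro u w
      rw [fderiv_clm_apply (hα.differentiableAt hx) (differentiableAt_const w)]
      simp
    rw [Fin.sum_univ_two, ← h, ← h, sub_eq_add_neg]
    simp only [Fin.val_zero, pow_zero, one_smul, Fin.val_one, pow_one, neg_smul]
    rfl
  · exact ((ofSubsing E V).differentiableAt).comp _
      (hα.differentiableAt hx)

lemma pullback_oneForm (f : M → M') (α : ∀ x : M', TangentSpace I' x →L[ℝ] V) :
    pullback I I' f (oneForm I' α) =
      oneForm I (fun x => (α (f x)).comp (mfderiv I I' f x)) := rfl

lemma rep1_pullback {f : M → M'} (α : ∀ x : M', TangentSpace I' x →L[ℝ] V)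
    {x₀ x : M} {x₀' : M'} (hf : ContMDiffAt I I' ∞ f x)
    (hx : x ∈ (chartAt H x₀).source) (hx' : f x ∈ (chartAt H' x₀').source) :
    rep1 (fun x => (α (f x)).comp (mfderiv I I' f x)) x₀ =ᶠ[𝓝 (extChartAt I x₀ x)] fun y =>
      (rep1 α x₀' (extChartAt I' x₀' (f ((extChartAt I x₀).symm y)))).comp
        (fderiv ℝ (fun y => extChartAt I' x₀' (f ((extChartAt I x₀).symm y))) y) := by
  have h1 : ∀ᶠ z in 𝓝 x, ContMDiffAt I I' 1 f z := by
    have hf1 : ContMDiffAt I I' 1 f x := hf.of_le (by norm_cast)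
    exact (contMDiffAt_iff_contMDiffAt_nhds (by simp)).1 hf1
  have h2 : ∀ᶠ z in 𝓝 x, f z ∈ (chartAt H' x₀').source :=
    hf.continuousAt.eventually ((chartAt H' x₀').open_source.mem_nhds hx')
  filter_upwards [eventually_chart hx (h1.and h2)] with y ⟨z, hz, hy, hyz, h1, h2⟩
  subst hyz
  have hyt : y ∈ (extChartAt I x₀).target := by
    rw [hy]; exact (extChartAt I x₀).map_source (by simpa using hz)
  ext u
  rw [ContinuousLinearMap.comp_apply, rep1_apply α h2,
    fderiv_readInCharts hyt (h1.mdifferentiableAt (by simp)) h2, frame_coframe h2]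
  rfl

lemma SmoothOneForm.comp_mfderiv {f : M → M'} (hf : ContMDiff I I' ∞ f)
    {α : ∀ x : M', TangentSpace I' x →L[ℝ] V} (hα : SmoothOneForm α) :
    SmoothOneForm (fun x => (α (f x)).comp (mfderiv I I' f x)) := by
  intro x₀ x hx
  have hxs : x ∈ (extChartAt I x₀).source := by simpa using hx
  have hx' := mem_chart_source H' (f x)
  refine ContDiffAt.congr_of_eventuallyEq ?_ (rep1_pullback α (hf x) hx hx')
  have hF := contDiffAt_readInCharts hx hx' (hf x)
  have h1 : ContDiffAt ℝ ∞ (rep1 α (f x))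
      (extChartAt I' (f x) (f ((extChartAt I x₀).symm (extChartAt I x₀ x)))) := by
    rw [(extChartAt I x₀).left_inv hxs]
    exact hα _ _ hx'
  have h2 := ContDiffAt.comp (extChartAt I x₀ x) h1 hF
  exact h2.clm_comp (hF.fderiv_right (m := ∞) (by norm_cast))

lemma SmoothOneForm.extD_pullback {f : M → M'} (hf : ContMDiff I I' ∞ f)
    {α : ∀ x : M', TangentSpace I' x →L[ℝ] V} (hα : SmoothOneForm α) (x : M) :
    extD I (pullback I I' f (oneForm I' α)) x =
      (extD I' (oneForm I' α) (f x)).compContinuousLinearMap (mfderiv I I' f x) :=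
  GaugedCotangent.extD_pullback (hf x) _
    ((hα.contDiffAt_chartRep (mem_chart_source _ _)).differentiableAt (by simp))
    (((hα.comp_mfderiv hf).contDiffAt_chartRep (mem_chart_source _ _)).differentiableAt (by simp))

lemma rep1_sub (α β : ∀ x : M, TangentSpace I x →L[ℝ] V) (x₀ : M) :
    rep1 (fun x => α x - β x) x₀ = rep1 α x₀ - rep1 β x₀ := rfl

lemma SmoothOneForm.sub {α β : ∀ x : M, TangentSpace I x →L[ℝ] V} (hα : SmoothOneForm α)
    (hβ : SmoothOneForm β) : SmoothOneForm (fun x => α x - β x) := by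
  intro x₀ x hx
  rw [rep1_sub]
  exact (hα x₀ x hx).sub (hβ x₀ x hx)

lemma SmoothOneForm.extD_sub {α β : ∀ x : M, TangentSpace I x →L[ℝ] V} (hα : SmoothOneForm α)
    (hβ : SmoothOneForm β) (x : M) :
    extD I (oneForm I fun x => α x - β x) x = extD I (oneForm I α) x - extD I (oneForm I β) x := by
  ext v
  have hx := mem_chart_source H x
  rw [ContinuousAlternatingMap.sub_apply, extD_oneForm_apply (hα.sub hβ) hx,
    extD_oneForm_apply hα hx, extD_oneForm_apply hβ hx, rep1_sub,
    fderiv_sub (hα.differentiableAt hx) (hβ.differentiableAt hx)]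
  simp only [_root_.sub_apply]
  abel

/-- The square of the exterior derivative vanishes on smooth one-forms. -/
lemma SmoothOneForm.extD_extD {α : ∀ x : M, TangentSpace I x →L[ℝ] V} (hα : SmoothOneForm α)
    (x : M) : extD I (extD I (oneForm I α)) x = 0 := by
  have hx := mem_chart_source H x
  -- By definition `extD` at a nearby point uses that point's own chart. Chart independence replaces
  -- it by the chart at `x`, so that `d² = 0` in the model space applies.
  have h : chartRep I (extD I (oneForm I α)) x =ᶠ[𝓝 (extChartAt I x x)]
      extDeriv (chartRep I (oneForm I α) x) := by
    filter_upwards [eventually_chart hx (Filter.Eventually.of_forall fun _ => trivial)]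
      with y ⟨z, hz, hy, hyz, _⟩
    ext w
    rw [hy, chartRep_apply _ hz, extD_apply _ hz
      ((hα.contDiffAt_chartRep hz).differentiableAt (by simp))]
    congr 1
    ext i
    exact coframe_frame hz _
  have hs := hα.contDiffAt_chartRep hx
  have h2 : extDeriv (chartRep I (extD I (oneForm I α)) x) (extChartAt I x x) = 0 := by
    rw [h.extDeriv_eq]
    exact extDeriv_extDeriv_apply hs minSmoothness_two_le_infty
  unfold extD at h2 ⊢
  simp only [I.range_eq_univ, extDerivWithin_univ] at h2 ⊢
  rw [h2]
  rfl

variable (I) in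
/-- The differential of a vector valued function. -/
def diff (f : M → V) (x : M) : TangentSpace I x →L[ℝ] V := mfderiv I 𝓘(ℝ, V) f x

lemma diff_apply {f : M → V} {x₀ x : M} (hx : x ∈ (chartAt H x₀).source)
    (hf : MDifferentiableAt I 𝓘(ℝ, V) f x) (v : TangentSpace I x) :
    diff I f x v =
      fderiv ℝ (fun y => f ((extChartAt I x₀).symm y)) (extChartAt I x₀ x) (coframe I x₀ x v) := by
  have hxs : x ∈ (extChartAt I x₀).source := by simpa using hx
  have hy := (extChartAt I x₀).map_source hxs
  have e := (extChartAt I x₀).left_inv hxs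
  have hf' : MDifferentiableAt I 𝓘(ℝ, V) f
    ((extChartAt I x₀).symm (extChartAt I x₀ x)) := by rwa [e]
  have h3 : HasMFDerivAt 𝓘(ℝ, E) 𝓘(ℝ, V)
      (fun y => f ((extChartAt I x₀).symm y)) (extChartAt I x₀ x) _ :=
    hf'.hasMFDerivAt.comp _ (mdifferentiableAt_chart_symm hy).hasMFDerivAt
  rw [mfderiv_symm_eq_frame hy] at h3
  have h4 : HasFDerivAt (fun y => f ((extChartAt I x₀).symm y))
      ((diff I f ((extChartAt I x₀).symm (extChartAt I x₀ x))).comp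
        (frame I x₀ ((extChartAt I x₀).symm (extChartAt I x₀ x))) : E →L[ℝ] V)
      (extChartAt I x₀ x) := h3.hasFDerivAt
  rw [h4.fderiv]
  have h5 : ∀ w : E, diff I f ((extChartAt I x₀).symm (extChartAt I x₀ x))
      (frame I x₀ ((extChartAt I x₀).symm (extChartAt I x₀ x)) w) =
      diff I f x (frame I x₀ x w) := fun w =>
    congrArg (fun p => diff I f p (frame I x₀ p w)) e
  refine ((h5 _).trans ?_).symm
  rw [frame_coframe hx]

lemma contDiffAt_comp_chart_symm {f : M → V} {x₀ x : M} (hx : x ∈ (chartAt H x₀).source)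
    (hf : ContMDiffAt I 𝓘(ℝ, V) ∞ f x) :
    ContDiffAt ℝ ∞ (fun y => f ((extChartAt I x₀).symm y)) (extChartAt I x₀ x) :=
  contDiffAt_readInCharts (I' := 𝓘(ℝ, V)) (x₀' := f x) hx (by simp) hf

/-- The product rule for a function with values in the dual of `V` and a `V`-valued one-form. -/
lemma SmoothOneForm.extD_pairing {α : ∀ x : M, TangentSpace I x →L[ℝ] V} (hα : SmoothOneForm α)
    {μ : M → V →L[ℝ] ℝ} (hμ : ContMDiff I 𝓘(ℝ, V →L[ℝ] ℝ) ∞ μ) (x : M)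
    (v : Fin 2 → TangentSpace I x) :
    extD I (oneForm I fun x => (μ x).comp (α x)) x v =
      diff I μ x (v 0) (α x (v 1)) - diff I μ x (v 1) (α x (v 0)) +
      μ x (extD I (oneForm I α) x v) := by
  have hx := mem_chart_source H x
  have hμ' : ∀ {x₀ x : M}, x ∈ (chartAt H x₀).source → ContDiffAt ℝ ∞
      (fun y => μ ((extChartAt I x₀).symm y)) (extChartAt I x₀ x) := fun hx =>
    contDiffAt_comp_chart_symm hx hμ.contMDiffAt
  have hr : ∀ x₀ : M, rep1 (fun x => (μ x).comp (α x)) x₀ = fun y =>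
    (μ ((extChartAt I x₀).symm y)).comp (rep1 α x₀ y) := fun x₀ => rfl
  have hs : SmoothOneForm fun x => (μ x).comp (α x) := by
    intro x₀ x hx
    rw [hr]
    exact (hμ' hx).clm_comp (hα x₀ x hx)
  have hxs : x ∈ (extChartAt I x).source := by simp
  have hm : MDifferentiableAt I 𝓘(ℝ, V →L[ℝ] ℝ) μ x := hμ.contMDiffAt.mdifferentiableAt (by simp)
  rw [extD_oneForm_apply hs hx, extD_oneForm_apply hα hx, hr,
    fderiv_clm_comp ((hμ' hx).differentiableAt (by simp)) (hα.differentiableAt hx),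
    diff_apply hx hm, diff_apply hx hm]
  have h1 : ∀ w, rep1 α x (extChartAt I x x) (coframe I x x w) = α x w := fun w => by
    rw [rep1_apply _ hx, frame_coframe hx]
  have e := (extChartAt I x).left_inv hxs
  simp only [_root_.add_apply, ContinuousLinearMap.comp_apply, ContinuousLinearMap.compL_apply,
    ContinuousLinearMap.flip_apply, h1, e, map_sub]
  ring

end OneForms

end GaugedCotangent

end

/-! ### Criteria for smoothness of forms and of maps into tangent bundles -/

noncomputable section

namespace GaugedCotangent

/-- A basis of the finite-dimensional `E` identifies `E →L[ℝ] F` with a finite power of `F`, where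
smoothness is tested componentwise. -/
lemma contDiffAt_clm_apply {D E F : Type*} [NormedAddCommGroup D] [NormedSpace ℝ D]
    [NormedAddCommGroup E] [NormedSpace ℝ E] [NormedAddCommGroup F] [NormedSpace ℝ F]
    [FiniteDimensional ℝ E] {f : D → E →L[ℝ] F} {x : D} {n : ℕ∞ω}
    (h : ∀ y, ContDiffAt ℝ n (fun x => f x y) x) : ContDiffAt ℝ n f x := by
  have hd : Module.finrank ℝ E = Module.finrank ℝ (Fin (Module.finrank ℝ E) → ℝ) :=
    (Module.finrank_fin_fun ℝ).symm
  let e₁ := ContinuousLinearEquiv.ofFinrankEq hd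
  let e₂ := (e₁.arrowCongr (1 : F ≃L[ℝ] F)).trans
    (ContinuousLinearEquiv.piRing (Fin (Module.finrank ℝ E)))
  rw [← Function.id_comp f, ← e₂.symm_comp_self]
  exact e₂.symm.contDiff.contDiffAt.comp x (contDiffAt_pi.mpr fun i => h _)

section SmoothForms

variable {E H M : Type*} [NormedAddCommGroup E] [NormedSpace ℝ E] [TopologicalSpace H]
  {I : ModelWithCorners ℝ E H} [TopologicalSpace M] [ChartedSpace H M] [IsManifold I ∞ M]
  {E' H' N : Type*} [NormedAddCommGroup E'] [NormedSpace ℝ E'] [TopologicalSpace H']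
  {J : ModelWithCorners ℝ E' H'} [TopologicalSpace N] [ChartedSpace H' N]
  {V : Type*} [NormedAddCommGroup V] [NormedSpace ℝ V]

/-- A map to the tangent bundle is smooth if its base map and its components in a preferred chart
are. -/
lemma contMDiffAt_tangentBundle_iff {b : N → M} {X : ∀ n, TangentSpace I (b n)} {n₀ : N} {x₀ : M}
    (hx : b n₀ ∈ (chartAt H x₀).source) :
    ContMDiffAt J I.tangent ∞ (fun n => (⟨b n, X n⟩ : TangentBundle I M)) n₀ ↔
      ContMDiffAt J I ∞ b n₀ ∧
        ContMDiffAt J 𝓘(ℝ, E) ∞ (fun n => coframe I x₀ (b n) (X n)) n₀ := by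
  have hb : b n₀ ∈ (trivializationAt E (TangentSpace I) x₀).baseSet := by simpa using hx
  rw [Trivialization.contMDiffAt_iff (e := trivializationAt E (TangentSpace I) x₀)
    (IB := I) (by simpa [Trivialization.mem_source] using hx)]
  refine and_congr_right fun h => ?_
  apply Filter.EventuallyEq.contMDiffAt_iff
  filter_upwards [h.continuousAt.eventually
    ((trivializationAt E (TangentSpace I) x₀).open_baseSet.mem_nhds hb)] with n hn
  exact (Trivialization.continuousLinearMapAt_apply_of_mem (R := ℝ) _ hn (X n)).symm

variable [I.Boundaryless]

lemma IsSmoothForm_oneForm {α : ∀ x : M, TangentSpace I x →L[ℝ] V} (hα : SmoothOneForm α) :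
    IsSmoothForm I (oneForm I α) := by
  intro X hX x
  have hx := mem_chart_source H x
  have h0 := ((contMDiffAt_tangentBundle_iff (b := fun x => x) hx).1 (hX 0 x)).2
  have h1 : ContMDiffAt I 𝓘(ℝ, E →L[ℝ] V) ∞ (fun z => rep1 α x (extChartAt I x z)) x :=
    (hα x x hx).contMDiffAt.comp x contMDiffAt_extChartAt
  refine (h1.clm_apply h0).congr_of_eventuallyEq ?_
  filter_upwards [(chartAt H x).open_source.mem_nhds hx] with z hz
  rw [rep1_apply α hz, frame_coframe hz]
  rfl

lemma IsSmoothForm_extD {α : ∀ x : M, TangentSpace I x →L[ℝ] V} (hα : SmoothOneForm α) :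
    IsSmoothForm I (extD I (oneForm I α)) := by
  intro X hX x
  have hx := mem_chart_source H x
  have h0 := fun i => ((contMDiffAt_tangentBundle_iff (b := fun x => x) hx).1 (hX i x)).2
  have h1 : ContMDiffAt I 𝓘(ℝ, E →L[ℝ] E →L[ℝ] V) ∞
      (fun z => fderiv ℝ (rep1 α x) (extChartAt I x z)) x :=
    ((hα x x hx).fderiv_right (m := ∞) (by norm_cast)).contMDiffAt.comp x contMDiffAt_extChartAt
  refine (((h1.clm_apply (h0 0)).clm_apply (h0 1)).sub
    ((h1.clm_apply (h0 1)).clm_apply (h0 0))).congr_of_eventuallyEq ?_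
  filter_upwards [(chartAt H x).open_source.mem_nhds hx] with z hz
  rw [extD_oneForm_apply hα hz]

/-- A family of linear maps that is smooth as a function on the tangent bundle is a smooth
one-form. -/
lemma smoothOneForm_of_contMDiff [FiniteDimensional ℝ E]
    {α : ∀ x : M, TangentSpace I x →L[ℝ] V}
    (hα : ContMDiff I.tangent 𝓘(ℝ, V) ∞ fun v : TangentBundle I M => α v.1 v.2) :
    SmoothOneForm α := by
  intro x₀ x hx
  have hxs : x ∈ (extChartAt I x₀).source := by simpa using hx
  have e := (extChartAt I x₀).left_inv hxs
  -- For fixed `u` the frame field with constant component `u` is a smooth section, with which `α`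
  -- can be composed.
  refine contDiffAt_clm_apply fun u => ?_
  rw [← contMDiffAt_iff_contDiffAt]
  refine hα.contMDiffAt.comp (extChartAt I x₀ x)
    (f := fun y => (⟨(extChartAt I x₀).symm y, frame I x₀ _ u⟩ : TangentBundle I M)) ?_
  have hs : ContMDiffAt 𝓘(ℝ, E) I ∞ (extChartAt I x₀).symm (extChartAt I x₀ x) :=
    (contMDiffOn_extChartAt_symm x₀).contMDiffAt
      (target_mem_nhds ((extChartAt I x₀).map_source hxs))
  rw [contMDiffAt_tangentBundle_iff (b := (extChartAt I x₀).symm) (x₀ := x₀) (by rwa [e])]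
  refine ⟨hs, contMDiffAt_const (c := u) |>.congr_of_eventuallyEq ?_⟩
  filter_upwards [eventually_chart hx (Filter.Eventually.of_forall fun _ => trivial)]
    with y ⟨z, hz, hy, hyz, _⟩
  exact coframe_frame (by rwa [hyz]) u

end SmoothForms

/-! ### The Liouville form in charts -/

section Liouville

variable {E M : Type*} [NormedAddCommGroup E] [NormedSpace ℝ E]
  [TopologicalSpace M] [ChartedSpace E M] [IsManifold 𝓘(ℝ, E) ∞ M]
  {E' H' N : Type*} [NormedAddCommGroup E'] [NormedSpace ℝ E'] [TopologicalSpace H']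
  {J : ModelWithCorners ℝ E' H'} [TopologicalSpace N] [ChartedSpace H' N]

/-- The components of a covector in the preferred chart at `x₀`. -/
def covec (x₀ : M) (z : CotangentBundle E M) : E →L[ℝ] ℝ :=
  (z.2 : TangentSpace 𝓘(ℝ, E) z.1 →L[ℝ] ℝ).comp (frame 𝓘(ℝ, E) x₀ z.1)

lemma trivializationAt_cotangent_apply (x₀ : M) (z : CotangentBundle E M) :
    trivializationAt (E →L[ℝ] ℝ) (CotangentSpace E M) x₀ z = (z.1, covec x₀ z) := by
  rw [hom_trivializationAt_apply]
  congr 1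
  ext u
  rw [ContinuousLinearMap.inCoordinates]
  simp only [Bundle.Trivial.eq_trivialization, Bundle.Trivial.continuousLinearMapAt_trivialization]
  rfl

lemma mem_source_trivializationAt_cotangent {x₀ : M} {z : CotangentBundle E M} :
    z ∈ (trivializationAt (E →L[ℝ] ℝ) (CotangentSpace E M) x₀).source ↔
      z.1 ∈ (chartAt E x₀).source := by
  rw [Trivialization.mem_source, hom_trivializationAt_baseSet]
  simp

/-- A map to the cotangent bundle is smooth if its base map and its components in a preferred chart
are. -/
lemma contMDiffAt_cotangentBundle_iff {f : N → CotangentBundle E M} {n₀ : N} {x₀ : M}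
    (hx : (f n₀).1 ∈ (chartAt E x₀).source) :
    ContMDiffAt J (cotModel E) ∞ f n₀ ↔
      ContMDiffAt J 𝓘(ℝ, E) ∞ (fun n => (f n).1) n₀ ∧
        ContMDiffAt J 𝓘(ℝ, E →L[ℝ] ℝ) ∞ (fun n => covec x₀ (f n)) n₀ := by
  rw [Trivialization.contMDiffAt_iff
    (e := trivializationAt (E →L[ℝ] ℝ) (CotangentSpace E M) x₀)
    (IB := 𝓘(ℝ, E)) (mem_source_trivializationAt_cotangent.2 hx)]
  simp only [trivializationAt_cotangent_apply]

lemma extChartAt_cotangent_apply (z₀ z : CotangentBundle E M) :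
    extChartAt (cotModel E) z₀ z = (extChartAt 𝓘(ℝ, E) z₀.1 z.1, covec z₀.1 z) := by
  rw [FiberBundle.extChartAt]
  simp [trivializationAt_cotangent_apply]

end Liouville

end GaugedCotangent

end

noncomputable section

namespace GaugedCotangent

section LiouvilleForm

variable {E M : Type*} [NormedAddCommGroup E] [NormedSpace ℝ E]
  [TopologicalSpace M] [ChartedSpace E M] [IsManifold 𝓘(ℝ, E) ∞ M]

/-- The Liouville form as a family of linear maps. -/
def liouvilleMap (z : CotangentBundle E M) : TangentSpace (cotModel E) z →L[ℝ] ℝ :=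
  (z.2 : TangentSpace 𝓘(ℝ, E) z.1 →L[ℝ] ℝ).comp
    (mfderiv (cotModel E) 𝓘(ℝ, E) (TotalSpace.proj : CotangentBundle E M → M) z)

variable (E) in
/-- The pairing of covectors with vectors, as a map on the model of the cotangent bundle. -/
def liouvilleModel : E × (E →L[ℝ] ℝ) →L[ℝ] E × (E →L[ℝ] ℝ) →L[ℝ] ℝ :=
  ((ContinuousLinearMap.compL ℝ (E × (E →L[ℝ] ℝ)) E ℝ).flip
    (ContinuousLinearMap.fst ℝ E (E →L[ℝ] ℝ))).comp (ContinuousLinearMap.snd ℝ E (E →L[ℝ] ℝ))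

lemma mem_chart_source_cotangent {z₀ z : CotangentBundle E M} :
    z ∈ (chartAt (ModelProd E (E →L[ℝ] ℝ)) z₀).source ↔ z.1 ∈ (chartAt E z₀.1).source := by
  rw [FiberBundle.chartedSpace_chartAt, OpenPartialHomeomorph.trans_source,
    OpenPartialHomeomorph.prod_source]
  change z ∈ (trivializationAt (E →L[ℝ] ℝ) (CotangentSpace E M) z₀.1).source ∧
    ((trivializationAt (E →L[ℝ] ℝ) (CotangentSpace E M) z₀.1) z).1 ∈ (chartAt E z₀.1).source ∧
      True ↔ _
  rw [mem_source_trivializationAt_cotangent, trivializationAt_cotangent_apply]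
  simp

lemma contMDiff_cotangent_proj :
    ContMDiff (cotModel E) 𝓘(ℝ, E) ∞ (TotalSpace.proj : CotangentBundle E M → M) :=
  contMDiff_proj _

/-- In cotangent charts the projection is `(x, p) ↦ x`. -/
lemma mfderiv_proj_frame {z₀ z : CotangentBundle E M}
    (hz : z ∈ (chartAt (ModelProd E (E →L[ℝ] ℝ)) z₀).source) (w : E × (E →L[ℝ] ℝ)) :
    mfderiv (cotModel E) 𝓘(ℝ, E) (TotalSpace.proj : CotangentBundle E M → M) z
      (frame (cotModel E) z₀ z w) = frame 𝓘(ℝ, E) z₀.1 z.1 w.1 := by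
  have hz1 := mem_chart_source_cotangent.1 hz
  have hzs : z ∈ (extChartAt (cotModel E) z₀).source := by rwa [extChartAt_source]
  have e := (extChartAt (cotModel E) z₀).left_inv hzs
  have h := fderiv_readInCharts (I' := 𝓘(ℝ, E)) (x₀' := z₀.1)
    (f := (TotalSpace.proj : CotangentBundle E M → M))
    ((extChartAt (cotModel E) z₀).map_source hzs)
    (contMDiff_cotangent_proj.contMDiffAt.mdifferentiableAt (by simp)) (by rwa [e]) w
  have h2 : (fun y => extChartAt 𝓘(ℝ, E) z₀.1 ((extChartAt (cotModel E) z₀).symm y).1)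
      =ᶠ[𝓝 (extChartAt (cotModel E) z₀ z)] Prod.fst := by
    filter_upwards [eventually_chart hz (Filter.Eventually.of_forall fun _ => trivial)]
      with y ⟨z', hz', hy, hyz, _⟩
    rw [hyz, hy, extChartAt_cotangent_apply]
  rw [h2.fderiv_eq, fderiv_fst] at h
  have h3 := congrArg (fun p : CotangentBundle E M => coframe 𝓘(ℝ, E) z₀.1 p.1
    (mfderiv (cotModel E) 𝓘(ℝ, E) (TotalSpace.proj : CotangentBundle E M → M) p
      (frame (cotModel E) z₀ p w))) e
  rw [← frame_coframe hz1 (mfderiv (cotModel E) 𝓘(ℝ, E)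
    (TotalSpace.proj : CotangentBundle E M → M) z (frame (cotModel E) z₀ z w))]
  congr 1
  exact (h.trans h3).symm

/-- This is `θ = p dq`. The coefficients are a continuous linear function of the chart point, whence
both the smoothness of `θ` and the constant coefficients of `Ω`. -/
lemma rep1_liouvilleMap {z₀ z : CotangentBundle E M}
    (hz : z ∈ (chartAt (ModelProd E (E →L[ℝ] ℝ)) z₀).source) :
    rep1 (I := cotModel E) (liouvilleMap (M := M)) z₀ =ᶠ[𝓝 (extChartAt (cotModel E) z₀ z)]
      liouvilleModel E := by
  filter_upwards [eventually_chart hz (Filter.Eventually.of_forall fun _ => trivial)]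
    with y ⟨z', hz', hy, hyz, _⟩
  refine ContinuousLinearMap.ext fun w => ?_
  rw [hy, rep1_apply _ hz', extChartAt_cotangent_apply]
  change z'.2 (mfderiv (cotModel E) 𝓘(ℝ, E) (TotalSpace.proj : CotangentBundle E M → M) z'
    (frame (cotModel E) z₀ z' w)) = _
  rw [mfderiv_proj_frame hz']
  rfl

lemma smoothOneForm_liouvilleMap :
    SmoothOneForm (I := cotModel E) (liouvilleMap (M := M)) := by
  intro z₀ z hz
  refine ContDiffAt.congr_of_eventuallyEq ?_ (rep1_liouvilleMap hz)
  change ContDiffAt ℝ ∞ (fun p : E × (E →L[ℝ] ℝ) =>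
    p.2.comp (ContinuousLinearMap.fst ℝ E (E →L[ℝ] ℝ))) _
  exact contDiffAt_snd.clm_comp contDiffAt_const

/-- The canonical symplectic form in a preferred chart. -/
lemma canonicalForm_apply (z : CotangentBundle E M) (v : Fin 2 → TangentSpace (cotModel E) z) :
    canonicalForm E M z v =
      (coframe (cotModel E) z z (v 1)).2 (coframe (cotModel E) z z (v 0)).1 -
      (coframe (cotModel E) z z (v 0)).2 (coframe (cotModel E) z z (v 1)).1 := by
  have hz := mem_chart_source (ModelProd E (E →L[ℝ] ℝ)) z
  have h2 := extD_oneForm_apply (smoothOneForm_liouvilleMap (E := E) (M := M)) hz v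
  rw [(rep1_liouvilleMap hz).fderiv_eq, ContinuousLinearMap.fderiv] at h2
  change -(extD (cotModel E) (oneForm (cotModel E) liouvilleMap) z v) = _
  rw [h2, neg_sub]
  rfl

/-- In a chart the form sends `(e, α), (e', α')` to `α'(e) - α(e')`. Testing against `(0, α')` and
`(e', 0)` kills both components, the first because continuous functionals separate points. -/
lemma canonicalForm_nondegenerate (z : CotangentBundle E M) (u : TangentSpace (cotModel E) z)
    (h : ∀ v, canonicalForm E M z ![u, v] = 0) : u = 0 := by
  have hz := mem_chart_source (ModelProd E (E →L[ℝ] ℝ)) z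
  have h' : ∀ w : E × (E →L[ℝ] ℝ), w.2 (coframe (cotModel E) z z u).1 =
      (coframe (cotModel E) z z u).2 w.1 := by
    intro w
    have := h (frame (cotModel E) z z w)
    rw [canonicalForm_apply] at this
    change (coframe (cotModel E) z z (frame (cotModel E) z z w)).2 (coframe (cotModel E) z z u).1 -
      (coframe (cotModel E) z z u).2 (coframe (cotModel E) z z (frame (cotModel E) z z w)).1 = 0
      at this
    rw [coframe_frame hz] at this
    exact sub_eq_zero.1 this
  have h0 : coframe (cotModel E) z z u = 0 := by
    refine Prod.ext ?_ ?_
    · refine SeparatingDual.eq_zero_of_forall_dual_eq_zero (R := ℝ) fun f => ?_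
      simpa using h' (0, f)
    · ext e
      simpa using (h' (e, 0)).symm
  rw [← frame_coframe hz u, h0]
  exact ContinuousLinearMap.map_zero _

end LiouvilleForm

end GaugedCotangent

end

noncomputable section

namespace GaugedCotangent

/-! ### Smooth actions in charts -/

section FrameSelf

variable {E H M : Type*} [NormedAddCommGroup E] [NormedSpace ℝ E] [TopologicalSpace H]
  {I : ModelWithCorners ℝ E H} [TopologicalSpace M] [ChartedSpace H M] [IsManifold I 1 M]

/-- The tangent space is by definition the model space, and the coordinate change from the preferred
chart at `x` to itself is the identity. -/
lemma coframe_self (x : M) (v : TangentSpace I x) : coframe I x x v = v := by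
  rw [coframe, TangentBundle.continuousLinearMapAt_trivializationAt_eq_core (mem_chart_source H x)]
  exact (tangentBundleCore I M).coordChange_self _ _ (mem_chart_source H x) v

lemma frame_self (x : M) (v : E) : frame I x x v = v :=
  (congrArg (frame I x x) (coframe_self x (v : TangentSpace I x)).symm).trans
    (frame_coframe (mem_chart_source H x) _)

end FrameSelf

lemma contMDiff_smul_left (EG : Type*) [NormedAddCommGroup EG] [NormedSpace ℝ EG]
    {G : Type*} [TopologicalSpace G] [ChartedSpace EG G] [Group G]
    {E H M : Type*} [NormedAddCommGroup E] [NormedSpace ℝ E] [TopologicalSpace H]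
    (I : ModelWithCorners ℝ E H) [TopologicalSpace M] [ChartedSpace H M]
    [MulAction G M] [ContMDiffSMul 𝓘(ℝ, EG) I ∞ G M] (g : G) :
    ContMDiff I I ∞ (fun x : M => g • x) :=
  (contMDiff_smul (I := 𝓘(ℝ, EG)) (I' := I) (n := ∞) (G := G) (M := M)).comp
    (contMDiff_const.prodMk contMDiff_id)

lemma eventually_smul_mem_source (EG : Type*) [NormedAddCommGroup EG] [NormedSpace ℝ EG]
    {G : Type*} [TopologicalSpace G] [ChartedSpace EG G] [Group G]
    {E H M : Type*} [NormedAddCommGroup E] [NormedSpace ℝ E] [TopologicalSpace H]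
    (I : ModelWithCorners ℝ E H) [TopologicalSpace M] [ChartedSpace H M]
    [MulAction G M] [ContMDiffSMul 𝓘(ℝ, EG) I ∞ G M] {x₀ x : M}
    (hx : x ∈ (chartAt H x₀).source) :
    ∀ᶠ g in 𝓝 (1 : G), g • x ∈ (chartAt H x₀).source := by
  have hc : Continuous fun g : G => g • x :=
    ((contMDiff_smul (I := 𝓘(ℝ, EG)) (I' := I) (n := ∞) (G := G) (M := M)).comp
      (contMDiff_id.prodMk contMDiff_const)).continuous
  apply hc.continuousAt.eventually
  simpa using (chartAt H x₀).open_source.mem_nhds hx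

section Actions

variable {EG : Type*} [NormedAddCommGroup EG] [NormedSpace ℝ EG]
  (G : Type*) [TopologicalSpace G] [ChartedSpace EG G] [Group G] [LieGroup 𝓘(ℝ, EG) ∞ G]
  {E H M : Type*} [NormedAddCommGroup E] [NormedSpace ℝ E] [TopologicalSpace H]
  (I : ModelWithCorners ℝ E H) [TopologicalSpace M] [ChartedSpace H M] [IsManifold I ∞ M]
  [MulAction G M] [ContMDiffSMul 𝓘(ℝ, EG) I ∞ G M]
  {V : Type*} [NormedAddCommGroup V] [NormedSpace ℝ V]

/-- The preferred chart of the group at the identity. -/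
abbrev idChart (EG : Type*) [NormedAddCommGroup EG] [NormedSpace ℝ EG] (G : Type*)
    [TopologicalSpace G] [ChartedSpace EG G] [Group G] : PartialEquiv G EG :=
  extChartAt 𝓘(ℝ, EG) (1 : G)

/-- The action, read in the preferred charts at `1 ∈ G` and at `x₀ ∈ M`. -/
def actChart (x₀ : M) (p : EG × E) : E :=
  extChartAt I x₀ ((idChart EG G).symm p.1 • (extChartAt I x₀).symm p.2)

/-- The mixed second derivative of the action, read in charts. -/
def actHess (x : M) (X : EG) (u : E) : E :=
  fderiv ℝ (fderiv ℝ (actChart (EG := EG) G I x)) (idChart EG G 1, extChartAt I x x) (X, 0) (0, u)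

variable {G I} [I.Boundaryless]

lemma contMDiff_smul_right (x : M) : ContMDiff 𝓘(ℝ, EG) I ∞ (fun g : G => g • x) :=
  (contMDiff_smul (I := 𝓘(ℝ, EG)) (I' := I) (n := ∞) (G := G) (M := M)).comp
    (contMDiff_id.prodMk contMDiff_const)

lemma idChart_symm_one : (idChart EG G).symm (idChart EG G 1) = 1 :=
  (extChartAt 𝓘(ℝ, EG) (1 : G)).left_inv (mem_extChartAt_source 1)

lemma eventually_idChart {P : G → Prop} (h : ∀ᶠ g in 𝓝 (1 : G), P g) :
    ∀ᶠ k in 𝓝 (idChart EG G 1), k ∈ (idChart EG G).target ∧ P ((idChart EG G).symm k) := by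
  filter_upwards [eventually_chart (I := 𝓘(ℝ, EG)) (mem_chart_source EG (1 : G)) h]
    with y ⟨z, hz, hy, hyz, hP⟩
  refine ⟨?_, by rwa [hyz]⟩
  rw [hy]
  exact (idChart EG G).map_source (by simpa [idChart] using hz)

lemma contDiffAt_actChart {x₀ x : M} (hx : x ∈ (chartAt H x₀).source) :
    ContDiffAt ℝ ∞ (actChart (EG := EG) G I x₀) (idChart EG G 1, extChartAt I x₀ x) := by
  have hxs : x ∈ (extChartAt I x₀).source := by simpa using hx
  have h1 : ContMDiffAt 𝓘(ℝ, EG) 𝓘(ℝ, EG) ∞ (idChart EG G).symm (idChart EG G 1) :=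
    (contMDiffOn_extChartAt_symm (1 : G)).contMDiffAt
      (target_mem_nhds ((extChartAt 𝓘(ℝ, EG) (1 : G)).map_source (mem_extChartAt_source 1)))
  have h2 : ContMDiffAt 𝓘(ℝ, E) I ∞ (extChartAt I x₀).symm (extChartAt I x₀ x) :=
    (contMDiffOn_extChartAt_symm x₀).contMDiffAt
      (target_mem_nhds ((extChartAt I x₀).map_source hxs))
  have h3 : ContMDiffAt (𝓘(ℝ, EG).prod 𝓘(ℝ, E)) I ∞
      (fun p : EG × E => (idChart EG G).symm p.1 • (extChartAt I x₀).symm p.2)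
      (idChart EG G 1, extChartAt I x₀ x) :=
    (contMDiff_smul (I := 𝓘(ℝ, EG)) (I' := I) (n := ∞) (G := G) (M := M)).contMDiffAt.comp
      (idChart EG G 1, extChartAt I x₀ x) (ContMDiffAt.prodMk
      (ContMDiffAt.comp (idChart EG G 1, extChartAt I x₀ x) h1 contMDiffAt_fst)
      (ContMDiffAt.comp (idChart EG G 1, extChartAt I x₀ x) h2 contMDiffAt_snd))
  have h5 : (idChart EG G).symm (idChart EG G 1) •
      (extChartAt I x₀).symm (extChartAt I x₀ x) ∈ (chartAt H x₀).source := by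
    rw [idChart_symm_one, one_smul, (extChartAt I x₀).left_inv hxs]
    exact hx
  have h4 : ContMDiffAt (𝓘(ℝ, EG).prod 𝓘(ℝ, E)) 𝓘(ℝ, E) ∞
      (actChart (EG := EG) G I x₀) (idChart EG G 1, extChartAt I x₀ x) :=
    (contMDiffAt_extChartAt' h5).comp (idChart EG G 1, extChartAt I x₀ x) h3
  rw [← contMDiffAt_iff_contDiffAt, modelWithCornersSelf_prod, ← chartedSpaceSelf_prod]
  exact h4

lemma actChart_apply (x₀ : M) (k : EG) {x : M} (hx : x ∈ (chartAt H x₀).source) :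
    actChart G I x₀ (k, extChartAt I x₀ x) =
      extChartAt I x₀ ((idChart EG G).symm k • x) := by
  have hxs : x ∈ (extChartAt I x₀).source := by simpa using hx
  rw [actChart, (extChartAt I x₀).left_inv hxs]

lemma actChart_one {x₀ x : M} (hx : x ∈ (chartAt H x₀).source) :
    actChart G I x₀ (idChart EG G 1, extChartAt I x₀ x) = extChartAt I x₀ x := by
  rw [actChart_apply _ _ hx, idChart_symm_one, one_smul]

lemma eventually_differentiableAt_actChart {x₀ x : M} (hx : x ∈ (chartAt H x₀).source) :
    ∀ᶠ p in 𝓝 ((idChart EG G 1, extChartAt I x₀ x) : EG × E),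
      DifferentiableAt ℝ (actChart (EG := EG) G I x₀) p := by
  have h : ContDiffAt ℝ 1 (actChart (EG := EG) G I x₀) (idChart EG G 1, extChartAt I x₀ x) :=
    (contDiffAt_actChart hx).of_le (by norm_cast)
  filter_upwards [h.eventually (by simp)] with p hp
  exact hp.differentiableAt (by simp)

/-- The derivative of the action in the direction of the group, read in charts. -/
lemma fderiv_actChart_left {x₀ x : M} (hx : x ∈ (chartAt H x₀).source) {k : EG}
    (hk : k ∈ (idChart EG G).target) (hkx : (idChart EG G).symm k • x ∈ (chartAt H x₀).source)
    (hd : DifferentiableAt ℝ (actChart (EG := EG) G I x₀) (k, extChartAt I x₀ x)) (X : EG) :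
    fderiv ℝ (actChart (EG := EG) G I x₀) (k, extChartAt I x₀ x) (X, 0) =
      coframe I x₀ ((idChart EG G).symm k • x) (mfderiv 𝓘(ℝ, EG) I (fun g : G => g • x)
        ((idChart EG G).symm k) (frame 𝓘(ℝ, EG) 1 ((idChart EG G).symm k) X)) := by
  rw [← fderiv_readInCharts (f := fun g : G => g • x) hk
    ((contMDiff_smul_right x).contMDiffAt.mdifferentiableAt (by simp)) hkx]
  have h := HasFDerivAt.comp k (f := fun y => (y, extChartAt I x₀ x)) hd.hasFDerivAt
    (hasFDerivAt_prodMk_left k (extChartAt I x₀ x))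
  have h2 : (fun y => extChartAt I x₀ ((idChart EG G).symm y • x)) =
      actChart (EG := EG) G I x₀ ∘ fun y => (y, extChartAt I x₀ x) := by
    funext y
    exact (actChart_apply x₀ y hx).symm
  rw [h2, h.fderiv]
  simp

/-- The derivative of the action in the direction of the manifold, read in charts. -/
lemma fderiv_actChart_right {x₀ x : M} (hx : x ∈ (chartAt H x₀).source) {k : EG}
    (hkx : (idChart EG G).symm k • x ∈ (chartAt H x₀).source)
    (hd : DifferentiableAt ℝ (actChart (EG := EG) G I x₀) (k, extChartAt I x₀ x)) (u : E) :
    fderiv ℝ (actChart (EG := EG) G I x₀) (k, extChartAt I x₀ x) (0, u) =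
      coframe I x₀ ((idChart EG G).symm k • x) (mfderiv I I (fun z : M => (idChart EG G).symm k • z)
        x (frame I x₀ x u)) := by
  have hxs : x ∈ (extChartAt I x₀).source := by simpa using hx
  have e := (extChartAt I x₀).left_inv hxs
  have h1 := fderiv_readInCharts (I := I) (I' := I) (x₀' := x₀)
    (f := fun z : M => (idChart EG G).symm k • z)
    ((extChartAt I x₀).map_source hxs)
    ((contMDiff_smul_left EG I _).contMDiffAt.mdifferentiableAt (by simp))
    (by rwa [e]) u
  have h3 := congrArg (fun p : M => coframe I x₀ ((idChart EG G).symm k • p)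
    (mfderiv I I (fun z : M => (idChart EG G).symm k • z) p (frame I x₀ p u))) e
  refine Eq.trans ?_ (h1.trans h3)
  have h := hd.hasFDerivAt.comp (extChartAt I x₀ x) (hasFDerivAt_prodMk_right k (extChartAt I x₀ x))
  have h2 : (fun y => extChartAt I x₀ ((idChart EG G).symm k • (extChartAt I x₀).symm y)) =
      actChart (EG := EG) G I x₀ ∘ fun y => (k, y) := rfl
  rw [h2, h.fderiv]
  simp

/-- The fundamental vector fields in charts. -/
lemma fderiv_actChart_one_left {x₀ x : M} (hx : x ∈ (chartAt H x₀).source) (X : EG) :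
    fderiv ℝ (actChart (EG := EG) G I x₀) (idChart EG G 1, extChartAt I x₀ x) (X, 0) =
      coframe I x₀ x (zeta G I x X) := by
  have h1 := idChart_symm_one (EG := EG) (G := G)
  rw [fderiv_actChart_left hx ((idChart EG G).map_source (mem_extChartAt_source 1))
    (by rw [h1]; simpa using hx) ((contDiffAt_actChart hx).differentiableAt (by simp))]
  have h3 : coframe I x₀ ((idChart EG G).symm (idChart EG G 1) • x)
      (mfderiv 𝓘(ℝ, EG) I (fun g : G => g • x) ((idChart EG G).symm (idChart EG G 1))
        (frame 𝓘(ℝ, EG) 1 ((idChart EG G).symm (idChart EG G 1)) X)) =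
      coframe I x₀ ((1 : G) • x) (mfderiv 𝓘(ℝ, EG) I (fun g : G => g • x) 1
        (frame 𝓘(ℝ, EG) 1 1 X)) :=
    congrArg (fun g : G => coframe I x₀ (g • x) (mfderiv 𝓘(ℝ, EG) I (fun g : G => g • x) g
      (frame 𝓘(ℝ, EG) 1 g X))) h1
  rw [h3, frame_self]
  exact congrArg (fun p : M => (coframe I x₀ p : E →L[ℝ] E) (zeta G I x X)) (one_smul G x)

lemma fderiv_actChart_one_right {x₀ x : M} (hx : x ∈ (chartAt H x₀).source) (u : E) :
    fderiv ℝ (actChart (EG := EG) G I x₀) (idChart EG G 1, extChartAt I x₀ x) (0, u) = u := by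
  have h := ((contDiffAt_actChart (EG := EG) (G := G) hx).differentiableAt
    (by simp)).hasFDerivAt.comp (extChartAt I x₀ x)
    (hasFDerivAt_prodMk_right (idChart EG G 1) (extChartAt I x₀ x))
  have h2 : (actChart (EG := EG) G I x₀ ∘ fun y => (idChart EG G 1, y))
      =ᶠ[𝓝 (extChartAt I x₀ x)] id := by
    filter_upwards [eventually_chart hx (Filter.Eventually.of_forall fun _ => trivial)]
      with y ⟨z, hz, hy, hyz, _⟩
    rw [hy]
    exact actChart_one hz
  have h3 := h.fderiv
  rw [h2.fderiv_eq, fderiv_id] at h3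
  simpa using (congrArg (fun L : E →L[ℝ] E => L u) h3).symm

end Actions

end GaugedCotangent

end

noncomputable section

namespace GaugedCotangent

/-! ### Differentiating a one-form along a two-variable map -/

section SecondDerivatives

variable {F₁ F₂ F₃ : Type*} [NormedAddCommGroup F₁] [NormedSpace ℝ F₁] [NormedAddCommGroup F₂]
  [NormedSpace ℝ F₂] [NormedAddCommGroup F₃] [NormedSpace ℝ F₃]

lemma hasFDerivAt_fderiv_left {a : F₁ × F₂ → F₃} {h : F₁} {y : F₂} (ha : ContDiffAt ℝ ∞ a (h, y)) :
    HasFDerivAt (fun k => fderiv ℝ a (k, y))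
      ((fderiv ℝ (fderiv ℝ a) (h, y)).comp (ContinuousLinearMap.inl ℝ F₁ F₂)) h :=
  HasFDerivAt.comp h (f := fun k => (k, y))
    ((ha.fderiv_right (m := ∞) (by norm_cast)).differentiableAt (by simp)).hasFDerivAt
    (hasFDerivAt_prodMk_left h y)

lemma hasFDerivAt_fderiv_right {a : F₁ × F₂ → F₃} {h : F₁} {y : F₂}
    (ha : ContDiffAt ℝ ∞ a (h, y)) :
    HasFDerivAt (fun z => fderiv ℝ a (h, z))
      ((fderiv ℝ (fderiv ℝ a) (h, y)).comp (ContinuousLinearMap.inr ℝ F₁ F₂)) y :=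
  HasFDerivAt.comp y (f := fun z => (h, z))
    ((ha.fderiv_right (m := ∞) (by norm_cast)).differentiableAt (by simp)).hasFDerivAt
    (hasFDerivAt_prodMk_right h y)

/-- With `a` the action in charts, `hc` is the invariance of the form represented by `r`. Its
derivative in the group variable says that the Lie derivative along a fundamental field vanishes. -/
lemma fderiv_pairing_left {V : Type*} [NormedAddCommGroup V] [NormedSpace ℝ V]
    {r : F₂ → F₂ →L[ℝ] V} {a : F₁ × F₂ → F₂} {h : F₁} {y u : F₂} {c : V}
    (hr : DifferentiableAt ℝ r y) (ha : ContDiffAt ℝ ∞ a (h, y)) (hy : a (h, y) = y)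
    (hu : fderiv ℝ a (h, y) (0, u) = u)
    (hc : ∀ᶠ k in 𝓝 h, r (a (k, y)) (fderiv ℝ a (k, y) (0, u)) = c) (X : F₁) :
    fderiv ℝ r y (fderiv ℝ a (h, y) (X, 0)) u +
      r y (fderiv ℝ (fderiv ℝ a) (h, y) (X, 0) (0, u)) = 0 := by
  have hr' : HasFDerivAt r (fderiv ℝ r y) (a (h, y)) := by rw [hy]; exact hr.hasFDerivAt
  have h1 : HasFDerivAt (fun k => a (k, y))
      ((fderiv ℝ a (h, y)).comp (ContinuousLinearMap.inl ℝ F₁ F₂)) h :=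
    HasFDerivAt.comp h (f := fun k => (k, y)) (ha.differentiableAt (by simp)).hasFDerivAt
      (hasFDerivAt_prodMk_left _ _)
  have h2 : HasFDerivAt (fun k => r (a (k, y))) _ h :=
    HasFDerivAt.comp h (f := fun k => a (k, y)) hr' h1
  have h3 := h2.clm_apply ((hasFDerivAt_fderiv_left ha).clm_apply
    (hasFDerivAt_const ((0 : F₁), u) h))
  have h4 : HasFDerivAt (fun k => r (a (k, y)) (fderiv ℝ a (k, y) (0, u))) (0 : F₁ →L[ℝ] V) h :=
    (hasFDerivAt_const c h).congr_of_eventuallyEq hc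
  have h5 := congrArg (fun L : F₁ →L[ℝ] V => L X) (h3.unique h4)
  simpa [hy, hu, add_comm] using h5

/-- With `a` the action in charts, the function on the left is the value of the form on a
fundamental field. The mixed second derivative appears in the order opposite to
`fderiv_pairing_left`. -/
lemma fderiv_pairing_right {V : Type*} [NormedAddCommGroup V] [NormedSpace ℝ V]
    {r : F₂ → F₂ →L[ℝ] V} {a : F₁ × F₂ → F₂} {h : F₁} {y : F₂}
    (hr : DifferentiableAt ℝ r y) (ha : ContDiffAt ℝ ∞ a (h, y)) (X : F₁) (u : F₂) :
    fderiv ℝ (fun z => r z (fderiv ℝ a (h, z) (X, 0))) y u =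
      fderiv ℝ r y u (fderiv ℝ a (h, y) (X, 0)) +
      r y (fderiv ℝ (fderiv ℝ a) (h, y) (0, u) (X, 0)) := by
  have h3 := hr.hasFDerivAt.clm_apply ((hasFDerivAt_fderiv_right ha).clm_apply
    (hasFDerivAt_const (X, (0 : F₂)) y))
  rw [h3.fderiv]
  simp [add_comm]

end SecondDerivatives

/-! ### Cartan's formula, and brackets as second derivatives of the action -/

section Infinitesimal

variable {EG : Type*} [NormedAddCommGroup EG] [NormedSpace ℝ EG]
  {G : Type*} [TopologicalSpace G] [ChartedSpace EG G] [Group G] [LieGroup 𝓘(ℝ, EG) ∞ G]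
  {E H M : Type*} [NormedAddCommGroup E] [NormedSpace ℝ E] [TopologicalSpace H]
  {I : ModelWithCorners ℝ E H} [TopologicalSpace M] [ChartedSpace H M] [IsManifold I ∞ M]
  [MulAction G M] [ContMDiffSMul 𝓘(ℝ, EG) I ∞ G M]
  {V : Type*} [NormedAddCommGroup V] [NormedSpace ℝ V] [I.Boundaryless]

lemma actHess_symm (x : M) (X : EG) (u : E) :
    fderiv ℝ (fderiv ℝ (actChart (EG := EG) G I x)) (idChart EG G 1, extChartAt I x x) (0, u) (X, 0) =
      actHess G I x X u :=
  ((contDiffAt_actChart (EG := EG) (G := G) (I := I) (mem_chart_source H x)).isSymmSndFDerivAt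
    minSmoothness_two_le_infty) _ _

/-- Invariance of fundamental vectors under the group. -/
lemma mfderiv_smul_zeta (g : G) (x : M) (Y : EG) :
    mfderiv I I (fun z : M => g • z) x (zeta G I x Y) =
      mfderiv 𝓘(ℝ, EG) I (fun h : G => h • x) g
        (mulInvariantVectorField (I := 𝓘(ℝ, EG)) (G := G) Y g) := by
  have h1 := mfderiv_comp (I := 𝓘(ℝ, EG)) (I' := I) (I'' := I) (1 : G)
    (g := fun z : M => g • z) (f := fun h : G => h • x)
    ((contMDiff_smul_left EG I g).contMDiffAt.mdifferentiableAt (by simp))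
    ((contMDiff_smul_right x).contMDiffAt.mdifferentiableAt (by simp))
  have h2 := mfderiv_comp (I := 𝓘(ℝ, EG)) (I' := 𝓘(ℝ, EG)) (I'' := I) (1 : G)
    (g := fun h : G => h • x) (f := fun h : G => g * h)
    ((contMDiff_smul_right x).contMDiffAt.mdifferentiableAt (by simp))
    ((contMDiff_mul_left (I := 𝓘(ℝ, EG)) (n := ∞)).contMDiffAt.mdifferentiableAt (by simp))
  have h3 : (fun z : M => g • z) ∘ (fun h : G => h • x) = (fun h : G => h • x) ∘ fun h => g * h := by
    funext h
    simp [mul_smul]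
  have h4 : mfderiv I I (fun z : M => g • z) x (zeta G I x Y) =
      mfderiv I I (fun z : M => g • z) ((1 : G) • x) (mfderiv 𝓘(ℝ, EG) I (fun h : G => h • x) 1 Y) :=
    congrArg (fun p : M => (mfderiv I I (fun z : M => g • z) p : E →L[ℝ] E) (zeta G I x Y))
      (one_smul G x).symm
  have h5 : mfderiv 𝓘(ℝ, EG) I (fun h : G => h • x) g
        (mulInvariantVectorField (I := 𝓘(ℝ, EG)) (G := G) Y g) =
      mfderiv 𝓘(ℝ, EG) I (fun h : G => h • x) (g * 1)
        (mfderiv 𝓘(ℝ, EG) 𝓘(ℝ, EG) (fun h : G => g * h) 1 Y) :=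
    congrArg (fun p : G => (mfderiv 𝓘(ℝ, EG) I (fun h : G => h • x) p : EG →L[ℝ] E)
      (mfderiv 𝓘(ℝ, EG) 𝓘(ℝ, EG) (fun h : G => g * h) 1 Y)) (mul_one g).symm
  rw [h4, h5]
  have h6 : mfderiv 𝓘(ℝ, EG) I ((fun z : M => g • z) ∘ (fun h : G => h • x)) 1 Y =
    mfderiv 𝓘(ℝ, EG) I ((fun h : G => h • x) ∘ fun h => g * h) 1 Y := by rw [h3]
  rw [h1, h2] at h6
  exact h6

lemma tendsto_prodMk_left {F₁ F₂ : Type*} [TopologicalSpace F₁] [TopologicalSpace F₂]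
    (h : F₁) (y : F₂) : Filter.Tendsto (fun k => (k, y)) (𝓝 h) (𝓝 (h, y)) :=
  (continuous_id.prodMk continuous_const).tendsto _

/-- Cartan's formula for an invariant one-form and a fundamental vector field. -/
lemma extD_invariant_zeta {α : ∀ x : M, TangentSpace I x →L[ℝ] V} (hα : SmoothOneForm α)
    (hinv : ∀ (g : G) (x : M) (v : TangentSpace I x),
      α (g • x) (mfderiv I I (fun z : M => g • z) x v) = α x v) (X : EG) (x : M)
    (v : TangentSpace I x) (hd : MDifferentiableAt I 𝓘(ℝ, V) (fun y => α y (zeta G I y X)) x) :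
    extD I (oneForm I α) x ![zeta G I x X, v] = -diff I (fun y => α y (zeta G I y X)) x v := by
  have hx := mem_chart_source H x
  set y₀ := extChartAt I x x with hy₀
  set a := actChart (EG := EG) G I x with ha
  have hs : ContDiffAt ℝ ∞ a (idChart EG G 1, y₀) := contDiffAt_actChart hx
  have hy : a (idChart EG G 1, y₀) = y₀ := actChart_one hx
  set u := coframe I x x v with hu
  have h1 : ∀ᶠ k in 𝓝 (idChart EG G 1),
      rep1 α x (a (k, y₀)) (fderiv ℝ a (k, y₀) (0, u)) = α x v := by
    filter_upwards [eventually_idChart (EG := EG) (eventually_smul_mem_source EG I (G := G) hx),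
      (tendsto_prodMk_left _ _).eventually
        (eventually_differentiableAt_actChart (EG := EG) (G := G) (I := I) hx)] with k hk hd
    rw [ha, hy₀, fderiv_actChart_right hx hk.2 hd, actChart_apply _ _ hx, rep1_apply _ hk.2,
      frame_coframe hk.2, frame_coframe hx, hinv]
  -- `h2` says that the Lie derivative of `α` along `ζ_X` vanishes, and `h3` computes the
  -- differential of `α(ζ_X)`. By symmetry both contain `α` of the same mixed second derivative;
  -- eliminating it leaves `dα(ζ_X, ·)`.
  have h2 := fderiv_pairing_left (hα.differentiableAt hx) hs hy (fderiv_actChart_one_right hx u)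
    h1 X
  have h3 := fderiv_pairing_right (hα.differentiableAt hx) hs X u
  have h4 : (fun y => (fun y => α y (zeta G I y X)) ((extChartAt I x).symm y)) =ᶠ[𝓝 y₀]
      fun z => rep1 α x z (fderiv ℝ a (idChart EG G 1, z) (X, 0)) := by
    filter_upwards [eventually_chart hx (Filter.Eventually.of_forall fun _ => trivial)]
      with y ⟨z, hz, hy, hyz, _⟩
    rw [hyz, hy, ha, fderiv_actChart_one_left hz, rep1_apply _ hz, frame_coframe hz]
  rw [extD_oneForm_apply hα hx, diff_apply hx hd, h4.fderiv_eq, h3]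
  have h5 := fderiv_actChart_one_left (EG := EG) (G := G) (I := I) hx X
  rw [← ha, ← hy₀] at h5
  change fderiv ℝ (rep1 α x) y₀ (coframe I x x (zeta G I x X)) u -
    fderiv ℝ (rep1 α x) y₀ u (coframe I x x (zeta G I x X)) = _
  rw [← h5, eq_neg_of_add_eq_zero_left h2, ha, hy₀, actHess_symm x X u]
  change -(rep1 α x y₀ (actHess G I x X u)) - _ = _
  abel

/-- The derivative of a one-form on fundamental vectors, at a point where the fundamental vector
field vanishes. -/
lemma diff_apply_zeta_of_zeta_eq_zero {α : ∀ x : M, TangentSpace I x →L[ℝ] V}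
    (hα : SmoothOneForm α) {Y : EG} {x : M} (hY : zeta G I x Y = 0)
    (hd : MDifferentiableAt I 𝓘(ℝ, V) (fun y => α y (zeta G I y Y)) x) (v : TangentSpace I x) :
    diff I (fun y => α y (zeta G I y Y)) x v =
      α x (frame I x x (actHess G I x Y (coframe I x x v))) := by
  have hx := mem_chart_source H x
  have hs : ContDiffAt ℝ ∞ (actChart (EG := EG) G I x) (idChart EG G 1, extChartAt I x x) :=
    contDiffAt_actChart hx
  have h3 := fderiv_pairing_right (hα.differentiableAt hx) hs Y (coframe I x x v)
  have h4 : (fun y => (fun y => α y (zeta G I y Y)) ((extChartAt I x).symm y))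
      =ᶠ[𝓝 (extChartAt I x x)]
      fun z => rep1 α x z (fderiv ℝ (actChart (EG := EG) G I x) (idChart EG G 1, z) (Y, 0)) := by
    filter_upwards [eventually_chart hx (Filter.Eventually.of_forall fun _ => trivial)]
      with y ⟨z, hz, hy, hyz, _⟩
    rw [hyz, hy, fderiv_actChart_one_left hz, rep1_apply _ hz, frame_coframe hz]
  rw [diff_apply hx hd, h4.fderiv_eq, h3, fderiv_actChart_one_left hx, hY, actHess_symm,
    rep1_apply _ hx, ContinuousLinearMap.map_zero, ContinuousLinearMap.map_zero, zero_add]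

lemma inverse_mfderivWithin_symm {x₀ : M} {y : E} (hy : y ∈ (extChartAt I x₀).target) :
    (mfderivWithin 𝓘(ℝ, E) I (extChartAt I x₀).symm (Set.range I) y).inverse =
      coframe I x₀ ((extChartAt I x₀).symm y) := by
  have hx : (extChartAt I x₀).symm y ∈ (chartAt H x₀).source := by
    simpa using (extChartAt I x₀).map_target hy
  rw [mfderivWithin_symm_eq_frame hy]
  exact ContinuousLinearMap.inverse_eq (ContinuousLinearMap.ext fun v => frame_coframe hx v)
    (ContinuousLinearMap.ext fun v => coframe_frame (E := E) (I := I) (x₀ := x₀) hx v)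

/-- Left invariant vector fields in the preferred chart at `1`. -/
lemma fderiv_mulChart_right (Y : EG) : ∀ᶠ k in 𝓝 (idChart EG G 1),
    fderiv ℝ (actChart (EG := EG) G 𝓘(ℝ, EG) (1 : G)) (k, idChart EG G 1) (0, Y) =
      coframe 𝓘(ℝ, EG) 1 ((idChart EG G).symm k)
        (mulInvariantVectorField (I := 𝓘(ℝ, EG)) (G := G) Y ((idChart EG G).symm k)) := by
  have h1 : (1 : G) ∈ (chartAt EG (1 : G)).source := mem_chart_source EG (1 : G)
  filter_upwards [eventually_idChart (EG := EG)
    (eventually_smul_mem_source EG 𝓘(ℝ, EG) (G := G) h1), (tendsto_prodMk_left _ _).eventually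
      (eventually_differentiableAt_actChart (EG := EG) (G := G) (I := 𝓘(ℝ, EG)) h1)] with k hk hd
  rw [fderiv_actChart_right h1 hk.2 hd, frame_self]
  exact congrArg (fun g : G => (coframe 𝓘(ℝ, EG) 1 g : EG →L[ℝ] EG)
    (mulInvariantVectorField (I := 𝓘(ℝ, EG)) (G := G) Y ((idChart EG G).symm k)))
    (mul_one ((idChart EG G).symm k))

/-- The bracket of the Lie algebra in terms of the second derivative of the multiplication. -/
lemma lieBr_eq_actHess (X Y : EG) :
    lieBr G X Y = actHess G 𝓘(ℝ, EG) (1 : G) X Y - actHess G 𝓘(ℝ, EG) (1 : G) Y X := by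
  have h1 : (1 : G) ∈ (chartAt EG (1 : G)).source := mem_chart_source EG (1 : G)
  -- In the chart at `1` a left invariant field is the partial derivative of the multiplication in
  -- its second factor, so its own derivative is a mixed second derivative.
  have hV : ∀ X : EG, VectorField.mpullbackWithin 𝓘(ℝ, EG) 𝓘(ℝ, EG) (extChartAt 𝓘(ℝ, EG) (1 : G)).symm
      (mulInvariantVectorField (I := 𝓘(ℝ, EG)) (G := G) X) (Set.range 𝓘(ℝ, EG))
      =ᶠ[𝓝 (idChart EG G 1)]
      fun k => fderiv ℝ (actChart (EG := EG) G 𝓘(ℝ, EG) (1 : G)) (k, idChart EG G 1) (0, X) := by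
    intro X
    filter_upwards [eventually_idChart (EG := EG)
      (eventually_smul_mem_source EG 𝓘(ℝ, EG) (G := G) h1), fderiv_mulChart_right X] with k hk hX
    rw [hX, VectorField.mpullbackWithin_apply, inverse_mfderivWithin_symm hk.1]
    rfl
  have hs : ContDiffAt ℝ ∞ (actChart (EG := EG) G 𝓘(ℝ, EG) (1 : G))
    (idChart EG G 1, idChart EG G 1) := contDiffAt_actChart h1
  have hD : ∀ X Y : EG, fderiv ℝ (fun k => fderiv ℝ (actChart (EG := EG) G 𝓘(ℝ, EG) (1 : G))
      (k, idChart EG G 1) (0, X)) (idChart EG G 1) Y = actHess G 𝓘(ℝ, EG) (1 : G) Y X := by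
    intro X Y
    rw [((hasFDerivAt_fderiv_left hs).clm_apply (hasFDerivAt_const ((0 : EG), X) _)).fderiv]
    simp [actHess]
  have h0 : ∀ X : EG, fderiv ℝ (actChart (EG := EG) G 𝓘(ℝ, EG) (1 : G))
      (idChart EG G 1, idChart EG G 1) (0, X) = X := fun X => fderiv_actChart_one_right h1 X
  have h2 : (mfderiv 𝓘(ℝ, EG) 𝓘(ℝ, EG) (extChartAt 𝓘(ℝ, EG) (1 : G)) 1).inverse =
      ContinuousLinearMap.id ℝ EG := by
    rw [mfderiv_chart_eq_coframe h1]
    refine ContinuousLinearMap.inverse_eq ?_ ?_ <;> ext v <;> exact coframe_self (1 : G) v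
  set VX : EG → EG := VectorField.mpullbackWithin 𝓘(ℝ, EG) 𝓘(ℝ, EG)
    (extChartAt 𝓘(ℝ, EG) (1 : G)).symm (mulInvariantVectorField (I := 𝓘(ℝ, EG)) (G := G) X)
    (Set.range 𝓘(ℝ, EG)) with hVX
  set VY : EG → EG := VectorField.mpullbackWithin 𝓘(ℝ, EG) 𝓘(ℝ, EG)
    (extChartAt 𝓘(ℝ, EG) (1 : G)).symm (mulInvariantVectorField (I := 𝓘(ℝ, EG)) (G := G) Y)
    (Set.range 𝓘(ℝ, EG)) with hVY
  -- By definition the bracket is computed by pulling the invariant fields back to the chart and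
  -- bracketing them there.
  have h3 : lieBr G X Y = ((mfderiv 𝓘(ℝ, EG) 𝓘(ℝ, EG) (extChartAt 𝓘(ℝ, EG) (1 : G)) 1).inverse :
      EG →L[ℝ] EG) (VectorField.lieBracketWithin ℝ (E := EG) VX VY
        ((extChartAt 𝓘(ℝ, EG) (1 : G)).symm ⁻¹' Set.univ ∩ Set.range 𝓘(ℝ, EG))
        (idChart EG G 1)) := rfl
  rw [ModelWithCorners.range_eq_univ, Set.preimage_univ, Set.univ_inter,
    VectorField.lieBracketWithin_univ, h2, (hV X).lieBracket_vectorField_eq (hV Y)] at h3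
  rw [h3, VectorField.lieBracket, h0, h0, hD, hD]
  rfl

/-- Fundamental vector fields of brackets, in charts. -/
lemma coframe_zeta_lieBr (x : M) (X Y : EG) :
    coframe I x x (zeta G I x (lieBr G X Y)) =
      actHess G I x X (coframe I x x (zeta G I x Y)) -
        actHess G I x Y (coframe I x x (zeta G I x X)) := by
  have h1 : (1 : G) ∈ (chartAt EG (1 : G)).source := mem_chart_source EG (1 : G)
  have hx := mem_chart_source H x
  have hsb : ContDiffAt ℝ ∞ (actChart (EG := EG) G 𝓘(ℝ, EG) (1 : G))
    (idChart EG G 1, idChart EG G 1) := contDiffAt_actChart h1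
  have hs : ContDiffAt ℝ ∞ (actChart (EG := EG) G I x) (idChart EG G 1, extChartAt I x x) :=
    contDiffAt_actChart hx
  -- The identity of `mfderiv_smul_zeta` for `Y`, differentiated at `1` in the direction `X`. The
  -- pure second derivative in the group variable is symmetric in `X` and `Y`, so it drops out on
  -- antisymmetrizing.
  have key : ∀ X Y : EG,
      fderiv ℝ (fderiv ℝ (actChart (EG := EG) G I x)) (idChart EG G 1, extChartAt I x x) (X, 0) (Y, 0) +
      coframe I x x (zeta G I x (actHess G 𝓘(ℝ, EG) (1 : G) X Y)) =
        actHess G I x X (coframe I x x (zeta G I x Y)) := by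
    intro X Y
    have e : ∀ᶠ k in 𝓝 (idChart EG G 1),
        fderiv ℝ (actChart (EG := EG) G I x) (k, extChartAt I x x)
          (fderiv ℝ (actChart (EG := EG) G 𝓘(ℝ, EG) (1 : G)) (k, idChart EG G 1) (0, Y), 0) =
        fderiv ℝ (actChart (EG := EG) G I x) (k, extChartAt I x x)
          (0, coframe I x x (zeta G I x Y)) := by
      filter_upwards [eventually_idChart (EG := EG) (eventually_smul_mem_source EG I (G := G) hx),
        (tendsto_prodMk_left _ _).eventually
          (eventually_differentiableAt_actChart (EG := EG) (G := G) (I := I) hx),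
        fderiv_mulChart_right Y] with k hk hd hY
      have hk' : (idChart EG G).symm k ∈ (chartAt EG (1 : G)).source := by
        simpa using (idChart EG G).map_target hk.1
      rw [hY, fderiv_actChart_left hx hk.1 hk.2 hd, fderiv_actChart_right hx hk.2 hd,
        frame_coframe hx, frame_coframe hk', mfderiv_smul_zeta]
    have hL := (hasFDerivAt_fderiv_left hsb).clm_apply
      (hasFDerivAt_const ((0 : EG), Y) (idChart EG G 1))
    have h3 := (hasFDerivAt_fderiv_left hs).clm_apply
      (hL.prodMk (hasFDerivAt_const (0 : E) (idChart EG G 1)))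
    have h4 := (hasFDerivAt_fderiv_left hs).clm_apply
      (hasFDerivAt_const ((0 : EG), coframe I x x (zeta G I x Y)) (idChart EG G 1))
    have h5 := congrArg (fun L : EG →L[ℝ] E => L X) (h3.unique (h4.congr_of_eventuallyEq e))
    have h0 : fderiv ℝ (actChart (EG := EG) G 𝓘(ℝ, EG) (1 : G))
      (idChart EG G 1, idChart EG G 1) (0, Y) = Y := fderiv_actChart_one_right h1 Y
    rw [← fderiv_actChart_one_left hx]
    simp only [_root_.add_apply, ContinuousLinearMap.comp_apply, ContinuousLinearMap.flip_apply, h0,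
      ContinuousLinearMap.prod_apply, ContinuousLinearMap.inl_apply, _root_.zero_apply, map_zero,
      zero_add] at h5
    rw [add_comm]
    exact h5
  have sym : fderiv ℝ (fderiv ℝ (actChart (EG := EG) G I x)) (idChart EG G 1, extChartAt I x x)
      (X, 0) (Y, 0) = fderiv ℝ (fderiv ℝ (actChart (EG := EG) G I x))
        (idChart EG G 1, extChartAt I x x) (Y, 0) (X, 0) :=
    (hs.isSymmSndFDerivAt minSmoothness_two_le_infty) _ _
  rw [← key X Y, ← key Y X, lieBr_eq_actHess, sym, ContinuousLinearMap.map_sub,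
    ContinuousLinearMap.map_sub]
  abel

end Infinitesimal

end GaugedCotangent

end

noncomputable section

namespace GaugedCotangent

/-! ### Isotropy algebras and isotropy groups -/

section Stabilizers

variable {EG : Type*} [NormedAddCommGroup EG] [NormedSpace ℝ EG]
  {G : Type*} [TopologicalSpace G] [ChartedSpace EG G] [Group G] [LieGroup 𝓘(ℝ, EG) ∞ G]
  {E H M : Type*} [NormedAddCommGroup E] [NormedSpace ℝ E] [TopologicalSpace H]
  {I : ModelWithCorners ℝ E H} [TopologicalSpace M] [ChartedSpace H M] [IsManifold I ∞ M]
  [MulAction G M] [ContMDiffSMul 𝓘(ℝ, EG) I ∞ G M] [I.Boundaryless]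

/-- A vector in the isotropy Lie algebra is tangent to a curve in the isotropy group. -/
lemma exists_curve_stabilizer [CompleteSpace EG] [T2Space G] {x : M} {Y : EG}
    (hY : zeta G I x Y = 0) :
    ∃ k : ℝ → G, k 0 = 1 ∧ ContinuousAt k 0 ∧ (∀ᶠ t in 𝓝 (0 : ℝ), k t • x = x) ∧
      HasDerivAt (fun t => idChart EG G (k t)) Y 0 := by
  have : LieGroup 𝓘(ℝ, EG) (minSmoothness ℝ 3) G :=
    LieGroup.of_le (n := ∞) (by simpa using ENat.LEInfty.out)
  have hv : ContMDiffAt 𝓘(ℝ, EG) 𝓘(ℝ, EG).tangent 1 (fun g : G =>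
      (⟨g, mulInvariantVectorField (I := 𝓘(ℝ, EG)) (G := G) Y g⟩ : TangentBundle 𝓘(ℝ, EG) G)) 1 :=
    ((contMDiff_mulInvariantVectorField (I := 𝓘(ℝ, EG)) (G := G) Y).of_le
      (by simp)).contMDiffAt
  -- The curve is an integral curve through `1` of the left invariant field of `Y`.
  obtain ⟨γ, h0, hγ⟩ := exists_isMIntegralCurveAt_of_contMDiffAt_boundaryless 0 hv
  have hγ' : ∀ᶠ t in 𝓝 (0 : ℝ), HasMFDerivAt 𝓘(ℝ, ℝ) 𝓘(ℝ, EG) γ t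
    (ContinuousLinearMap.smulRight (1 : ℝ →L[ℝ] ℝ)
      (mulInvariantVectorField (I := 𝓘(ℝ, EG)) (G := G) Y (γ t))) := hγ
  have hc0 : ContinuousAt γ 0 := hγ'.self_of_nhds.continuousAt
  have hx : x ∈ (chartAt H x).source := mem_chart_source H x
  have hsrc : ∀ᶠ t in 𝓝 (0 : ℝ), γ t • x ∈ (chartAt H x).source := by
    refine hc0.eventually (p := fun g : G => g • x ∈ (chartAt H x).source) ?_
    rw [h0]
    exact eventually_smul_mem_source EG I hx
  have hd : ∀ᶠ t in 𝓝 (0 : ℝ), γ t • x ∈ (chartAt H x).source ∧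
      HasFDerivAt (fun s => extChartAt I x (γ s • x)) (0 : ℝ →L[ℝ] E) t := by
    filter_upwards [hγ', hsrc] with t h1 h2
    refine ⟨h2, ?_⟩
    have h3 := ((contMDiff_smul_right (EG := EG) (G := G) (I := I) x).contMDiffAt.mdifferentiableAt
      (x := γ t) (by simp)).hasMFDerivAt.comp t h1
    have h4 := (mdifferentiableAt_extChartAt (I := I) h2).hasMFDerivAt.comp t h3
    have h5 : HasFDerivAt (fun s => extChartAt I x (γ s • x)) _ t := h4.hasFDerivAt
    refine h5.congr_fderiv (ContinuousLinearMap.ext fun (r : ℝ) => ?_)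
    change (mfderiv I 𝓘(ℝ, E) (extChartAt I x) (γ t • x) : E →L[ℝ] E)
      (mfderiv 𝓘(ℝ, EG) I (fun g : G => g • x) (γ t)
        ((r : ℝ) • (mulInvariantVectorField (I := 𝓘(ℝ, EG)) (G := G) Y (γ t) : EG))) = 0
    -- By left invariance the velocity of `γ t • x` is the image under `γ t` of `ζ_Y(x) = 0`. A
    -- vanishing derivative then makes the orbit curve constant near `0`.
    rw [ContinuousLinearMap.map_smul, ← mfderiv_smul_zeta, hY]
    simp only [map_zero, smul_zero]
  obtain ⟨ε, hε, hball⟩ := Metric.eventually_nhds_iff_ball.1 hd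
  refine ⟨γ, h0, hc0, ?_, ?_⟩
  · filter_upwards [Metric.ball_mem_nhds (0 : ℝ) hε] with t ht
    have hconst := Metric.isOpen_ball.is_const_of_fderiv_eq_zero
      (convex_ball (0 : ℝ) ε).isPreconnected (𝕜 := ℝ) (f := fun s => extChartAt I x (γ s • x))
      (fun s hs => (hball s hs).2.differentiableAt.differentiableWithinAt)
      (fun s hs => (hball s hs).2.fderiv) ht (Metric.mem_ball_self hε)
    simp only [h0, one_smul] at hconst
    exact (extChartAt I x).injOn (by simpa using (hball t ht).1) (by simp) hconst
  · have h1 := hγ'.self_of_nhds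
    have hg : γ 0 ∈ (chartAt EG (1 : G)).source := by rw [h0]; exact mem_chart_source EG 1
    have h4 := (mdifferentiableAt_extChartAt (I := 𝓘(ℝ, EG)) hg).hasMFDerivAt.comp 0 h1
    have h5 : HasFDerivAt (fun s => idChart EG G (γ s))
        (ContinuousLinearMap.smulRight (1 : ℝ →L[ℝ] ℝ) Y) 0 := by
      have h6 : HasFDerivAt (fun s => idChart EG G (γ s)) _ 0 := h4.hasFDerivAt
      refine h6.congr_fderiv (ContinuousLinearMap.ext fun (r : ℝ) => ?_)
      change (mfderiv 𝓘(ℝ, EG) 𝓘(ℝ, EG) (extChartAt 𝓘(ℝ, EG) (1 : G)) (γ 0) : EG →L[ℝ] EG)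
        ((r : ℝ) • (mulInvariantVectorField (I := 𝓘(ℝ, EG)) (G := G) Y (γ 0) : EG)) = r • Y
      rw [ContinuousLinearMap.map_smul, mfderiv_chart_eq_coframe hg]
      congr 1
      rw [h0]
      refine (coframe_self (I := 𝓘(ℝ, EG)) (1 : G) _).trans ?_
      have h7 : (fun h : G => (1 : G) * h) = id := funext fun h => one_mul h
      have h8 : mfderiv 𝓘(ℝ, EG) 𝓘(ℝ, EG) (fun h : G => (1 : G) * h) 1 =
          ContinuousLinearMap.id ℝ EG := by
        rw [h7]
        exact mfderiv_id (I := 𝓘(ℝ, EG)) (x := (1 : G))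
      exact congrArg (fun L : EG →L[ℝ] EG => L Y) h8
    simpa using h5.hasDerivAt

/-- A vector that is fixed by the isotropy group is annihilated by the linearizations of the
fundamental vector fields of the isotropy Lie algebra. -/
lemma actHess_eq_zero_of_fixed [CompleteSpace EG] [T2Space G] {x : M} {Y : EG}
    (hY : zeta G I x Y = 0) {v : TangentSpace I x}
    (hv : ∀ g : G, g • x = x →
      coframe I x (g • x) (mfderiv I I (fun z : M => g • z) x v) = coframe I x x v) :
    actHess G I x Y (coframe I x x v) = 0 := by
  obtain ⟨k, h0, hc, hk, hd⟩ := exists_curve_stabilizer hY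
  have hx : x ∈ (chartAt H x).source := mem_chart_source H x
  have hs : ContDiffAt ℝ ∞ (actChart (EG := EG) G I x) (idChart EG G (k 0), extChartAt I x x) := by
    rw [h0]; exact contDiffAt_actChart hx
  have h1 : ∀ᶠ t in 𝓝 (0 : ℝ), fderiv ℝ (actChart (EG := EG) G I x)
      (idChart EG G (k t), extChartAt I x x) (0, coframe I x x v) = coframe I x x v := by
    have hk1 : ∀ᶠ t in 𝓝 (0 : ℝ), k t ∈ (chartAt EG (1 : G)).source := by
      apply hc.eventually
      rw [h0]
      exact (chartAt EG (1 : G)).open_source.mem_nhds (mem_chart_source EG 1)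
    have hd1 : ∀ᶠ t in 𝓝 (0 : ℝ), DifferentiableAt ℝ (actChart (EG := EG) G I x)
        (idChart EG G (k t), extChartAt I x x) := by
      have := (tendsto_prodMk_left (idChart EG G 1) (extChartAt I x x)).eventually
        (eventually_differentiableAt_actChart (EG := EG) (G := G) (I := I) hx)
      refine hd.continuousAt.eventually (p := fun z => DifferentiableAt ℝ
        (actChart (EG := EG) G I x) (z, extChartAt I x x)) ?_
      simp only [h0]
      exact this
    filter_upwards [hk, hk1, hd1] with t ht ht1 htd
    have e : (idChart EG G).symm (idChart EG G (k t)) = k t :=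
      (extChartAt 𝓘(ℝ, EG) (1 : G)).left_inv (by simpa using ht1)
    have h2 := fderiv_actChart_right hx (k := idChart EG G (k t)) (by rw [e, ht]; exact hx) htd
      (coframe I x x v)
    rw [e, frame_coframe hx, hv _ ht] at h2
    exact h2
  -- The expression in `h1` is constant in `t`. Its derivative at `0` is the mixed second derivative
  -- in the directions `Y` and `v`.
  have h3 := HasFDerivAt.comp_hasDerivAt (0 : ℝ) (hasFDerivAt_fderiv_left hs) hd
  have h4 := h3.clm_apply (hasDerivAt_const (0 : ℝ) ((0 : EG), coframe I x x v))
  have h5 := h4.unique ((hasDerivAt_const (0 : ℝ) (coframe I x x v)).congr_of_eventuallyEq h1)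
  simp only [ContinuousLinearMap.comp_apply, ContinuousLinearMap.inl_apply, h0, map_zero,
    add_zero] at h5
  exact h5

end Stabilizers

end GaugedCotangent

end

noncomputable section

namespace GaugedCotangent

/-! ### First order approximation of curves inside an orbit -/

section OrbitDirections

open Asymptotics Filter

variable {EG : Type*} [NormedAddCommGroup EG] [NormedSpace ℝ EG]
  {G : Type*} [TopologicalSpace G] [ChartedSpace EG G] [Group G] [LieGroup 𝓘(ℝ, EG) ∞ G]
  {E H M : Type*} [NormedAddCommGroup E] [NormedSpace ℝ E] [TopologicalSpace H]
  {I : ModelWithCorners ℝ E H} [TopologicalSpace M] [ChartedSpace H M] [IsManifold I ∞ M]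
  [MulAction G M] [ContMDiffSMul 𝓘(ℝ, EG) I ∞ G M] [I.Boundaryless]

/-- The derivative of the group multiplication at `(1, 1)`, read in the chart at `1`. -/
lemma hasFDerivAt_mulChart :
    HasFDerivAt (actChart (EG := EG) G 𝓘(ℝ, EG) (1 : G))
      (ContinuousLinearMap.fst ℝ EG EG + ContinuousLinearMap.snd ℝ EG EG)
      (idChart EG G 1, idChart EG G 1) := by
  have hx : (1 : G) ∈ (chartAt EG (1 : G)).source := mem_chart_source EG 1
  have h : HasFDerivAt (actChart (EG := EG) G 𝓘(ℝ, EG) (1 : G)) _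
      (idChart EG G 1, idChart EG G 1) :=
    ((contDiffAt_actChart (EG := EG) (G := G) (I := 𝓘(ℝ, EG)) hx).differentiableAt
      (by simp)).hasFDerivAt
  refine h.congr_fderiv (ContinuousLinearMap.ext fun p => ?_)
  have e1 := fderiv_actChart_one_left (EG := EG) (G := G) (I := 𝓘(ℝ, EG)) hx p.1
  have e2 := fderiv_actChart_one_right (EG := EG) (G := G) (I := 𝓘(ℝ, EG)) hx p.2
  have e3 : coframe 𝓘(ℝ, EG) (1 : G) 1 (zeta G 𝓘(ℝ, EG) (1 : G) p.1) = p.1 := by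
    refine (coframe_self (I := 𝓘(ℝ, EG)) (1 : G) _).trans ?_
    have h7 : (fun h : G => h • (1 : G)) = id := funext fun h => mul_one h
    have h8 : zeta G 𝓘(ℝ, EG) (1 : G) = ContinuousLinearMap.id ℝ EG := by
      rw [zeta, h7]
      exact mfderiv_id (I := 𝓘(ℝ, EG)) (x := (1 : G))
    exact congrArg (fun L : EG →L[ℝ] EG => L p.1) h8
  have e4 : p = (p.1, 0) + (0, p.2) := by simp
  rw [e4, ContinuousLinearMap.map_add]
  refine (congrArg₂ (· + ·) (e1.trans e3) e2).trans ?_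
  simp

set_option maxHeartbeats 800000 in
/-- If the orbit of `x` contains points that are asymptotic to `x + t v`, and that are reached by
group elements tending to `1`, then `v` is tangent to the orbit. -/
lemma exists_zeta_eq_of_isLittleO [FiniteDimensional ℝ EG] [T2Space G] {x : M}
    {U : Ultrafilter ℝ} (hU : ↑U ≤ 𝓝[≠] (0 : ℝ)) {h : ℝ → G} (hh : Tendsto h U (𝓝 1)) {v : E}
    (hv : (fun t => extChartAt I x (h t • x) - extChartAt I x x - t • v) =o[U] fun t : ℝ => t) :
    ∃ X : EG, coframe I x x (zeta G I x X) = v := by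
  have : CompleteSpace EG := FiniteDimensional.complete ℝ EG
  have : ProperSpace EG := FiniteDimensional.proper ℝ EG
  set e := idChart EG G 1 with he
  have hx : x ∈ (chartAt H x).source := mem_chart_source H x
  have ht0 : Tendsto (fun t : ℝ => t) U (𝓝 0) := tendsto_id.mono_left (hU.trans nhdsWithin_le_nhds)
  have hne : ∀ᶠ t in (U : Filter ℝ), t ≠ 0 := hU self_mem_nhdsWithin
  have hsrc : ∀ᶠ t in (U : Filter ℝ), h t ∈ (idChart EG G).source :=
    hh.eventually ((isOpen_extChartAt_source (I := 𝓘(ℝ, EG)) (1 : G)).mem_nhds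
      (mem_extChartAt_source 1))
  have hce : ContinuousAt (idChart EG G) 1 := continuousAt_extChartAt (I := 𝓘(ℝ, EG)) (1 : G)
  -- nearly minimal representatives
  have hmin : ∀ t : ℝ, ∃ g : G, t ≠ 0 → h t ∈ (idChart EG G).source →
      g ∈ (idChart EG G).source ∧ g • x = h t • x ∧
      ∀ k ∈ (idChart EG G).source, k • x = h t • x →
        ‖idChart EG G g - e‖ ≤ ‖idChart EG G k - e‖ + t ^ 2 := by
    intro t
    by_cases hc : t ≠ 0 ∧ h t ∈ (idChart EG G).source
    swap
    · exact ⟨1, fun h1 h2 => (hc ⟨h1, h2⟩).elim⟩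
    let S : Set ℝ := {r | ∃ g ∈ (idChart EG G).source, g • x = h t • x ∧
      ‖idChart EG G g - e‖ = r}
    have hS : S.Nonempty := ⟨_, h t, hc.2, rfl, rfl⟩
    have hb : BddBelow S := ⟨0, by rintro _ ⟨g, -, -, rfl⟩; positivity⟩
    -- The infimum need not be attained. The slack `t ^ 2` is positive, and negligible against `t`.
    obtain ⟨_, ⟨g, hg1, hg2, rfl⟩, hg3⟩ := exists_lt_of_csInf_lt hS
      (lt_add_of_pos_right (sInf S) (by have := hc.1; positivity : 0 < t ^ 2))
    refine ⟨g, fun _ _ => ⟨hg1, hg2, fun k hk1 hk2 => hg3.le.trans ?_⟩⟩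
    gcongr
    exact csInf_le hb ⟨k, hk1, hk2, rfl⟩
  choose g hg using hmin
  set ξ : ℝ → EG := fun t => idChart EG G (g t) - e with hξ
  have hgs : ∀ᶠ t in (U : Filter ℝ), g t ∈ (idChart EG G).source ∧ g t • x = h t • x ∧
      ∀ k ∈ (idChart EG G).source, k • x = h t • x → ‖ξ t‖ ≤ ‖idChart EG G k - e‖ + t ^ 2 := by
    filter_upwards [hne, hsrc] with t h1 h2 using hg t h1 h2
  have hξ0 : Tendsto ξ U (𝓝 0) := by
    have h1 : Tendsto (fun t => ‖idChart EG G (h t) - e‖ + t ^ 2) U (𝓝 0) := by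
      have := ((hce.tendsto.comp hh).sub_const e).norm.add (ht0.pow 2)
      have e0 : ‖idChart EG G 1 - e‖ + 0 ^ 2 = 0 := by rw [he]; simp
      rw [e0] at this
      exact this
    refine squeeze_zero_norm' ?_ h1
    filter_upwards [hgs, hsrc] with t ht1 ht2 using ht1.2.2 _ ht2 rfl
  have hgξ : ∀ᶠ t in (U : Filter ℝ), (idChart EG G).symm (e + ξ t) = g t := by
    filter_upwards [hgs] with t ht
    rw [hξ]
    simp only [add_sub_cancel]
    exact (idChart EG G).left_inv ht.1
  have hg1 : Tendsto g U (𝓝 1) := by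
    have h1 : ContinuousAt (idChart EG G).symm e := continuousAt_extChartAt_symm (I := 𝓘(ℝ, EG)) (1 : G)
    have h2 : Tendsto (fun t => e + ξ t) U (𝓝 e) := by simpa using hξ0.const_add e
    have h3 := (h1.tendsto.comp h2).congr' hgξ
    rwa [idChart_symm_one] at h3
  -- the first order expansion of the orbit map
  set L : EG →L[ℝ] E := (fderiv ℝ (actChart (EG := EG) G I x) (e, extChartAt I x x)).comp
    (ContinuousLinearMap.inl ℝ EG E) with hL
  have hLz : ∀ X, L X = coframe I x x (zeta G I x X) := fderiv_actChart_one_left hx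
  have hexp : (fun t => t • v - L (ξ t)) =o[U] fun t => ‖t‖ + ‖ξ t‖ := by
    have h0 : HasFDerivAt (actChart (EG := EG) G I x) (fderiv ℝ (actChart (EG := EG) G I x)
        (e, extChartAt I x x)) (e, extChartAt I x x) :=
      ((contDiffAt_actChart hx).differentiableAt (by simp)).hasFDerivAt
    have h1 : HasFDerivAt (fun k => actChart (EG := EG) G I x (k, extChartAt I x x)) L e :=
      HasFDerivAt.comp (f := fun k : EG => (k, extChartAt I x x)) e h0
        (hasFDerivAt_prodMk_left e (extChartAt I x x))
    have h2 := (hasFDerivAt_iff_isLittleO_nhds_zero.1 h1).comp_tendsto hξ0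
    have h3 : (fun t => actChart (EG := EG) G I x (e + ξ t, extChartAt I x x) -
        extChartAt I x x - L (ξ t)) =o[U] ξ := by
      refine h2.congr_left fun t => ?_
      simp only [Function.comp_apply]
      rw [he, actChart_one hx]
    have h4 : (fun t => ξ t) =O[U] fun t => ‖t‖ + ‖ξ t‖ :=
      IsBigO.of_bound 1 (Eventually.of_forall fun t => by
        rw [one_mul, Real.norm_of_nonneg (by positivity)]; linarith [norm_nonneg t])
    have h5 : (fun t : ℝ => t) =O[U] fun t : ℝ => ‖t‖ + ‖ξ t‖ :=
      IsBigO.of_bound 1 (Eventually.of_forall fun t : ℝ => by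
        rw [one_mul, Real.norm_of_nonneg (by positivity : 0 ≤ ‖t‖ + ‖ξ t‖)]; linarith [norm_nonneg (ξ t)])
    refine ((h3.trans_isBigO h4).sub (hv.trans_isBigO h5)).congr' ?_ EventuallyEq.rfl
    filter_upwards [hgξ, hgs] with t ht1 ht2
    rw [actChart_apply _ _ hx, ht1, ht2.2.1]
    abel
  -- If `ξ = O(t)`, a limit of `ξ / t` in a compact ball is the required `X`. Otherwise `t = o(ξ)`;
  -- the unit directions of `ξ` then converge to an isotropy vector, and this contradicts near
  -- minimality.
  by_cases hC : ∃ C : ℝ, ∀ᶠ t in (U : Filter ℝ), ‖ξ t‖ ≤ C * ‖t‖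
  · obtain ⟨C, hC⟩ := hC
    have h1 : ∀ᶠ t in (U : Filter ℝ), t⁻¹ • ξ t ∈ Metric.closedBall (0 : EG) C := by
      filter_upwards [hC, hne] with t ht ht'
      rw [mem_closedBall_zero_iff, norm_smul, norm_inv, inv_mul_le_iff₀ (by positivity), mul_comm]
      exact ht
    obtain ⟨X, -, hX⟩ := (isCompact_closedBall (0 : EG) C).ultrafilter_le_nhds
      (U.map fun t => t⁻¹ • ξ t) (le_principal_iff.2 h1)
    refine ⟨X, ?_⟩
    rw [← hLz]
    have h2 : Tendsto (fun t => L (t⁻¹ • ξ t)) U (𝓝 (L X)) :=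
      (L.continuous.tendsto X).comp hX
    have h3 : (fun t => t • v - L (ξ t)) =o[U] fun t : ℝ => t := by
      refine hexp.trans_isBigO (IsBigO.of_bound (1 + C) ?_)
      filter_upwards [hC] with t ht
      rw [Real.norm_of_nonneg (by positivity)]
      linarith
    have h4 : Tendsto (fun t => v - L (t⁻¹ • ξ t)) U (𝓝 0) := by
      refine squeeze_zero_norm' (Eventually.of_forall fun _ => le_rfl) ?_
      have h5 := h3.norm_norm.tendsto_div_nhds_zero
      refine h5.congr' ?_
      filter_upwards [hne] with t ht
      have : v - L (t⁻¹ • ξ t) = t⁻¹ • (t • v - L (ξ t)) := by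
        rw [smul_sub t⁻¹ (t • v), inv_smul_smul₀ ht, map_smul]
      rw [this, norm_smul, norm_inv, div_eq_inv_mul]
    have h6 := tendsto_nhds_unique h4 (h2.const_sub v)
    exact (sub_eq_zero.1 h6.symm).symm
  · exfalso
    -- An ultrafilter decides every inequality, so the failure of each bound holds eventually and
    -- not merely frequently. No subsequences are needed.
    simp only [not_exists, ← Ultrafilter.eventually_not, not_le] at hC
    have hlt : ∀ C : ℝ, ∀ᶠ t in (U : Filter ℝ), C * ‖t‖ < ‖ξ t‖ := hC
    have hpos : ∀ᶠ t in (U : Filter ℝ), 0 < ‖ξ t‖ := by simpa using hlt 0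
    have h1 : ∀ᶠ t in (U : Filter ℝ), ‖ξ t‖⁻¹ • ξ t ∈ Metric.sphere (0 : EG) 1 := by
      filter_upwards [hpos] with t ht
      rw [mem_sphere_zero_iff_norm, norm_smul, norm_inv, norm_norm, inv_mul_cancel₀ ht.ne']
    obtain ⟨X, hX1, hX⟩ := (isCompact_sphere (0 : EG) 1).ultrafilter_le_nhds
      (U.map fun t => ‖ξ t‖⁻¹ • ξ t) (le_principal_iff.2 h1)
    have hX : Tendsto (fun t => ‖ξ t‖⁻¹ • ξ t) U (𝓝 X) := hX
    have htξ : (fun t : ℝ => t) =o[U] ξ := by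
      rw [isLittleO_iff]
      intro c hc
      filter_upwards [hlt c⁻¹] with t ht
      rw [inv_mul_lt_iff₀ hc] at ht
      exact ht.le
    have hL0 : zeta G I x X = 0 := by
      have h2 : Tendsto (fun t => L (‖ξ t‖⁻¹ • ξ t)) U (𝓝 (L X)) := (L.continuous.tendsto X).comp hX
      have h3 : (fun t => t • v - L (ξ t)) =o[U] ξ := by
        refine hexp.trans_isBigO ?_
        exact (htξ.norm_left.isBigO).add (isBigO_refl ξ _).norm_left
      have h4 : (fun t => L (ξ t)) =o[U] ξ := by
        have h5 : (fun t : ℝ => t • v) =o[U] ξ := by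
          have h6 : (fun t : ℝ => t • v) =O[U] fun t : ℝ => t :=
            IsBigO.of_bound ‖v‖ (Eventually.of_forall fun t => by rw [norm_smul, mul_comm])
          exact h6.trans_isLittleO htξ
        exact (h5.sub h3).congr_left fun t => by abel
      have h5 := h4.norm_norm.tendsto_div_nhds_zero
      have h7 : Tendsto (fun t => L (‖ξ t‖⁻¹ • ξ t)) U (𝓝 0) := by
        refine squeeze_zero_norm' (Eventually.of_forall fun _ => le_rfl) (h5.congr fun t => ?_)
        rw [map_smul, norm_smul, norm_inv, norm_norm, div_eq_inv_mul]
      have h8 := tendsto_nhds_unique h2 h7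
      rw [hLz] at h8
      exact (coframe_self (I := I) x _).symm.trans h8
    -- Right multiplication of `g t` by `k (-‖ξ t‖)` does not change the image of `x`, and it
    -- cancels the leading term `‖ξ t‖ • X` of `ξ t`.
    obtain ⟨k, hk0, hkc, hkx, hkd⟩ := exists_curve_stabilizer hL0
    have hs : Tendsto (fun t => -‖ξ t‖) U (𝓝 0) := by simpa using hξ0.norm.neg
    have hk1 : Tendsto (fun t => k (-‖ξ t‖)) U (𝓝 1) := by
      have := hkc.tendsto.comp hs
      rwa [hk0] at this
    have : IsTopologicalGroup G := topologicalGroup_of_lieGroup 𝓘(ℝ, EG) ∞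
    have hgk : Tendsto (fun t => g t * k (-‖ξ t‖)) U (𝓝 1) := by simpa using hg1.mul hk1
    have hopen := (isOpen_extChartAt_source (I := 𝓘(ℝ, EG)) (1 : G)).mem_nhds
      (mem_extChartAt_source 1)
    have hle : ∀ᶠ t in (U : Filter ℝ),
        ‖ξ t‖ ≤ ‖idChart EG G (g t * k (-‖ξ t‖)) - e‖ + t ^ 2 := by
      filter_upwards [hgs, hgk.eventually hopen, hs.eventually hkx] with t ht1 ht2 ht3
      exact ht1.2.2 _ ht2 (by rw [mul_smul, ht3, ht1.2.1])
    -- the chosen elements are not nearly minimal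
    set κ : ℝ → EG := fun t => idChart EG G (k (-‖ξ t‖)) - e with hκ
    have hκξ : (fun t => κ t + ‖ξ t‖ • X) =o[U] ξ := by
      have h2 := hkd.isLittleO.comp_tendsto hs
      rw [hk0] at h2
      have h3 : (fun t => κ t + ‖ξ t‖ • X) =o[U] fun t => -‖ξ t‖ := by
        refine h2.congr (fun t => ?_) fun t => ?_
        · simp only [Function.comp_apply, hκ, sub_zero, neg_smul]
          abel
        · simp
      exact h3.trans_isBigO (isBigO_refl ξ _).norm_left.neg_left
    have hξX : (fun t => ξ t - ‖ξ t‖ • X) =o[U] ξ := by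
      have h2 : Tendsto (fun t => ‖ξ t‖⁻¹ • ξ t - X) U (𝓝 0) := by simpa using hX.sub_const X
      have h3 : (fun t => ‖ξ t‖ • (‖ξ t‖⁻¹ • ξ t - X)) =o[U] fun t => ‖ξ t‖ • (1 : ℝ) :=
        (isBigO_refl (fun t => ‖ξ t‖) _).smul_isLittleO ((isLittleO_one_iff ℝ).2 h2)
      refine (h3.congr' ?_ (Eventually.of_forall fun t => by simp :
        _ =ᶠ[(U : Filter ℝ)] fun t => ‖ξ t‖)).of_norm_right
      filter_upwards [hpos] with t ht
      rw [smul_sub, smul_inv_smul₀ ht.ne']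
    have hsum : (fun t => ξ t + κ t) =o[U] ξ := (hξX.add hκξ).congr_left fun t => by abel
    have hκO : κ =O[U] ξ := (hsum.isBigO.sub (isBigO_refl ξ _)).congr_left fun t => by abel
    have hκ0 : Tendsto κ U (𝓝 0) := hκO.trans_tendsto hξ0
    have hm : (fun t => idChart EG G (g t * k (-‖ξ t‖)) - e) =o[U] ξ := by
      have h2 := (hasFDerivAt_iff_isLittleO_nhds_zero.1
        (hasFDerivAt_mulChart (EG := EG) (G := G))).comp_tendsto (hξ0.prodMk_nhds hκ0)
      have h3 : (fun t => (ξ t, κ t)) =O[U] ξ := (isBigO_refl ξ _).prod_left hκO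
      refine ((h2.trans_isBigO h3).add hsum).congr' ?_ EventuallyEq.rfl
      filter_upwards [hgξ, hk1.eventually (p := fun z => z ∈ (idChart EG G).source) hopen] with t ht1 ht2
      have e1 : e + κ t = idChart EG G (k (-‖ξ t‖)) := by simp only [hκ, add_sub_cancel]
      have e2 : k (-‖ξ t‖) ∈ (chartAt EG (1 : G)).source := by simpa using ht2
      have e3 := actChart_one (EG := EG) (G := G) (I := 𝓘(ℝ, EG)) (mem_chart_source EG (1 : G))
      simp only [Function.comp_apply, Prod.mk_add_mk, ← he, e1]
      rw [actChart_apply (I := 𝓘(ℝ, EG)) _ _ e2, ht1]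
      have e4 : actChart G 𝓘(ℝ, EG) (1 : G) (e, e) = e := e3
      rw [e4]
      simp
    have hm' := isLittleO_iff.1 hm (by norm_num : (0 : ℝ) < 1 / 2)
    have ht2 : ∀ᶠ t in (U : Filter ℝ), ‖t‖ < 1 := by
      have := ht0.norm
      rw [norm_zero] at this
      exact this.eventually (gt_mem_nhds one_pos)
    -- At such a `t` near minimality gives `‖ξ t‖ ≤ ‖ξ t‖ / 2 + t ^ 2`, whereas `t ^ 2 ≤ ‖t‖ < ‖ξ t‖
    -- / 4`. Any factor at least `2` in place of `4` would do.
    obtain ⟨t, h1, h2, h3, h4, h5⟩ :=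
      (hle.and (hm'.and (hpos.and ((hlt 4).and ht2)))).exists
    have h6 : t ^ 2 ≤ ‖t‖ := by
      rw [← sq_abs, ← Real.norm_eq_abs]
      nlinarith [norm_nonneg t]
    linarith

end OrbitDirections

end GaugedCotangent

end

noncomputable section

namespace GaugedCotangent

/-! ### Local sections of submersions and curves in their fibres -/

section Submersions

variable {E M : Type*} [NormedAddCommGroup E] [NormedSpace ℝ E]
  [TopologicalSpace M] [ChartedSpace E M] [IsManifold 𝓘(ℝ, E) ∞ M]
  {E' M' : Type*} [NormedAddCommGroup E'] [NormedSpace ℝ E']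
  [TopologicalSpace M'] [ChartedSpace E' M'] [IsManifold 𝓘(ℝ, E') ∞ M']
  {F : Type*} [NormedAddCommGroup F] [NormedSpace ℝ F] {f : M → M'} {x : M}

open Manifold

lemma submersion_writtenInCharts (h : IsSubmersionAtOfComplement F 𝓘(ℝ, E) 𝓘(ℝ, E') ∞ f x)
    {y : M} (hy : y ∈ h.domChart.source) :
    h.codChart (f y) = (h.equiv (h.domChart y)).1 := by
  have hy' : h.domChart y ∈ (h.domChart.extend 𝓘(ℝ, E)).target := by
    simpa using h.domChart.map_source hy
  have h1 := h.writtenInCharts hy'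
  simpa [h.domChart.left_inv hy] using h1

/-- The differential of a submersion is surjective. -/
lemma submersion_mfderiv_surjective (h : IsSubmersionAtOfComplement F 𝓘(ℝ, E) 𝓘(ℝ, E') ∞ f x) :
    Function.Surjective (mfderiv 𝓘(ℝ, E) 𝓘(ℝ, E') f x) := by
  -- A local section through `x`, with the complementary coordinate frozen at its value at `x`. Its
  -- differential is a right inverse of that of `f`.
  set s : M' → M := fun b =>
    h.domChart.symm (h.equiv.symm (h.codChart b, (h.equiv (h.domChart x)).2)) with hs
  have hx := h.mem_domChart_source
  have e1 : h.equiv.symm (h.codChart (f x), (h.equiv (h.domChart x)).2) = h.domChart x := by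
    rw [submersion_writtenInCharts h hx, Prod.mk.eta, h.equiv.symm_apply_apply]
  have e2 : s (f x) = x := by simp only [hs, e1, h.domChart.left_inv hx]
  have h1 : ContMDiffAt 𝓘(ℝ, E') 𝓘(ℝ, E) ∞
      (fun b => h.equiv.symm (h.codChart b, (h.equiv (h.domChart x)).2)) (f x) := by
    have h2 : ContMDiffAt 𝓘(ℝ, E') 𝓘(ℝ, E') ∞ h.codChart (f x) :=
      contMDiffAt_of_mem_maximalAtlas h.codChart_mem_maximalAtlas h.mem_codChart_source
    have h3 : ContDiff ℝ ∞ fun b : E' => h.equiv.symm (b, (h.equiv (h.domChart x)).2) := by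
      fun_prop
    exact h3.contMDiff.contMDiffAt.comp (f x) h2
  have h4 : ContMDiffAt 𝓘(ℝ, E') 𝓘(ℝ, E) ∞ s (f x) := by
    refine ContMDiffAt.comp (f x) ?_ h1
    rw [e1]
    exact contMDiffAt_symm_of_mem_maximalAtlas h.domChart_mem_maximalAtlas
      (h.domChart.map_source hx)
  have h5 : f ∘ s =ᶠ[𝓝 (f x)] id := by
    have c1 : ∀ᶠ b in 𝓝 (f x), b ∈ h.codChart.source :=
      h.codChart.open_source.mem_nhds h.mem_codChart_source
    have c2 : ∀ᶠ b in 𝓝 (f x),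
        h.equiv.symm (h.codChart b, (h.equiv (h.domChart x)).2) ∈ h.domChart.target := by
      refine h1.continuousAt.eventually (p := fun z => z ∈ h.domChart.target) ?_
      simp only [e1]
      exact h.domChart.open_target.mem_nhds (h.domChart.map_source hx)
    filter_upwards [c1, c2] with b hb1 hb2
    have hsb := h.domChart.map_target hb2
    refine h.codChart.injOn (h.mapsto_domChart_source_codChart_source hsb) hb1 ?_
    refine (submersion_writtenInCharts h hsb).trans ?_
    simp only [h.domChart.right_inv hb2, h.equiv.apply_symm_apply, id]
  have hf : MDifferentiableAt 𝓘(ℝ, E) 𝓘(ℝ, E') f (s (f x)) := by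
    rw [e2]; exact h.contMDiffAt.mdifferentiableAt (by simp)
  have h6 := mfderiv_comp (f x) hf (h4.mdifferentiableAt (by simp))
  rw [h5.mfderiv_eq, mfderiv_id] at h6
  intro u
  have h7 := congrArg (fun L : E' →L[ℝ] E' => L u) h6
  rw [e2] at h7
  exact ⟨_, h7.symm⟩

/-- A vector in the kernel of the differential of a submersion is tangent to a curve in the
fibre. -/
lemma submersion_exists_curve (h : IsSubmersionAtOfComplement F 𝓘(ℝ, E) 𝓘(ℝ, E') ∞ f x)
    {v : TangentSpace 𝓘(ℝ, E) x} (hv : mfderiv 𝓘(ℝ, E) 𝓘(ℝ, E') f x v = 0) :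
    ∃ c : ℝ → M, c 0 = x ∧ ContinuousAt c 0 ∧ (∀ᶠ t in 𝓝 (0 : ℝ), f (c t) = f x) ∧
      HasDerivAt (fun t => extChartAt 𝓘(ℝ, E) x (c t)) (coframe 𝓘(ℝ, E) x x v) 0 := by
  have hx := h.mem_domChart_source
  have hφ : ContMDiffAt 𝓘(ℝ, E) 𝓘(ℝ, E) ∞ h.domChart x :=
    contMDiffAt_of_mem_maximalAtlas h.domChart_mem_maximalAtlas hx
  have hφm := (hφ.mdifferentiableAt (by simp)).hasMFDerivAt
  have hψ : ContMDiffAt 𝓘(ℝ, E) 𝓘(ℝ, E) ∞ h.domChart.symm (h.domChart x) :=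
    contMDiffAt_symm_of_mem_maximalAtlas h.domChart_mem_maximalAtlas (h.domChart.map_source hx)
  set w : E := mfderiv 𝓘(ℝ, E) 𝓘(ℝ, E) h.domChart x v with hw
  -- In the adapted charts `f` is a linear projection, and `w` lies in its kernel. The straight line
  -- in the direction `w` therefore stays in the fibre.
  have hw1 : (h.equiv w).1 = 0 := by
    have h1 : h.codChart ∘ f =ᶠ[𝓝 x]
        ((ContinuousLinearMap.fst ℝ E' F).comp (h.equiv : E →L[ℝ] E' × F)) ∘ h.domChart := by
      filter_upwards [h.domChart.open_source.mem_nhds hx] with y hy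
      exact submersion_writtenInCharts h hy
    have hc : ContMDiffAt 𝓘(ℝ, E') 𝓘(ℝ, E') ∞ h.codChart (f x) :=
      contMDiffAt_of_mem_maximalAtlas h.codChart_mem_maximalAtlas h.mem_codChart_source
    have h2 := mfderiv_comp x (hc.mdifferentiableAt (by simp))
      (h.contMDiffAt.mdifferentiableAt (by simp))
    have h3 : HasMFDerivAt 𝓘(ℝ, E) 𝓘(ℝ, E') _ x _ := HasMFDerivAt.comp x
      (((ContinuousLinearMap.fst ℝ E' F).comp
        (h.equiv : E →L[ℝ] E' × F)).hasMFDerivAt (x := h.domChart x)) hφm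
    rw [h1.mfderiv_eq, h3.mfderiv] at h2
    have h4 := congrArg (fun L : E →L[ℝ] E' => L v) h2
    refine h4.trans ?_
    exact (congrArg (mfderiv 𝓘(ℝ, E') 𝓘(ℝ, E') h.codChart (f x) : E' →L[ℝ] E') hv).trans
      (ContinuousLinearMap.map_zero _)
  set c : ℝ → M := fun t => h.domChart.symm (h.domChart x + t • w) with hc
  have hline : Continuous fun t : ℝ => h.domChart x + t • w := by fun_prop
  have hc0 : c 0 = x := by simp only [hc, zero_smul, add_zero, h.domChart.left_inv hx]
  have ht : ∀ᶠ t in 𝓝 (0 : ℝ), h.domChart x + t • w ∈ h.domChart.target := by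
    apply hline.continuousAt.eventually
    simpa using h.domChart.open_target.mem_nhds (h.domChart.map_source hx)
  have hcc : ContinuousAt c 0 := by
    refine ContinuousAt.comp ?_ hline.continuousAt
    simpa using hψ.continuousAt
  refine ⟨c, hc0, hcc, ?_, ?_⟩
  · filter_upwards [ht] with t ht
    have hs := h.domChart.map_target ht
    refine h.codChart.injOn (h.mapsto_domChart_source_codChart_source hs) h.mem_codChart_source ?_
    rw [submersion_writtenInCharts h hs, submersion_writtenInCharts h hx,
      h.domChart.right_inv ht]
    simp [hw1]
  · have hline' : HasDerivAt (fun t : ℝ => h.domChart x + t • w) w 0 := by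
      simpa using ((hasDerivAt_id (0 : ℝ)).smul_const w).const_add (h.domChart x)
    have e0 : h.domChart x + (0 : ℝ) • w = h.domChart x := by simp
    have hχ : ContMDiffAt 𝓘(ℝ, E) 𝓘(ℝ, E) ∞ (extChartAt 𝓘(ℝ, E) x)
        (h.domChart.symm (h.domChart x)) := by
      rw [h.domChart.left_inv hx]
      exact contMDiffAt_extChartAt
    have hτ : ContMDiffAt 𝓘(ℝ, E) 𝓘(ℝ, E) ∞
        (fun y => extChartAt 𝓘(ℝ, E) x (h.domChart.symm y)) (h.domChart x) := hχ.comp _ hψ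
    have hτd : DifferentiableAt ℝ (fun y => extChartAt 𝓘(ℝ, E) x (h.domChart.symm y))
        (h.domChart x) := (contMDiffAt_iff_contDiffAt.1 hτ).differentiableAt (by simp)
    have hτ0 : HasFDerivAt (fun y => extChartAt 𝓘(ℝ, E) x (h.domChart.symm y))
        (fderiv ℝ (fun y => extChartAt 𝓘(ℝ, E) x (h.domChart.symm y)) (h.domChart x))
        (h.domChart x + (0 : ℝ) • w) := by rw [e0]; exact hτd.hasFDerivAt
    have h8 := hτ0.comp_hasDerivAt (0 : ℝ) hline'
    -- The line is straight in the adapted chart; the chain rule converts its velocity to the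
    -- preferred chart at `x`.
    have h9 : (fderiv ℝ (fun y => extChartAt 𝓘(ℝ, E) x (h.domChart.symm y)) (h.domChart x)) w =
        coframe 𝓘(ℝ, E) x x v := by
      rw [← mfderiv_chart_eq_coframe (mem_chart_source E x), hw]
      have h10 : (fun y => extChartAt 𝓘(ℝ, E) x (h.domChart.symm y)) ∘ h.domChart =ᶠ[𝓝 x]
          extChartAt 𝓘(ℝ, E) x := by
        filter_upwards [h.domChart.open_source.mem_nhds hx] with y hy
        simp only [Function.comp_apply, h.domChart.left_inv hy]
      have h11 : HasMFDerivAt 𝓘(ℝ, E) 𝓘(ℝ, E) _ x _ :=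
        HasMFDerivAt.comp x hτd.hasFDerivAt.hasMFDerivAt hφm
      rw [← h10.mfderiv_eq, h11.mfderiv]
      rfl
    exact h8.congr_deriv h9

end Submersions

/-! ### The kernel of the differential of the orbit projection -/

section Orbits

open Filter

variable {EG : Type*} [NormedAddCommGroup EG] [NormedSpace ℝ EG]
  {G : Type*} [TopologicalSpace G] [ChartedSpace EG G] [Group G] [LieGroup 𝓘(ℝ, EG) ∞ G]
  {E Q : Type*} [NormedAddCommGroup E] [NormedSpace ℝ E]
  [TopologicalSpace Q] [ChartedSpace E Q] [IsManifold 𝓘(ℝ, E) ∞ Q]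
  [MulAction G Q] [ContMDiffSMul 𝓘(ℝ, EG) 𝓘(ℝ, E) ∞ G Q]
  {EB : Type*} [NormedAddCommGroup EB] [NormedSpace ℝ EB]
  [ChartedSpace EB (MulAction.orbitRel.Quotient G Q)]
  [IsManifold 𝓘(ℝ, EB) ∞ (MulAction.orbitRel.Quotient G Q)]

lemma orbitProj_smul (g : G) (q : Q) :
    orbitProj G (g • q) = (orbitProj G q : MulAction.orbitRel.Quotient G Q) :=
  Quotient.sound ⟨g, rfl⟩

/-- The kernel of the differential of the orbit projection consists of the values of fundamental
vector fields. -/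
lemma exists_zeta_eq_of_mfderiv_orbitProj_eq_zero
    [FiniteDimensional ℝ EG] [T2Space G] [ProperSMul G Q]
    (hπ : Manifold.IsSubmersion 𝓘(ℝ, E) 𝓘(ℝ, EB) ∞
      (orbitProj G : Q → MulAction.orbitRel.Quotient G Q)) {q : Q} {v : TangentSpace 𝓘(ℝ, E) q}
    (hv : mfderiv 𝓘(ℝ, E) 𝓘(ℝ, EB) (orbitProj G : Q → MulAction.orbitRel.Quotient G Q) q v = 0) :
    ∃ X : EG, zeta G 𝓘(ℝ, E) q X = v := by
  obtain ⟨F, _, _, hF⟩ := hπ.isSubmersionAt q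
  obtain ⟨c, hc0, hcc, hcf, hcd⟩ := submersion_exists_curve hF hv
  have h1 : ∀ t, ∃ g : G, orbitProj G (c t) = (orbitProj G q : MulAction.orbitRel.Quotient G Q) →
      g • q = c t := by
    intro t
    by_cases h : orbitProj G (c t) = (orbitProj G q : MulAction.orbitRel.Quotient G Q)
    · obtain ⟨g, hg⟩ := MulAction.orbitRel_apply.1 (Quotient.exact h)
      exact ⟨g, fun _ => hg⟩
    · exact ⟨1, fun h' => (h h').elim⟩
  choose g hg using h1
  -- The elements `g t` are merely chosen, with no continuity in `t`. An ultrafilter finer than the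
  -- punctured neighbourhoods of `0` supplies the limits.
  let U : Ultrafilter ℝ := Ultrafilter.of (𝓝[≠] (0 : ℝ))
  have hU : (U : Filter ℝ) ≤ 𝓝[≠] (0 : ℝ) := Ultrafilter.of_le _
  have hU0 : (U : Filter ℝ) ≤ 𝓝 (0 : ℝ) := hU.trans nhdsWithin_le_nhds
  have hgc : ∀ᶠ t in (U : Filter ℝ), g t • q = c t := by
    filter_upwards [hU0 hcf] with t ht using hg t ht
  have hct : Tendsto c U (𝓝 q) := by
    have := hcc.tendsto
    rw [hc0] at this
    exact this.mono_left hU0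
  have h2 : Tendsto (fun p : G × Q => (p.1 • p.2, p.2)) (U.map fun t => (g t, q)) (𝓝 (q, q)) := by
    have h3 : Tendsto (fun t => (c t, q)) U (𝓝 (q, q)) := hct.prodMk_nhds tendsto_const_nhds
    have h4 : Tendsto (fun t => (g t • q, q)) U (𝓝 (q, q)) := by
      refine h3.congr' ?_
      filter_upwards [hgc] with t ht
      rw [ht]
    rw [Ultrafilter.coe_map, tendsto_map'_iff]
    exact h4
  -- Properness: since `(g t • q, q)` converges to `(q, q)`, the pairs `(g t, q)` have a limit over
  -- it, so `g₀` lies in the isotropy group.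
  obtain ⟨⟨g₀, q'⟩, hq, hlim⟩ :=
    (ProperSMul.isProperMap_smul_pair (G := G) (X := Q)).ultrafilter_le_nhds_of_tendsto h2
  obtain ⟨hq1, rfl⟩ := Prod.mk.inj hq
  have hgl : Tendsto g U (𝓝 g₀) := (continuous_fst.tendsto (g₀, q')).comp hlim
  have : IsTopologicalGroup G := topologicalGroup_of_lieGroup 𝓘(ℝ, EG) ∞
  -- Since `g₀` fixes the point, dividing by it on the right leaves the orbit curve unchanged and
  -- makes the elements tend to `1`.
  have hh : Tendsto (fun t => g t * g₀⁻¹) U (𝓝 1) := by simpa using hgl.mul_const g₀⁻¹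
  have hsm : ∀ t, (g t * g₀⁻¹) • q' = g t • q' := fun t => by
    rw [mul_smul, inv_smul_eq_iff.2 hq1.symm]
  obtain ⟨X, hX⟩ := exists_zeta_eq_of_isLittleO (EG := EG) (I := 𝓘(ℝ, E)) hU hh
    (v := coframe 𝓘(ℝ, E) q' q' v) (by
      have h5 := hcd.isLittleO.mono hU0
      refine h5.congr' ?_ ?_
      · filter_upwards [hgc] with t ht
        rw [hsm, ht, hc0, sub_zero]
      · exact Eventually.of_forall fun t => sub_zero t)
  refine ⟨X, ?_⟩
  rw [← frame_coframe (mem_chart_source E q') (zeta G 𝓘(ℝ, E) q' X), hX,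
    frame_coframe (mem_chart_source E q')]

/-- Fundamental vector fields are tangent to the fibres of the orbit projection. -/
lemma mfderiv_orbitProj_zeta
    (hπ : ContMDiff 𝓘(ℝ, E) 𝓘(ℝ, EB) ∞
      (orbitProj G : Q → MulAction.orbitRel.Quotient G Q)) (q : Q) (X : EG) :
    mfderiv 𝓘(ℝ, E) 𝓘(ℝ, EB) (orbitProj G : Q → MulAction.orbitRel.Quotient G Q) q
      (zeta G 𝓘(ℝ, E) q X) = 0 := by
  have h1 : MDifferentiableAt 𝓘(ℝ, EG) 𝓘(ℝ, E) (fun g : G => g • q) 1 :=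
    (contMDiff_smul_right q).contMDiffAt.mdifferentiableAt (by simp)
  have h2 : MDifferentiableAt 𝓘(ℝ, E) 𝓘(ℝ, EB)
      (orbitProj G : Q → MulAction.orbitRel.Quotient G Q) ((1 : G) • q) :=
    hπ.contMDiffAt.mdifferentiableAt (by simp)
  have h3 := mfderiv_comp (1 : G) h2 h1
  have h4 : (orbitProj G : Q → MulAction.orbitRel.Quotient G Q) ∘ (fun g : G => g • q) =
      fun _ => orbitProj G q := funext fun g => orbitProj_smul g q
  rw [h4, mfderiv_const] at h3
  have h5 := congrArg (fun L : EG →L[ℝ] EB => L X) h3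
  have h6 : (mfderiv 𝓘(ℝ, E) 𝓘(ℝ, EB) (orbitProj G : Q → MulAction.orbitRel.Quotient G Q)
      ((1 : G) • q) : E →L[ℝ] EB) (zeta G 𝓘(ℝ, E) q X) = 0 := h5.symm
  exact (congrArg (fun p : Q => (mfderiv 𝓘(ℝ, E) 𝓘(ℝ, EB)
    (orbitProj G : Q → MulAction.orbitRel.Quotient G Q) p : E →L[ℝ] EB)
    (zeta G 𝓘(ℝ, E) q X)) (one_smul G q)).symm.trans h6

end Orbits

end GaugedCotangent

end

noncomputable section

namespace GaugedCotangent

/-! ### Transport of a manifold structure along a homeomorphism -/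

section Transport

variable {E H : Type*} [NormedAddCommGroup E] [NormedSpace ℝ E] [TopologicalSpace H]
  {I : ModelWithCorners ℝ E H} {M N : Type*} [TopologicalSpace M] [TopologicalSpace N]
  [ChartedSpace H N]

variable (H) in
/-- The charted space structure transported along a homeomorphism. -/
@[reducible]
def pullChartedSpace (e : M ≃ₜ N) : ChartedSpace H M where
  atlas := {c' | ∃ c ∈ atlas H N, e.transOpenPartialHomeomorph c = c'}
  chartAt x := e.transOpenPartialHomeomorph (chartAt H (e x))
  mem_chart_source x := mem_chart_source H (e x)
  chart_mem_atlas x := ⟨_, chart_mem_atlas H (e x), rfl⟩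

/-- In a transition map between transported charts `e` cancels, so the transition maps are those of
`N`. -/
lemma isManifold_pullChartedSpace [IsManifold I ∞ N] (e : M ≃ₜ N) :
    letI := pullChartedSpace H e
    IsManifold I ∞ M := by
  let := pullChartedSpace H e
  have : HasGroupoid M (contDiffGroupoid ∞ I) := by
    refine ⟨?_⟩
    rintro _ _ ⟨c, hc, rfl⟩ ⟨c', hc', rfl⟩
    refine (contDiffGroupoid ∞ I).mem_of_eqOnSource
      ((contDiffGroupoid ∞ I).compatible hc hc') ⟨?_, fun y hy => ?_⟩
    · ext y
      simp
    · simp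
  exact IsManifold.mk' I ∞ M

/-- Between a transported chart and the original one, `e` reads as the identity. -/
lemma contMDiff_pullChartedSpace (e : M ≃ₜ N) :
    letI := pullChartedSpace H e
    ContMDiff I I ∞ e := by
  let := pullChartedSpace H e
  intro x
  refine contMDiffAt_iff.2 ⟨e.continuous.continuousAt, ?_⟩
  refine contDiffWithinAt_id.congr_of_eventuallyEq_of_mem ?_ ⟨_, rfl⟩
  have h := extChartAt_target_mem_nhdsWithin (I := I) (e x)
  filter_upwards [h] with y hy
  exact (congrArg (extChartAt I (e x)) (e.apply_symm_apply _)).trans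
    ((extChartAt I (e x)).right_inv hy)

lemma contMDiff_symm_pullChartedSpace (e : M ≃ₜ N) :
    letI := pullChartedSpace H e
    ContMDiff I I ∞ e.symm := by
  let := pullChartedSpace H e
  intro x
  refine contMDiffAt_iff.2 ⟨e.symm.continuous.continuousAt, ?_⟩
  refine contDiffWithinAt_id.congr_of_eventuallyEq_of_mem ?_ ⟨_, rfl⟩
  have h := extChartAt_target_mem_nhdsWithin (I := I) x
  filter_upwards [h] with y hy
  change extChartAt I (e (e.symm x)) (e (e.symm ((extChartAt I x).symm y))) = y
  rw [e.apply_symm_apply, e.apply_symm_apply]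
  exact (extChartAt I x).right_inv hy

/-- The diffeomorphism onto `N` for the transported structure. -/
def pullDiffeomorph (e : M ≃ₜ N) :
    letI := pullChartedSpace H e
    Diffeomorph I I M N ∞ :=
  letI := pullChartedSpace H e
  { toEquiv := e.toEquiv
    contMDiff_toFun := contMDiff_pullChartedSpace e
    contMDiff_invFun := contMDiff_symm_pullChartedSpace e }

end Transport

end GaugedCotangent

end

noncomputable section

namespace GaugedCotangent

/-! ### `ψ` is bijective on fibres -/

section FibreMap

variable {EG : Type*} [NormedAddCommGroup EG] [NormedSpace ℝ EG]
  {G : Type*} [TopologicalSpace G] [ChartedSpace EG G] [Group G] [LieGroup 𝓘(ℝ, EG) ∞ G]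
  {E Q : Type*} [NormedAddCommGroup E] [NormedSpace ℝ E]
  [TopologicalSpace Q] [ChartedSpace E Q] [IsManifold 𝓘(ℝ, E) ∞ Q]
  [MulAction G Q] [ContMDiffSMul 𝓘(ℝ, EG) 𝓘(ℝ, E) ∞ G Q]
  {EB : Type*} [NormedAddCommGroup EB] [NormedSpace ℝ EB]
  [ChartedSpace EB (MulAction.orbitRel.Quotient G Q)]
  [IsManifold 𝓘(ℝ, EB) ∞ (MulAction.orbitRel.Quotient G Q)]
  (A : GenConnection EG G E Q)

local notation "dproj" => mfderiv 𝓘(ℝ, E) 𝓘(ℝ, EB) (orbitProj G : Q → MulAction.orbitRel.Quotient G Q)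

/-- `ζ ∘ A ∘ ζ = ζ` says exactly that `A(ζ_X) - X` lies in `𝔤_q`, which `λ` annihilates. -/
lemma annIsotropy_apply_conn {q : Q} (lam : annIsotropy EG G E q) (X : EG) :
    (lam : EG →L[ℝ] ℝ) (A.toFun q (zeta G 𝓘(ℝ, E) q X)) = (lam : EG →L[ℝ] ℝ) X := by
  have h : A.toFun q (zeta G 𝓘(ℝ, E) q X) - X ∈ isotropyAlg EG G E q := by
    change zeta G 𝓘(ℝ, E) q (A.toFun q (zeta G 𝓘(ℝ, E) q X) - X) = 0
    rw [ContinuousLinearMap.map_sub, A.reproduces]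
    exact sub_self _
  have h2 := lam.2 _ h
  rw [ContinuousLinearMap.map_sub] at h2
  exact sub_eq_zero.1 h2

lemma psiFib_apply (q : Q)
    (p : CotangentSpace EB (MulAction.orbitRel.Quotient G Q) (orbitProj G q) ×
      annIsotropy EG G E q) (v : TangentSpace 𝓘(ℝ, E) q) :
    psiFib A EB q p v = (p.1 : EB →L[ℝ] ℝ) (dproj q v) + (p.2 : EG →L[ℝ] ℝ) (A.toFun q v) := rfl

/-- `Tπ` kills fundamental vectors, so only the `λ` term survives. Both injectivity of `ψ` and the
identity `μ_A = λ` follow from this. -/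
lemma psiFib_zeta (hπ : ContMDiff 𝓘(ℝ, E) 𝓘(ℝ, EB) ∞
      (orbitProj G : Q → MulAction.orbitRel.Quotient G Q)) (q : Q)
    (p : CotangentSpace EB (MulAction.orbitRel.Quotient G Q) (orbitProj G q) ×
      annIsotropy EG G E q) (X : EG) :
    psiFib A EB q p (zeta G 𝓘(ℝ, E) q X) = (p.2 : EG →L[ℝ] ℝ) X := by
  rw [psiFib_apply, annIsotropy_apply_conn]
  have h : (p.1 : EB →L[ℝ] ℝ) (dproj q (zeta G 𝓘(ℝ, E) q X)) = 0 :=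
    (congrArg (p.1 : EB →L[ℝ] ℝ) (mfderiv_orbitProj_zeta hπ q X)).trans
      (ContinuousLinearMap.map_zero _)
  rw [h, zero_add]

/-- The momentum map on `W` is the projection to `𝔤^*`. -/
lemma muA_eq_lam (hπ : ContMDiff 𝓘(ℝ, E) 𝓘(ℝ, EB) ∞
      (orbitProj G : Q → MulAction.orbitRel.Quotient G Q)) (w : WSpace EG G E Q EB) :
    muA A w = w.lam :=
  ContinuousLinearMap.ext fun X => psiFib_zeta A hπ w.base (w.eta, w.lam) X

/-- Fundamental vectors detect `λ`. When `λ = 0`, the remaining covector `η ∘ Tπ` detects `η`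
because `Tπ` is onto. -/
lemma psiFib_injective (hπ : Manifold.IsSubmersion 𝓘(ℝ, E) 𝓘(ℝ, EB) ∞
      (orbitProj G : Q → MulAction.orbitRel.Quotient G Q)) (q : Q) :
    Function.Injective (psiFib A EB q) := by
  rw [injective_iff_map_eq_zero]
  rintro ⟨η, lam⟩ h
  have h1 : (lam : EG →L[ℝ] ℝ) = 0 := ContinuousLinearMap.ext fun X => by
    rw [← psiFib_zeta A hπ.contMDiff q (η, lam) X, h]
    rfl
  have h2 : lam = 0 := Subtype.ext h1
  subst h2
  have h3 : η = 0 := ContinuousLinearMap.ext fun u => by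
    obtain ⟨F, _, _, hF⟩ := hπ.isSubmersionAt q
    obtain ⟨v, rfl⟩ := submersion_mfderiv_surjective hF u
    have h4 := psiFib_apply A q (η, 0) v
    rw [h] at h4
    exact (h4.trans (add_zero _)).symm
  rw [h3]
  rfl

/-- By `psiFib_zeta` the only candidate is `λ = p ∘ ζ`. The remainder `p - λ ∘ A` must then factor
through `Tπ`. -/
lemma psiFib_surjective [FiniteDimensional ℝ EG] [T2Space G] [ProperSMul G Q]
    [FiniteDimensional ℝ EB]
    (hπ : Manifold.IsSubmersion 𝓘(ℝ, E) 𝓘(ℝ, EB) ∞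
      (orbitProj G : Q → MulAction.orbitRel.Quotient G Q)) (q : Q) :
    Function.Surjective (psiFib A EB q) := by
  intro p
  let lam : annIsotropy EG G E q := ⟨ContinuousLinearMap.comp
    (p : TangentSpace 𝓘(ℝ, E) q →L[ℝ] ℝ) (zeta G 𝓘(ℝ, E) q), fun X hX => by
      have hX' : zeta G 𝓘(ℝ, E) q X = 0 := hX
      change p (zeta G 𝓘(ℝ, E) q X) = 0
      rw [hX']
      exact ContinuousLinearMap.map_zero _⟩
  let r : E →L[ℝ] ℝ := p - (lam : EG →L[ℝ] ℝ).comp (A.toFun q)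
  let D : E →L[ℝ] EB := dproj q
  obtain ⟨F, _, _, hF⟩ := hπ.isSubmersionAt q
  have hsurj : Function.Surjective D := submersion_mfderiv_surjective hF
  -- This is where the inclusion of `ker Tπ` in the image of `ζ` is needed; on fundamental vectors
  -- the remainder vanishes because `A` reproduces them.
  have hr : ∀ v, D v = 0 → r v = 0 := by
    intro v hv
    obtain ⟨X, rfl⟩ := exists_zeta_eq_of_mfderiv_orbitProj_eq_zero (EG := EG) hπ hv
    change p (zeta G 𝓘(ℝ, E) q X) - p (zeta G 𝓘(ℝ, E) q (A.toFun q (zeta G 𝓘(ℝ, E) q X))) = 0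
    rw [A.reproduces, sub_self]
  obtain ⟨R, hR⟩ := D.toLinearMap.exists_rightInverse_of_surjective (LinearMap.range_eq_top.2 hsurj)
  have hR' : ∀ u, D (R u) = u := fun u => LinearMap.congr_fun hR u
  let η : EB →L[ℝ] ℝ := (r.toLinearMap ∘ₗ R).toContinuousLinearMap
  refine ⟨(η, lam), ContinuousLinearMap.ext fun v => ?_⟩
  rw [psiFib_apply]
  change r (R (D v)) + (lam : EG →L[ℝ] ℝ) (A.toFun q v) = p v
  have h1 : r ((R (D v) : E) - (show E from v)) = 0 := hr ((R (D v) : E) - (show E from v)) (by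
    rw [map_sub, hR']; exact sub_self _)
  rw [map_sub, sub_eq_zero] at h1
  rw [h1]
  exact sub_add_cancel _ _

lemma psi_bijective [FiniteDimensional ℝ EG] [T2Space G] [ProperSMul G Q]
    [FiniteDimensional ℝ EB]
    (hπ : Manifold.IsSubmersion 𝓘(ℝ, E) 𝓘(ℝ, EB) ∞
      (orbitProj G : Q → MulAction.orbitRel.Quotient G Q)) :
    Function.Bijective (psi A : WSpace EG G E Q EB → CotangentBundle E Q) := by
  constructor
  · rintro ⟨q, η, lam⟩ ⟨q', η', lam'⟩ h
    obtain rfl : q = q' := congrArg TotalSpace.proj h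
    have h1 : psiFib A EB q (η, lam) = psiFib A EB q (η', lam') :=
      (TotalSpace.mk_inj (F := E →L[ℝ] ℝ) (E := CotangentSpace E Q)).1 h
    obtain ⟨rfl, rfl⟩ := Prod.mk.inj (psiFib_injective A hπ q h1)
    rfl
  · rintro ⟨q, p⟩
    obtain ⟨⟨η, lam⟩, h⟩ := psiFib_surjective A hπ q p
    exact ⟨⟨q, η, lam⟩, congrArg (TotalSpace.mk' _ q) h⟩

lemma incl_injective :
    Function.Injective (WSpace.incl : WSpace EG G E Q EB → _) := by
  rintro ⟨q, η, lam⟩ ⟨q', η', lam'⟩ h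
  obtain rfl : q = q' := congrArg Prod.fst h
  have h1 : (⟨orbitProj G q, η⟩ : CotangentBundle EB (MulAction.orbitRel.Quotient G Q)) =
    ⟨orbitProj G q, η'⟩ := congrArg (fun n => n.2.1) h
  obtain rfl : η = η' := TotalSpace.mk_inj.1 h1
  obtain rfl : lam = lam' := Subtype.ext (congrArg (fun n => n.2.2) h)
  rfl

end FibreMap

/-! ### Smoothness of `ψ` and of its inverse, in frames -/

section LocalFrames

variable {EG : Type*} [NormedAddCommGroup EG] [NormedSpace ℝ EG]
  {G : Type*} [TopologicalSpace G] [ChartedSpace EG G] [Group G] [LieGroup 𝓘(ℝ, EG) ∞ G]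
  {E Q : Type*} [NormedAddCommGroup E] [NormedSpace ℝ E]
  [TopologicalSpace Q] [ChartedSpace E Q] [IsManifold 𝓘(ℝ, E) ∞ Q]
  [MulAction G Q] [ContMDiffSMul 𝓘(ℝ, EG) 𝓘(ℝ, E) ∞ G Q]
  {EB : Type*} [NormedAddCommGroup EB] [NormedSpace ℝ EB]
  [ChartedSpace EB (MulAction.orbitRel.Quotient G Q)]
  [IsManifold 𝓘(ℝ, EB) ∞ (MulAction.orbitRel.Quotient G Q)]
  (A : GenConnection EG G E Q)

local notation "dproj" => mfderiv 𝓘(ℝ, E) 𝓘(ℝ, EB) (orbitProj G : Q → MulAction.orbitRel.Quotient G Q)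

/-- The differential of a map in the frames of preferred charts. -/
def derivRep {E' M' : Type*} [NormedAddCommGroup E'] [NormedSpace ℝ E']
    [TopologicalSpace M'] [ChartedSpace E' M'] [IsManifold 𝓘(ℝ, E') ∞ M'] (f : Q → M')
    (q₀ : Q) (b₀ : M') (q : Q) : E →L[ℝ] E' :=
  (coframe 𝓘(ℝ, E') b₀ (f q)).comp
    ((mfderiv 𝓘(ℝ, E) 𝓘(ℝ, E') f q).comp (frame 𝓘(ℝ, E) q₀ q))

/-- In frames of preferred charts the differential is the Fréchet derivative of the map read in
charts. -/
lemma contMDiffAt_derivRep {E' M' : Type*} [NormedAddCommGroup E'] [NormedSpace ℝ E']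
    [TopologicalSpace M'] [ChartedSpace E' M'] [IsManifold 𝓘(ℝ, E') ∞ M'] {f : Q → M'}
    (hf : ContMDiff 𝓘(ℝ, E) 𝓘(ℝ, E') ∞ f) {q₀ q : Q} {b₀ : M'}
    (hq : q ∈ (chartAt E q₀).source) (hb : f q ∈ (chartAt E' b₀).source) :
    ContMDiffAt 𝓘(ℝ, E) 𝓘(ℝ, E →L[ℝ] E') ∞ (derivRep f q₀ b₀ : Q → E →L[ℝ] E') q := by
  have h1 := (contDiffAt_readInCharts hq hb (hf q)).fderiv_right (m := ∞) (by norm_cast)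
  have h2 : ContMDiffAt 𝓘(ℝ, E) 𝓘(ℝ, E) ∞ (extChartAt 𝓘(ℝ, E) q₀) q := contMDiffAt_extChartAt' (I := 𝓘(ℝ, E)) hq
  refine (h1.contMDiffAt.comp q h2).congr_of_eventuallyEq ?_
  filter_upwards [(chartAt E q₀).open_source.mem_nhds hq,
    (hf q).continuousAt.eventually ((chartAt E' b₀).open_source.mem_nhds hb)] with z hz1 hz2
  have hzs : z ∈ (extChartAt 𝓘(ℝ, E) q₀).source := by rwa [extChartAt_source]
  have e := (extChartAt 𝓘(ℝ, E) q₀).left_inv hzs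
  refine ContinuousLinearMap.ext fun u => ?_
  rw [Function.comp_apply]
  have h3 := fderiv_readInCharts (I' := 𝓘(ℝ, E')) (x₀' := b₀) (f := f)
    ((extChartAt 𝓘(ℝ, E) q₀).map_source hzs)
    ((hf _).mdifferentiableAt (by simp)) (by rw [e]; exact hz2) u
  refine Eq.trans ?_ h3.symm
  exact congrArg (fun p : Q => derivRep f q₀ b₀ p u) e.symm

/-- The connection form in the frame of a preferred chart. -/
def connRep (q₀ q : Q) : E →L[ℝ] EG := (A.toFun q).comp (frame 𝓘(ℝ, E) q₀ q)

lemma GenConnection.smoothOneForm [FiniteDimensional ℝ E] : SmoothOneForm A.toFun :=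
  smoothOneForm_of_contMDiff A.smooth

lemma contMDiffAt_connRep [FiniteDimensional ℝ E] {q₀ q : Q} (hq : q ∈ (chartAt E q₀).source) :
    ContMDiffAt 𝓘(ℝ, E) 𝓘(ℝ, E →L[ℝ] EG) ∞ (connRep A q₀) q := by
  have h2 : ContMDiffAt 𝓘(ℝ, E) 𝓘(ℝ, E) ∞ (extChartAt 𝓘(ℝ, E) q₀) q := contMDiffAt_extChartAt' (I := 𝓘(ℝ, E)) hq
  refine ((A.smoothOneForm q₀ q hq).contMDiffAt.comp q h2).congr_of_eventuallyEq ?_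
  filter_upwards [(chartAt E q₀).open_source.mem_nhds hq] with z hz
  exact ContinuousLinearMap.ext fun u => (rep1_apply A.toFun hz u).symm

variable (EG G) in
/-- The infinitesimal action in the frame of a preferred chart. -/
def zetaRep (q₀ q : Q) : EG →L[ℝ] E :=
  (coframe 𝓘(ℝ, E) q₀ q).comp (zeta G 𝓘(ℝ, E) q)

/-- In frames `ζ` is the partial derivative of `actChart` in the group direction at `1`. -/
lemma contMDiffAt_zetaRep {q₀ q : Q} (hq : q ∈ (chartAt E q₀).source) :
    ContMDiffAt 𝓘(ℝ, E) 𝓘(ℝ, EG →L[ℝ] E) ∞ (zetaRep EG G q₀ : Q → EG →L[ℝ] E) q := by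
  have h2 : ContMDiffAt 𝓘(ℝ, E) 𝓘(ℝ, E) ∞ (extChartAt 𝓘(ℝ, E) q₀) q := contMDiffAt_extChartAt' (I := 𝓘(ℝ, E)) hq
  have h1 : ContDiffAt ℝ ∞ (fun y => (fderiv ℝ (actChart (EG := EG) G 𝓘(ℝ, E) q₀)
      (idChart EG G 1, y)).comp (ContinuousLinearMap.inl ℝ EG E)) (extChartAt 𝓘(ℝ, E) q₀ q) := by
    have h3 := (contDiffAt_actChart (EG := EG) (G := G) (I := 𝓘(ℝ, E)) hq).fderiv_right
      (m := ∞) (by norm_cast)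
    have h4 : ContDiffAt ℝ ∞ (fun y : E => (idChart EG G 1, y)) (extChartAt 𝓘(ℝ, E) q₀ q) := by
      fun_prop
    exact (h3.comp _ h4).clm_comp contDiffAt_const
  refine (h1.contMDiffAt.comp q h2).congr_of_eventuallyEq ?_
  filter_upwards [(chartAt E q₀).open_source.mem_nhds hq] with z hz
  exact ContinuousLinearMap.ext fun X => (fderiv_actChart_one_left hz X).symm

/-- The frames at `b₀` cancel. What remains expresses `ψ` through smooth coefficients, linearly in
the components of `η` and in `λ`; smoothness of `ψ` and of its inverse is read off from it. -/
lemma covec_psi {q₀ : Q} {b₀ : MulAction.orbitRel.Quotient G Q} (w : WSpace EG G E Q EB)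
    (hb : (orbitProj G w.base : MulAction.orbitRel.Quotient G Q) ∈ (chartAt EB b₀).source) :
    covec q₀ (psi A w) = (covec b₀ w.toCot).comp
      (derivRep (orbitProj G : Q → MulAction.orbitRel.Quotient G Q) q₀ b₀ w.base) +
      (w.lam : EG →L[ℝ] ℝ).comp (connRep A q₀ w.base) := by
  refine ContinuousLinearMap.ext fun u => ?_
  change psiFib A EB w.base (w.eta, w.lam) (frame 𝓘(ℝ, E) q₀ w.base u) = _
  rw [psiFib_apply]
  refine congrArg (· + _) ?_
  exact (congrArg (w.eta : EB →L[ℝ] ℝ) (frame_coframe hb _)).symm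

lemma zetaRep_momentum {q₀ : Q} (z : CotangentBundle E Q) (hq : z.1 ∈ (chartAt E q₀).source) :
    (momentum G z : EG →L[ℝ] ℝ) = (covec q₀ z).comp (zetaRep EG G q₀ z.1) := by
  refine ContinuousLinearMap.ext fun X => ?_
  exact (congrArg (z.2 : TangentSpace 𝓘(ℝ, E) z.1 →L[ℝ] ℝ) (frame_coframe hq _)).symm

lemma contMDiffAt_covec {E M : Type*} [NormedAddCommGroup E] [NormedSpace ℝ E]
    [TopologicalSpace M] [ChartedSpace E M] [IsManifold 𝓘(ℝ, E) ∞ M] {x₀ : M}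
    {z : CotangentBundle E M} (hz : z.1 ∈ (chartAt E x₀).source) :
    ContMDiffAt (cotModel E) 𝓘(ℝ, E →L[ℝ] ℝ) ∞ (covec x₀) z :=
  ((contMDiffAt_cotangentBundle_iff (f := id) hz).1 contMDiffAt_id).2

/-- Near any point, `ψ` extends to a smooth map on `Q × T^*(Q/G) × 𝔤^*`. -/
lemma exists_local_extension_psi [FiniteDimensional ℝ E]
    (hπ : ContMDiff 𝓘(ℝ, E) 𝓘(ℝ, EB) ∞ (orbitProj G : Q → MulAction.orbitRel.Quotient G Q))
    (w₀ : WSpace EG G E Q EB) :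
    ∃ Φ : Q × CotangentBundle EB (MulAction.orbitRel.Quotient G Q) × (EG →L[ℝ] ℝ) →
        CotangentBundle E Q,
      ContMDiffAt (𝓘(ℝ, E).prod ((cotModel EB).prod 𝓘(ℝ, EG →L[ℝ] ℝ))) (cotModel E) ∞ Φ
        w₀.incl ∧ ∀ᶠ w in 𝓝 w₀, psi A w = Φ w.incl := by
  set q₀ := w₀.base
  set b₀ : MulAction.orbitRel.Quotient G Q := orbitProj G q₀
  have hq := mem_chart_source E q₀
  -- Off `W` the covector need not sit over `π(q)`, so `η ∘ T_q π` makes no sense there. Its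
  -- coordinate expression in the fixed frames at `q₀` and `b₀` still does.
  let Φ : Q × CotangentBundle EB (MulAction.orbitRel.Quotient G Q) × (EG →L[ℝ] ℝ) →
      CotangentBundle E Q := fun n => ⟨n.1, ((covec b₀ n.2.1).comp
        (derivRep (orbitProj G : Q → MulAction.orbitRel.Quotient G Q) q₀ b₀ n.1) +
        n.2.2.comp (connRep A q₀ n.1)).comp (coframe 𝓘(ℝ, E) q₀ n.1)⟩
  have hev : ∀ {n}, n ∈ (chartAt E q₀).source → ∀ c l, covec q₀ (Φ (n, c, l)) = (covec b₀ c).comp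
        (derivRep (orbitProj G : Q → MulAction.orbitRel.Quotient G Q) q₀ b₀ n) +
        l.comp (connRep A q₀ n) := fun {n} hn c l => ContinuousLinearMap.ext fun u =>
    congrArg ((covec b₀ c).comp
        (derivRep (orbitProj G : Q → MulAction.orbitRel.Quotient G Q) q₀ b₀ n) +
        l.comp (connRep A q₀ n) : E →L[ℝ] ℝ) (coframe_frame (I := 𝓘(ℝ, E)) hn u)
  refine ⟨Φ, ?_, ?_⟩
  · rw [contMDiffAt_cotangentBundle_iff (x₀ := q₀) hq]
    refine ⟨contMDiffAt_fst, ?_⟩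
    have h1 := (contMDiffAt_derivRep hπ hq (mem_chart_source EB b₀)).comp w₀.incl
      (contMDiffAt_fst (I := 𝓘(ℝ, E)) (J := (cotModel EB).prod 𝓘(ℝ, EG →L[ℝ] ℝ)))
    have h2 := (contMDiffAt_connRep A hq).comp w₀.incl
      (contMDiffAt_fst (I := 𝓘(ℝ, E)) (J := (cotModel EB).prod 𝓘(ℝ, EG →L[ℝ] ℝ)))
    have h3 := (contMDiffAt_covec (x₀ := b₀) (z := w₀.toCot) (mem_chart_source EB b₀)).comp w₀.incl
      (f := fun n : Q × CotangentBundle EB (MulAction.orbitRel.Quotient G Q) × (EG →L[ℝ] ℝ) => n.2.1)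
      (contMDiffAt_fst.comp w₀.incl
        (contMDiffAt_snd (I := 𝓘(ℝ, E)) (J := (cotModel EB).prod 𝓘(ℝ, EG →L[ℝ] ℝ))))
    have h4 : ContMDiffAt (𝓘(ℝ, E).prod ((cotModel EB).prod 𝓘(ℝ, EG →L[ℝ] ℝ)))
      𝓘(ℝ, EG →L[ℝ] ℝ) ∞ (fun n : Q × CotangentBundle EB (MulAction.orbitRel.Quotient G Q) ×
        (EG →L[ℝ] ℝ) => n.2.2) w₀.incl := (contMDiffAt_snd.comp w₀.incl
        (contMDiffAt_snd (I := 𝓘(ℝ, E)) (J := (cotModel EB).prod 𝓘(ℝ, EG →L[ℝ] ℝ))))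
    refine ((h3.clm_comp h1).add (h4.clm_comp h2)).congr_of_eventuallyEq ?_
    have hc : Filter.Tendsto (fun n : Q × CotangentBundle EB (MulAction.orbitRel.Quotient G Q) ×
      (EG →L[ℝ] ℝ) => n.1) (𝓝 w₀.incl) (𝓝 q₀) := continuous_fst.tendsto _
    filter_upwards [hc.eventually ((chartAt E q₀).open_source.mem_nhds hq)] with n hn
    exact hev hn n.2.1 n.2.2
  · have hbase : Continuous (WSpace.base : WSpace EG G E Q EB → Q) :=
      continuous_fst.comp (f := (WSpace.incl : WSpace EG G E Q EB → _)) continuous_induced_dom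
    have h1 : ∀ᶠ w in 𝓝 w₀, w.base ∈ (chartAt E q₀).source :=
      hbase.continuousAt.eventually ((chartAt E q₀).open_source.mem_nhds hq)
    have h2 : ∀ᶠ w in 𝓝 w₀, (orbitProj G w.base : MulAction.orbitRel.Quotient G Q) ∈
        (chartAt EB b₀).source :=
      (hπ.continuous.comp hbase).continuousAt.eventually
        ((chartAt EB b₀).open_source.mem_nhds (mem_chart_source EB b₀))
    filter_upwards [h1, h2] with w hw1 hw2
    refine congrArg (TotalSpace.mk' _ w.base) ?_
    refine ContinuousLinearMap.ext fun v => ?_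
    have h3 := congrArg (fun L : E →L[ℝ] ℝ => L (coframe 𝓘(ℝ, E) q₀ w.base v))
      (covec_psi A (q₀ := q₀) w hw2)
    refine Eq.trans ?_ h3
    exact (congrArg (psiFib A EB w.base (w.eta, w.lam)) (frame_coframe hw1 v)).symm

lemma continuous_psi [FiniteDimensional ℝ E]
    (hπ : ContMDiff 𝓘(ℝ, E) 𝓘(ℝ, EB) ∞ (orbitProj G : Q → MulAction.orbitRel.Quotient G Q)) :
    Continuous (psi A : WSpace EG G E Q EB → CotangentBundle E Q) := by
  rw [continuous_iff_continuousAt]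
  intro w₀
  obtain ⟨Φ, hΦ, h⟩ := exists_local_extension_psi A hπ w₀
  refine ContinuousAt.congr (f := fun w => Φ w.incl) ?_ (h.mono fun w hw => hw.symm)
  exact hΦ.continuousAt.comp (f := WSpace.incl) continuous_induced_dom.continuousAt

/-- A right inverse `s` of `ψ` is smooth as a map to `Q × T^*(Q/G) × 𝔤^*`. -/
lemma contMDiff_incl_comp_rightInverse [FiniteDimensional ℝ E] [FiniteDimensional ℝ EB]
    (hπ : Manifold.IsSubmersion 𝓘(ℝ, E) 𝓘(ℝ, EB) ∞
      (orbitProj G : Q → MulAction.orbitRel.Quotient G Q))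
    {s : CotangentBundle E Q → WSpace EG G E Q EB} (hs : ∀ z, psi A (s z) = z) :
    ContMDiff (cotModel E) (𝓘(ℝ, E).prod ((cotModel EB).prod 𝓘(ℝ, EG →L[ℝ] ℝ))) ∞
      fun z => (s z).incl := by
  intro z₀
  set q₀ := z₀.1
  set b₀ : MulAction.orbitRel.Quotient G Q := orbitProj G q₀
  have hq := mem_chart_source E q₀
  have hπs := hπ.contMDiff
  have hsb : ∀ z, (s z).base = z.1 := fun z => congrArg TotalSpace.proj (hs z)
  -- The component `λ` of a preimage is the momentum, hence visibly smooth. Only `η` has to be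
  -- solved for.
  have hsl : ∀ z, ((s z).lam : EG →L[ℝ] ℝ) = momentum G z := fun z => by
    rw [← muA_eq_lam A hπs, muA, hs]
  have hp1 : ContMDiffAt (cotModel E) 𝓘(ℝ, E) ∞ (fun z : CotangentBundle E Q => z.1) z₀ :=
    contMDiff_cotangent_proj.contMDiffAt
  have hsrc : ∀ᶠ z : CotangentBundle E Q in 𝓝 z₀, z.1 ∈ (chartAt E q₀).source :=
    hp1.continuousAt.eventually ((chartAt E q₀).open_source.mem_nhds hq)
  have hsrcb : ∀ᶠ z : CotangentBundle E Q in 𝓝 z₀,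
      (orbitProj G z.1 : MulAction.orbitRel.Quotient G Q) ∈ (chartAt EB b₀).source :=
    (hπs.continuous.continuousAt.comp hp1.continuousAt).eventually
      ((chartAt EB b₀).open_source.mem_nhds (mem_chart_source EB b₀))
  have hlam : ContMDiffAt (cotModel E) 𝓘(ℝ, EG →L[ℝ] ℝ) ∞
      (fun z => ((s z).lam : EG →L[ℝ] ℝ)) z₀ := by
    refine ((contMDiffAt_covec (x₀ := q₀) (z := z₀) hq).clm_comp
      ((contMDiffAt_zetaRep (EG := EG) (G := G) hq).comp z₀ hp1)).congr_of_eventuallyEq ?_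
    filter_upwards [hsrc] with z hz
    rw [hsl]
    exact zetaRep_momentum z hz
  refine ContMDiffAt.prodMk ?_ (ContMDiffAt.prodMk ?_ hlam)
  · exact hp1.congr_of_eventuallyEq (Filter.Eventually.of_forall hsb)
  have hbb : (s z₀).toCot.1 ∈ (chartAt EB b₀).source := by
    change (orbitProj G (s z₀).base : MulAction.orbitRel.Quotient G Q) ∈ _
    rw [hsb]
    exact mem_chart_source EB b₀
  refine (contMDiffAt_cotangentBundle_iff (f := fun z => (s z).toCot) (x₀ := b₀) hbb).2 ?_
  constructor
  · refine (hπs.contMDiffAt.comp z₀ hp1).congr_of_eventuallyEq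
      (Filter.Eventually.of_forall fun z => ?_)
    exact congrArg (orbitProj G) (hsb z)
  set P : Q → E →L[ℝ] EB := derivRep (orbitProj G : Q → MulAction.orbitRel.Quotient G Q) q₀ b₀
    with hP
  have hPs : ContMDiffAt 𝓘(ℝ, E) 𝓘(ℝ, E →L[ℝ] EB) ∞ P q₀ :=
    contMDiffAt_derivRep hπs hq (mem_chart_source EB b₀)
  have hPsurj : Function.Surjective (P q₀) := by
    intro u
    obtain ⟨F, _, _, hF⟩ := hπ.isSubmersionAt q₀
    obtain ⟨v, hv⟩ := submersion_mfderiv_surjective hF (frame 𝓘(ℝ, EB) b₀ b₀ u)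
    refine ⟨coframe 𝓘(ℝ, E) q₀ q₀ v, ?_⟩
    change coframe 𝓘(ℝ, EB) b₀ b₀ (dproj q₀ (frame 𝓘(ℝ, E) q₀ q₀ (coframe 𝓘(ℝ, E) q₀ q₀ v))) = u
    rw [frame_coframe hq, hv]
    exact coframe_frame (mem_chart_source EB b₀) u
  -- A right inverse of `P` is fixed at `q₀` only. Nearby `P R'` stays invertible, so `R' (P R')⁻¹`
  -- is a right inverse of `P` depending smoothly on the point, and composing the remainder with it
  -- gives `η`.
  obtain ⟨R, hR⟩ := (P q₀).toLinearMap.exists_rightInverse_of_surjective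
    (LinearMap.range_eq_top.2 hPsurj)
  let R' : EB →L[ℝ] E := R.toContinuousLinearMap
  have hPR : (P q₀).comp R' = 1 := ContinuousLinearMap.ext fun u => LinearMap.congr_fun hR u
  have hPRs : ContMDiffAt (cotModel E) 𝓘(ℝ, EB →L[ℝ] EB) ∞
      (fun z : CotangentBundle E Q => (P z.1).comp R') z₀ :=
    (hPs.comp z₀ hp1).clm_comp contMDiffAt_const
  have : CompleteSpace EB := FiniteDimensional.complete ℝ EB
  have hinv : ContMDiffAt (cotModel E) 𝓘(ℝ, EB →L[ℝ] EB) ∞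
      (fun z : CotangentBundle E Q => Ring.inverse ((P z.1).comp R')) z₀ := by
    have h1 : ContDiffAt ℝ ∞ (Ring.inverse : (EB →L[ℝ] EB) → _) ((P z₀.1).comp R') := by
      rw [show (P z₀.1).comp R' = ((1 : (EB →L[ℝ] EB)ˣ) : EB →L[ℝ] EB) from hPR]
      exact contDiffAt_ringInverse ℝ 1
    exact h1.contMDiffAt.comp z₀ hPRs
  have hunit : ∀ᶠ z : CotangentBundle E Q in 𝓝 z₀, IsUnit ((P z.1).comp R') := by
    refine hPRs.continuousAt.eventually (p := IsUnit) (Units.isOpen.mem_nhds ?_)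
    change IsUnit ((P q₀).comp R')
    rw [hPR]
    exact isUnit_one
  have hr : ContMDiffAt (cotModel E) 𝓘(ℝ, E →L[ℝ] ℝ) ∞ (fun z : CotangentBundle E Q =>
      covec q₀ z - ((s z).lam : EG →L[ℝ] ℝ).comp (connRep A q₀ z.1)) z₀ :=
    (contMDiffAt_covec (x₀ := q₀) (z := z₀) hq).sub
      (hlam.clm_comp ((contMDiffAt_connRep A hq).comp z₀ hp1))
  refine ((hr.clm_comp (contMDiffAt_const (c := R'))).clm_comp hinv).congr_of_eventuallyEq ?_
  filter_upwards [hsrc, hsrcb, hunit] with z hz1 hz2 hz3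
  have h1 := covec_psi A (q₀ := q₀) (b₀ := b₀) (s z) (by rw [hsb]; exact hz2)
  have h4 : (s z).base = z.1 := hsb z
  have h5 : ∀ q, (s z).base = q → covec q₀ z = (covec b₀ (s z).toCot).comp (P q) +
      ((s z).lam : EG →L[ℝ] ℝ).comp (connRep A q₀ q) := by
    rintro q rfl
    rw [← h1, hs]
  rw [h5 _ h4, add_sub_cancel_right]
  change covec b₀ (s z).toCot =
    (((covec b₀ (s z).toCot).comp (P z.1)).comp R').comp (Ring.inverse ((P z.1).comp R'))
  rw [ContinuousLinearMap.comp_assoc, ContinuousLinearMap.comp_assoc,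
    ← ContinuousLinearMap.comp_assoc (P z.1)]
  have h2 : ((P z.1).comp R').comp (Ring.inverse ((P z.1).comp R')) = 1 :=
    Ring.mul_inverse_cancel _ hz3
  rw [h2]
  rfl

end LocalFrames

end GaugedCotangent

end

noncomputable section

namespace GaugedCotangent

/-! ### The adjoint action and equivariance of fundamental vectors -/

section Adjoint

variable {EG : Type*} [NormedAddCommGroup EG] [NormedSpace ℝ EG]
  {G : Type*} [TopologicalSpace G] [ChartedSpace EG G] [Group G] [LieGroup 𝓘(ℝ, EG) ∞ G]
  {E H M : Type*} [NormedAddCommGroup E] [NormedSpace ℝ E] [TopologicalSpace H]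
  {I : ModelWithCorners ℝ E H} [TopologicalSpace M] [ChartedSpace H M] [IsManifold I ∞ M]
  [MulAction G M] [ContMDiffSMul 𝓘(ℝ, EG) I ∞ G M] [I.Boundaryless]

lemma contMDiff_conj : ContMDiff (𝓘(ℝ, EG).prod 𝓘(ℝ, EG)) 𝓘(ℝ, EG) ∞
    fun p : G × G => p.1 * p.2 * p.1⁻¹ := by
  have h1 : ContMDiff (𝓘(ℝ, EG).prod 𝓘(ℝ, EG)) 𝓘(ℝ, EG) ∞ fun p : G × G => p.1 := contMDiff_fst
  exact (h1.mul contMDiff_snd).mul (contMDiff_fst (I := 𝓘(ℝ, EG)) (J := 𝓘(ℝ, EG))).inv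

lemma mdifferentiableAt_conj (g h : G) :
    MDifferentiableAt 𝓘(ℝ, EG) 𝓘(ℝ, EG) (fun k : G => g * k * g⁻¹) h := by
  have h1 : ContMDiff 𝓘(ℝ, EG) (𝓘(ℝ, EG).prod 𝓘(ℝ, EG)) ∞ fun k : G => (g, k) :=
    contMDiff_const.prodMk contMDiff_id
  exact (contMDiff_conj.comp h1).contMDiffAt.mdifferentiableAt (by simp)

lemma Ad_one : Ad (1 : G) = ContinuousLinearMap.id ℝ EG := by
  have h : (fun k : G => 1 * k * 1⁻¹) = id := by
    funext k
    simp
  rw [Ad, h]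
  exact mfderiv_id (I := 𝓘(ℝ, EG)) (x := (1 : G))

lemma Ad_mul (g h : G) : (Ad (g * h) : EG →L[ℝ] EG) = (Ad g).comp (Ad h) := by
  have h1 : (fun k : G => g * h * k * (g * h)⁻¹) =
      (fun k : G => g * k * g⁻¹) ∘ fun k : G => h * k * h⁻¹ := by
    funext k
    simp [mul_assoc]
  have h2 := mfderiv_comp (1 : G) (mdifferentiableAt_conj (EG := EG) g (h * 1 * h⁻¹))
    (mdifferentiableAt_conj h 1)
  rw [← h1] at h2
  refine h2.trans ?_
  have h3 : ∀ p : G, p = 1 → (mfderiv 𝓘(ℝ, EG) 𝓘(ℝ, EG) (fun k : G => g * k * g⁻¹) p :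
      EG →L[ℝ] EG) = Ad (EG := EG) g := by
    rintro _ rfl
    rfl
  exact congrArg (fun L : EG →L[ℝ] EG => L.comp (Ad h)) (h3 (h * 1 * h⁻¹) (by simp))

lemma Ad_inv_Ad (g : G) (X : EG) : Ad g⁻¹ (Ad g X) = X := by
  have h := congrArg (fun L : EG →L[ℝ] EG => L X) (Ad_mul (EG := EG) g⁻¹ g)
  rw [inv_mul_cancel, Ad_one] at h
  exact h.symm

lemma Ad_Ad_inv (g : G) (X : EG) : Ad g (Ad g⁻¹ X) = X := by
  simpa using Ad_inv_Ad g⁻¹ X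

/-- `Ad` is the derivative at `1`, in the second variable, of the smooth map `(g, h) ↦ g h g⁻¹`. All
values at `h = 1` equal `1`, where the preferred frame is the identity. -/
lemma contMDiff_Ad : ContMDiff 𝓘(ℝ, EG) 𝓘(ℝ, EG →L[ℝ] EG) ∞ (Ad : G → EG →L[ℝ] EG) := by
  intro g₀
  have h1 : ContMDiffAt (𝓘(ℝ, EG).prod 𝓘(ℝ, EG)) 𝓘(ℝ, EG) ∞
      (Function.uncurry fun g k : G => g * k * g⁻¹) (g₀, 1) := contMDiff_conj.contMDiffAt
  have h2 := ContMDiffAt.mfderiv (fun g k : G => g * k * g⁻¹) (fun _ : G => (1 : G)) h1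
    (contMDiffAt_const (I := 𝓘(ℝ, EG))) (m := ∞) (by norm_cast)
  have e : ∀ g a : G, a = 1 → ∀ L : EG →L[ℝ] EG,
      (coframe 𝓘(ℝ, EG) a (g * 1 * g⁻¹)).comp (L.comp (frame 𝓘(ℝ, EG) (1 : G) 1)) = L := by
    rintro g a rfl L
    refine ContinuousLinearMap.ext fun X => ?_
    have e2 : ∀ b : G, b = 1 → ∀ Y : EG, coframe 𝓘(ℝ, EG) (1 : G) b Y = Y := by
      rintro b rfl Y
      exact coframe_self (I := 𝓘(ℝ, EG)) (1 : G) _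
    refine (e2 _ (by simp) _).trans ?_
    exact congrArg L (frame_self (I := 𝓘(ℝ, EG)) (1 : G) X)
  refine h2.congr_of_eventuallyEq (Filter.Eventually.of_forall fun g => ?_)
  exact (e g (g₀ * 1 * g₀⁻¹) (by simp) (Ad g)).symm

lemma contMDiff_coAd : ContMDiff (𝓘(ℝ, EG).prod 𝓘(ℝ, EG →L[ℝ] ℝ)) 𝓘(ℝ, EG →L[ℝ] ℝ) ∞
    fun p : G × (EG →L[ℝ] ℝ) => coAd p.1 p.2 := by
  have h1 : ContMDiff (𝓘(ℝ, EG).prod 𝓘(ℝ, EG →L[ℝ] ℝ)) 𝓘(ℝ, EG) ∞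
      fun p : G × (EG →L[ℝ] ℝ) => p.1⁻¹ := contMDiff_fst.inv
  have h2 : ContMDiff (𝓘(ℝ, EG).prod 𝓘(ℝ, EG →L[ℝ] ℝ)) 𝓘(ℝ, EG →L[ℝ] ℝ) ∞
      fun p : G × (EG →L[ℝ] ℝ) => p.2 := contMDiff_snd
  exact h2.clm_comp (contMDiff_Ad.comp h1)

lemma coAd_one (lam : EG →L[ℝ] ℝ) : coAd (1 : G) lam = lam := by
  rw [coAd, inv_one, Ad_one]
  rfl

lemma coAd_mul (g h : G) (lam : EG →L[ℝ] ℝ) : coAd (g * h) lam = coAd g (coAd h lam) := by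
  rw [coAd, mul_inv_rev, Ad_mul]
  rfl

/-- Fundamental vector fields are equivariant. -/
lemma mfderiv_smul_zeta_eq (g : G) (x : M) (X : EG) :
    mfderiv I I (fun z : M => g • z) x (zeta G I x X) = zeta G I (g • x) (Ad g X) := by
  have h1 := mfderiv_comp (I := 𝓘(ℝ, EG)) (I' := I) (I'' := I) (1 : G)
    (g := fun z : M => g • z) (f := fun h : G => h • x)
    ((contMDiff_smul_left EG I g).contMDiffAt.mdifferentiableAt (by simp))
    ((contMDiff_smul_right x).contMDiffAt.mdifferentiableAt (by simp))
  have h2 := mfderiv_comp (I := 𝓘(ℝ, EG)) (I' := 𝓘(ℝ, EG)) (I'' := I) (1 : G)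
    (g := fun h : G => h • (g • x)) (f := fun h : G => g * h * g⁻¹)
    ((contMDiff_smul_right (g • x)).contMDiffAt.mdifferentiableAt (by simp))
    (mdifferentiableAt_conj g 1)
  have h3 : (fun z : M => g • z) ∘ (fun h : G => h • x) =
      (fun h : G => h • (g • x)) ∘ fun h => g * h * g⁻¹ := by
    funext h
    simp [mul_smul]
  have h4 : mfderiv I I (fun z : M => g • z) x (zeta G I x X) =
      mfderiv I I (fun z : M => g • z) ((1 : G) • x) (mfderiv 𝓘(ℝ, EG) I (fun h : G => h • x) 1 X) :=
    congrArg (fun p : M => (mfderiv I I (fun z : M => g • z) p : E →L[ℝ] E) (zeta G I x X))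
      (one_smul G x).symm
  have h5 : zeta G I (g • x) (Ad g X) =
      mfderiv 𝓘(ℝ, EG) I (fun h : G => h • (g • x)) (g * 1 * g⁻¹)
        (mfderiv 𝓘(ℝ, EG) 𝓘(ℝ, EG) (fun h : G => g * h * g⁻¹) 1 X) :=
    congrArg (fun p : G => (mfderiv 𝓘(ℝ, EG) I (fun h : G => h • (g • x)) p : EG →L[ℝ] E)
      (Ad (EG := EG) g X)) (by simp : (1 : G) = g * 1 * g⁻¹)
  have h6 : mfderiv 𝓘(ℝ, EG) I ((fun z : M => g • z) ∘ (fun h : G => h • x)) 1 X =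
    mfderiv 𝓘(ℝ, EG) I ((fun h : G => h • (g • x)) ∘ fun h => g * h * g⁻¹) 1 X := by rw [h3]
  rw [h1, h2] at h6
  exact (h4.trans h6).trans h5.symm

lemma mfderiv_inv_smul_smul (EG : Type*) [NormedAddCommGroup EG] [NormedSpace ℝ EG]
    [ChartedSpace EG G] [ContMDiffSMul 𝓘(ℝ, EG) I ∞ G M] (g : G) (x : M) :
    ((mfderiv I I (fun z : M => g⁻¹ • z) (g • x) : E →L[ℝ] E).comp
      (mfderiv I I (fun z : M => g • z) x : E →L[ℝ] E)) = ContinuousLinearMap.id ℝ E := by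
  have h1 := mfderiv_comp (I := I) (I' := I) (I'' := I) x
    (g := fun z : M => g⁻¹ • z) (f := fun z : M => g • z)
    ((contMDiff_smul_left EG I g⁻¹).contMDiffAt.mdifferentiableAt (by simp))
    ((contMDiff_smul_left EG I g).contMDiffAt.mdifferentiableAt (by simp))
  have h2 : (fun z : M => g⁻¹ • z) ∘ (fun z : M => g • z) = id := by
    funext z
    simp
  rw [h2, mfderiv_id] at h1
  exact h1.symm

lemma mfderiv_smul_inv_smul (EG : Type*) [NormedAddCommGroup EG] [NormedSpace ℝ EG]
    [ChartedSpace EG G] [ContMDiffSMul 𝓘(ℝ, EG) I ∞ G M] (g : G) (x : M) :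
    ((mfderiv I I (fun z : M => g • z) x : E →L[ℝ] E).comp
      (mfderiv I I (fun z : M => g⁻¹ • z) (g • x) : E →L[ℝ] E)) = ContinuousLinearMap.id ℝ E := by
  have h1 := mfderiv_inv_smul_smul (I := I) EG g⁻¹ (g • x)
  have h2 : ∀ h : G, h = g → ∀ y : M, y = x → (mfderiv I I (fun z : M => h • z) y : E →L[ℝ] E) =
      (mfderiv I I (fun z : M => g • z) x : E →L[ℝ] E) := by
    rintro _ rfl _ rfl
    rfl
  rw [h2 _ (inv_inv g) _ (inv_smul_smul g x)] at h1
  exact h1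

/-- `Ad(g⁻¹)` maps `𝔤_{g x}` into `𝔤_x`. Dually `Ad^*(g)` maps annihilators to annihilators, so the
action on `W` is well defined. -/
lemma zeta_Ad_inv_eq_zero {g : G} {x : M} {X : EG} (h : zeta G I (g • x) X = 0) :
    zeta G I x (Ad g⁻¹ X) = 0 := by
  have h1 := mfderiv_smul_zeta_eq (I := I) g x (Ad g⁻¹ X)
  rw [Ad_Ad_inv, h] at h1
  have h2 := congrArg (fun L : E →L[ℝ] E => L (zeta G I x (Ad g⁻¹ X)))
    (mfderiv_inv_smul_smul (I := I) EG g x)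
  refine h2.symm.trans ?_
  refine (congrArg (mfderiv I I (fun z : M => g⁻¹ • z) (g • x) : E →L[ℝ] E) h1).trans ?_
  exact ContinuousLinearMap.map_zero _

end Adjoint

/-! ### The action on `W` and equivariance of `ψ` -/

section ActionOnW

variable {EG : Type*} [NormedAddCommGroup EG] [NormedSpace ℝ EG]
  {G : Type*} [TopologicalSpace G] [ChartedSpace EG G] [Group G] [LieGroup 𝓘(ℝ, EG) ∞ G]
  {E Q : Type*} [NormedAddCommGroup E] [NormedSpace ℝ E]
  [TopologicalSpace Q] [ChartedSpace E Q] [IsManifold 𝓘(ℝ, E) ∞ Q]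
  [MulAction G Q] [ContMDiffSMul 𝓘(ℝ, EG) 𝓘(ℝ, E) ∞ G Q]
  {EB : Type*} [NormedAddCommGroup EB] [NormedSpace ℝ EB]
  [ChartedSpace EB (MulAction.orbitRel.Quotient G Q)]
  [IsManifold 𝓘(ℝ, EB) ∞ (MulAction.orbitRel.Quotient G Q)]
  (A : GenConnection EG G E Q)

local notation "dproj" => mfderiv 𝓘(ℝ, E) 𝓘(ℝ, EB) (orbitProj G : Q → MulAction.orbitRel.Quotient G Q)

lemma cotangent_mk_congr {E M : Type*} [NormedAddCommGroup E] [NormedSpace ℝ E]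
    [TopologicalSpace M] [ChartedSpace E M] {b b' : M} (h : b = b') (η : E →L[ℝ] ℝ) :
    (⟨b, η⟩ : CotangentBundle E M) = ⟨b', η⟩ := by
  subst h
  rfl

/-- The image of a point of `W` under a group element. -/
def WSpace.act (g : G) (w : WSpace EG G E Q EB) : WSpace EG G E Q EB where
  base := g • w.base
  -- All cotangent spaces of `Q/G` have the same underlying model space, and `π(g q) = π(q)`;
  -- keeping the functional therefore keeps the point of `T^*(Q/G)`.
  eta := (w.eta : EB →L[ℝ] ℝ)
  lam := ⟨coAd g w.lam, fun _ hX => w.lam.2 _ (zeta_Ad_inv_eq_zero hX)⟩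

lemma WSpace.act_toCot (g : G) (w : WSpace EG G E Q EB) : (w.act g).toCot = w.toCot :=
  cotangent_mk_congr (E := EB) (orbitProj_smul g w.base) (w.eta : EB →L[ℝ] ℝ)

lemma WSpace.act_incl (g : G) (w : WSpace EG G E Q EB) :
    (w.act g).incl = (g • w.base, w.toCot, coAd g (w.lam : EG →L[ℝ] ℝ)) :=
  congrArg (fun c => (g • w.base, c, coAd g (w.lam : EG →L[ℝ] ℝ))) (w.act_toCot g)

variable (EG G E Q EB) in
/-- The action of the group on `W`. -/
@[reducible]
def WSpace.mulAction : MulAction G (WSpace EG G E Q EB) where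
  smul g w := w.act g
  one_smul w := incl_injective <| by
    refine (w.act_incl 1).trans ?_
    rw [one_smul, coAd_one]
    rfl
  mul_smul g h w := incl_injective <| by
    refine (w.act_incl (g * h)).trans (Eq.trans ?_ ((w.act h).act_incl g).symm)
    rw [WSpace.act_toCot, mul_smul, coAd_mul]
    rfl

lemma mfderiv_orbitProj_smul (EG : Type*) [NormedAddCommGroup EG] [NormedSpace ℝ EG]
    [ChartedSpace EG G] [ContMDiffSMul 𝓘(ℝ, EG) 𝓘(ℝ, E) ∞ G Q] (hπ : ContMDiff 𝓘(ℝ, E) 𝓘(ℝ, EB) ∞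
      (orbitProj G : Q → MulAction.orbitRel.Quotient G Q)) (g : G) (q : Q)
    (v : TangentSpace 𝓘(ℝ, E) q) :
    (dproj (g • q) : E →L[ℝ] EB) (mfderiv 𝓘(ℝ, E) 𝓘(ℝ, E) (fun x : Q => g • x) q v) =
      (dproj q : E →L[ℝ] EB) v := by
  have h1 := mfderiv_comp (I := 𝓘(ℝ, E)) (I' := 𝓘(ℝ, E)) (I'' := 𝓘(ℝ, EB)) q
    (g := (orbitProj G : Q → MulAction.orbitRel.Quotient G Q)) (f := fun z : Q => g • z)
    (hπ.contMDiffAt.mdifferentiableAt (by simp))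
    ((contMDiff_smul_left EG 𝓘(ℝ, E) g).contMDiffAt.mdifferentiableAt (by simp))
  have h2 : (orbitProj G : Q → MulAction.orbitRel.Quotient G Q) ∘ (fun z : Q => g • z) =
      orbitProj G := funext fun q => orbitProj_smul g q
  rw [h2] at h1
  exact (congrArg (fun L : E →L[ℝ] EB => L v) h1).symm

/-- The `η` term is unchanged because `π ∘ g = π`. In the `λ` term `Ad(g⁻¹)` from the coadjoint
action cancels `Ad(g)` from the equivariance of `A`. -/
lemma psiFib_act (hπ : ContMDiff 𝓘(ℝ, E) 𝓘(ℝ, EB) ∞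
      (orbitProj G : Q → MulAction.orbitRel.Quotient G Q)) (g : G) (w : WSpace EG G E Q EB)
    (v : TangentSpace 𝓘(ℝ, E) w.base) :
    psiFib A EB (w.act g).base ((w.act g).eta, (w.act g).lam)
      (mfderiv 𝓘(ℝ, E) 𝓘(ℝ, E) (fun x : Q => g • x) w.base v) =
      psiFib A EB w.base (w.eta, w.lam) v := by
  rw [psiFib_apply]
  refine (congrArg₂ (· + ·) (congrArg (w.eta : EB →L[ℝ] ℝ)
    (mfderiv_orbitProj_smul EG hπ g w.base v)) ?_ :
    _ = (w.eta : EB →L[ℝ] ℝ) (dproj w.base v) + (w.lam : EG →L[ℝ] ℝ) (A.toFun w.base v))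
  change (w.lam : EG →L[ℝ] ℝ) (Ad g⁻¹ (A.toFun (g • w.base) _)) = _
  rw [A.equivariant, Ad_inv_Ad]

/-- `psiFib_act` evaluated at `(T_q g)⁻¹ u`, the inverse being the tangent map of `g⁻¹`. -/
lemma psi_act (hπ : ContMDiff 𝓘(ℝ, E) 𝓘(ℝ, EB) ∞
      (orbitProj G : Q → MulAction.orbitRel.Quotient G Q)) (g : G) (w : WSpace EG G E Q EB) :
    psi A (w.act g) = cotangentLift g (psi A w) := by
  refine congrArg (TotalSpace.mk' _ (g • w.base)) (ContinuousLinearMap.ext fun u => ?_)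
  have h1 : (mfderiv 𝓘(ℝ, E) 𝓘(ℝ, E) (fun x : Q => g • x) w.base : E →L[ℝ] E).inverse =
      mfderiv 𝓘(ℝ, E) 𝓘(ℝ, E) (fun x : Q => g⁻¹ • x) (g • w.base) :=
    ContinuousLinearMap.inverse_eq (mfderiv_smul_inv_smul (I := 𝓘(ℝ, E)) EG g w.base)
      (mfderiv_inv_smul_smul (I := 𝓘(ℝ, E)) EG g w.base)
  set u' : E := (mfderiv 𝓘(ℝ, E) 𝓘(ℝ, E) (fun x : Q => g⁻¹ • x) (g • w.base) : E →L[ℝ] E) u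
    with hu'
  have h2 : (mfderiv 𝓘(ℝ, E) 𝓘(ℝ, E) (fun x : Q => g • x) w.base : E →L[ℝ] E) u' = u :=
    congrArg (fun L : E →L[ℝ] E => L u) (mfderiv_smul_inv_smul (I := 𝓘(ℝ, E)) EG g w.base)
  have h3 := psiFib_act A hπ g w u'
  refine (congrArg (psiFib A EB (w.act g).base ((w.act g).eta, (w.act g).lam) : E →L[ℝ] ℝ)
    h2).symm.trans (h3.trans ?_)
  exact (congrArg (fun L : E →L[ℝ] E =>
    (psiFib A EB w.base (w.eta, w.lam) : E →L[ℝ] ℝ) (L u)) h1).symm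

end ActionOnW

end GaugedCotangent

end

noncomputable section

namespace GaugedCotangent

/-! ### Negation of one-forms, and wedges of degree one -/

section Negation

variable {E H M : Type*} [NormedAddCommGroup E] [NormedSpace ℝ E] [TopologicalSpace H]
  {I : ModelWithCorners ℝ E H} [TopologicalSpace M] [ChartedSpace H M] [IsManifold I ∞ M]
  [I.Boundaryless] {V : Type*} [NormedAddCommGroup V] [NormedSpace ℝ V]

lemma SmoothOneForm.neg {α : ∀ x : M, TangentSpace I x →L[ℝ] V} (hα : SmoothOneForm α) :
    SmoothOneForm (fun x => -α x) := by
  intro x₀ x hx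
  exact (hα x₀ x hx).neg

lemma SmoothOneForm.extD_neg {α : ∀ x : M, TangentSpace I x →L[ℝ] V} (hα : SmoothOneForm α)
    (x : M) : extD I (oneForm I fun x => -α x) x = -extD I (oneForm I α) x := by
  ext v
  have hx := mem_chart_source H x
  have h1 : fderiv ℝ (rep1 (fun x => -α x) x) (extChartAt I x x) =
      -fderiv ℝ (rep1 α x) (extChartAt I x x) := by
    change fderiv ℝ (-(rep1 α x)) _ = _
    exact fderiv_neg
  rw [ContinuousAlternatingMap.neg_apply, extD_oneForm_apply hα.neg hx, extD_oneForm_apply hα hx,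
    h1]
  simp only [_root_.neg_apply]
  abel

end Negation

/-- There are two permutations, and the factor `1 / (k! l!)` is `1`. -/
lemma wedge_one_one {T V₁ V₂ V₃ : Type*} [AddCommGroup V₃] [Module ℝ V₃] (β : V₁ → V₂ → V₃)
    (φ : (Fin 1 → T) → V₁) (χ : (Fin 1 → T) → V₂) (v : Fin 2 → T) :
    wedge (l := 1) (k := 1) β φ χ v =
      β (φ fun _ => v 0) (χ fun _ => v 1) - β (φ fun _ => v 1) (χ fun _ => v 0) := by
  have h : (Finset.univ : Finset (Equiv.Perm (Fin (1 + 1)))) = {1, Equiv.swap 0 1} := by decide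
  have h1 : ∀ s : Equiv.Perm (Fin 2), (fun i : Fin 1 => v (s (Fin.castAdd 1 i))) =
      fun _ => v (s 0) := fun s => funext fun i => by rw [Subsingleton.elim i 0]; rfl
  have h2 : ∀ s : Equiv.Perm (Fin 2), (fun i : Fin 1 => v (s (Fin.natAdd 1 i))) =
      fun _ => v (s 1) := fun s => funext fun i => by rw [Subsingleton.elim i 0]; rfl
  rw [wedge, h, Finset.sum_insert (by decide), Finset.sum_singleton]
  rw [h1, h1, h2, h2, Equiv.swap_apply_left, Equiv.swap_apply_right]
  simp [sub_eq_add_neg]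

/-! ### The manifold `W`, its symplectic form and the form `B` -/

section Structure

variable {EG : Type*} [NormedAddCommGroup EG] [NormedSpace ℝ EG]
  {G : Type*} [TopologicalSpace G] [ChartedSpace EG G] [Group G] [LieGroup 𝓘(ℝ, EG) ∞ G]
  {E Q : Type*} [NormedAddCommGroup E] [NormedSpace ℝ E] [FiniteDimensional ℝ E]
  [TopologicalSpace Q] [ChartedSpace E Q] [IsManifold 𝓘(ℝ, E) ∞ Q]
  [MulAction G Q] [ContMDiffSMul 𝓘(ℝ, EG) 𝓘(ℝ, E) ∞ G Q]
  {EB : Type*} [NormedAddCommGroup EB] [NormedSpace ℝ EB] [FiniteDimensional ℝ EB]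
  [ChartedSpace EB (MulAction.orbitRel.Quotient G Q)]
  [IsManifold 𝓘(ℝ, EB) ∞ (MulAction.orbitRel.Quotient G Q)]
  {A : GenConnection EG G E Q}

/-- The bijection `ψ` as a homeomorphism. -/
def psiHomeomorph (A : GenConnection EG G E Q) [FiniteDimensional ℝ EG] [T2Space G]
    [ProperSMul G Q]
    (hπ : Manifold.IsSubmersion 𝓘(ℝ, E) 𝓘(ℝ, EB) ∞
      (orbitProj G : Q → MulAction.orbitRel.Quotient G Q)) :
    WSpace EG G E Q EB ≃ₜ CotangentBundle E Q where
  toEquiv := Equiv.ofBijective (psi A) (psi_bijective A hπ)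
  continuous_toFun := continuous_psi A hπ.contMDiff
  continuous_invFun := continuous_induced_rng.2
    (contMDiff_incl_comp_rightInverse A hπ
      (Equiv.ofBijective_apply_symm_apply (psi A) (psi_bijective A hπ))).continuous

variable [ChartedSpace (ModelProd E (E →L[ℝ] ℝ)) (WSpace EG G E Q EB)]
  [IsManifold (cotModel E) ∞ (WSpace EG G E Q EB)]
  {Ψ : Diffeomorph (cotModel E) (cotModel E) (WSpace EG G E Q EB) (CotangentBundle E Q) ∞}

local notation "dproj" => mfderiv 𝓘(ℝ, E) 𝓘(ℝ, EB) (orbitProj G : Q → MulAction.orbitRel.Quotient G Q)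

lemma contMDiff_psi (hΨ : ∀ w, Ψ w = psi A w) :
    ContMDiff (cotModel E) (cotModel E) ∞ (psi A : WSpace EG G E Q EB → _) := by
  rw [← funext hΨ]
  exact Ψ.contMDiff

/-- The inclusion is its composite with `ψ⁻¹`, whose smoothness is known, precomposed with the
diffeomorphism `ψ`. -/
lemma contMDiff_incl (hΨ : ∀ w, Ψ w = psi A w) (hπ : Manifold.IsSubmersion 𝓘(ℝ, E) 𝓘(ℝ, EB) ∞
      (orbitProj G : Q → MulAction.orbitRel.Quotient G Q)) :
    ContMDiff (cotModel E) (𝓘(ℝ, E).prod ((cotModel EB).prod 𝓘(ℝ, EG →L[ℝ] ℝ))) ∞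
      (WSpace.incl : WSpace EG G E Q EB → _) := by
  have h := (contMDiff_incl_comp_rightInverse A hπ (s := Ψ.symm)
    (fun z => by rw [← hΨ]; exact Ψ.apply_symm_apply z)).comp Ψ.contMDiff
  refine h.congr fun w => ?_
  exact congrArg WSpace.incl (Ψ.symm_apply_apply w).symm

lemma contMDiff_base (hΨ : ∀ w, Ψ w = psi A w) (hπ : Manifold.IsSubmersion 𝓘(ℝ, E) 𝓘(ℝ, EB) ∞
      (orbitProj G : Q → MulAction.orbitRel.Quotient G Q)) :
    ContMDiff (cotModel E) 𝓘(ℝ, E) ∞ (WSpace.base : WSpace EG G E Q EB → Q) :=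
  contMDiff_fst.comp (contMDiff_incl hΨ hπ)

lemma contMDiff_toCot (hΨ : ∀ w, Ψ w = psi A w) (hπ : Manifold.IsSubmersion 𝓘(ℝ, E) 𝓘(ℝ, EB) ∞
      (orbitProj G : Q → MulAction.orbitRel.Quotient G Q)) :
    ContMDiff (cotModel E) (cotModel EB) ∞ (WSpace.toCot : WSpace EG G E Q EB → _) :=
  (contMDiff_fst.comp contMDiff_snd).comp (contMDiff_incl hΨ hπ)

lemma contMDiff_lam (hΨ : ∀ w, Ψ w = psi A w) (hπ : Manifold.IsSubmersion 𝓘(ℝ, E) 𝓘(ℝ, EB) ∞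
      (orbitProj G : Q → MulAction.orbitRel.Quotient G Q)) :
    ContMDiff (cotModel E) 𝓘(ℝ, EG →L[ℝ] ℝ) ∞
      (fun w : WSpace EG G E Q EB => (w.lam : EG →L[ℝ] ℝ)) :=
  (contMDiff_snd.comp contMDiff_snd).comp (contMDiff_incl hΨ hπ)

lemma contMDiff_muA (hΨ : ∀ w, Ψ w = psi A w) (hπ : Manifold.IsSubmersion 𝓘(ℝ, E) 𝓘(ℝ, EB) ∞
      (orbitProj G : Q → MulAction.orbitRel.Quotient G Q)) :
    ContMDiff (cotModel E) 𝓘(ℝ, EG →L[ℝ] ℝ) ∞ (muA A : WSpace EG G E Q EB → _) :=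
  (contMDiff_lam hΨ hπ).congr (muA_eq_lam A hπ.contMDiff)

/-- A map into `W` is smooth if it is smooth as a map into `Q × T^*(Q/G) × 𝔤^*`. -/
lemma contMDiff_of_incl (hΨ : ∀ w, Ψ w = psi A w) (hπ : Manifold.IsSubmersion 𝓘(ℝ, E) 𝓘(ℝ, EB) ∞
      (orbitProj G : Q → MulAction.orbitRel.Quotient G Q))
    {E' H' N : Type*} [NormedAddCommGroup E'] [NormedSpace ℝ E'] [TopologicalSpace H']
    {J : ModelWithCorners ℝ E' H'} [TopologicalSpace N] [ChartedSpace H' N]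
    {f : N → WSpace EG G E Q EB}
    (hf : ContMDiff J (𝓘(ℝ, E).prod ((cotModel EB).prod 𝓘(ℝ, EG →L[ℝ] ℝ))) ∞
      fun n => (f n).incl) : ContMDiff J (cotModel E) ∞ f := by
  have hc : Continuous f := continuous_induced_rng.2 hf.continuous
  have h1 : ContMDiff J (cotModel E) ∞ fun n => psi A (f n) := by
    intro n
    -- Locally `ψ ∘ f` is `Φ` after a smooth map into the product. Composing with `ψ⁻¹` then gives
    -- back `f`.
    obtain ⟨Φ, hΦ, h⟩ := exists_local_extension_psi A hπ.contMDiff (f n)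
    refine (hΦ.comp n (hf n)).congr_of_eventuallyEq ?_
    exact hc.continuousAt.eventually h
  refine (Ψ.symm.contMDiff.comp h1).congr fun n => ?_
  exact ((congrArg Ψ.symm (hΨ (f n)).symm).trans (Ψ.symm_apply_apply (f n))).symm

lemma mfderiv_psi_bijective (hΨ : ∀ w, Ψ w = psi A w) (w : WSpace EG G E Q EB) :
    Function.Bijective (mfderiv (cotModel E) (cotModel E) (psi A) w) := by
  rw [← funext hΨ]
  exact (Ψ.mfderivToContinuousLinearEquiv (by simp) w).bijective

lemma isEmbeddedVia_incl (hΨ : ∀ w, Ψ w = psi A w)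
    (hπ : Manifold.IsSubmersion 𝓘(ℝ, E) 𝓘(ℝ, EB) ∞
      (orbitProj G : Q → MulAction.orbitRel.Quotient G Q)) :
    IsEmbeddedVia (cotModel E) (𝓘(ℝ, E).prod ((cotModel EB).prod 𝓘(ℝ, EG →L[ℝ] ℝ)))
      (WSpace.incl : WSpace EG G E Q EB → _) where
  smooth := contMDiff_incl hΨ hπ
  embedding := ⟨⟨rfl⟩, incl_injective⟩
  immersive w := by
    -- Locally `ψ` factors through the inclusion, so injectivity of `Tψ` forces that of the tangent
    -- map of the inclusion.
    obtain ⟨Φ, hΦ, h⟩ := exists_local_extension_psi A hπ.contMDiff w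
    have h1 := mfderiv_comp w (hΦ.mdifferentiableAt (by simp))
      ((contMDiff_incl hΨ hπ).contMDiffAt.mdifferentiableAt (x := w) (by simp))
    have h2 : Φ ∘ WSpace.incl =ᶠ[𝓝 w] psi A := h.mono fun w hw => hw.symm
    rw [h2.mfderiv_eq] at h1
    intro u v huv
    refine (mfderiv_psi_bijective hΨ w).1 ?_
    rw [h1]
    exact congrArg (mfderiv (𝓘(ℝ, E).prod ((cotModel EB).prod 𝓘(ℝ, EG →L[ℝ] ℝ))) (cotModel E) Φ
      w.incl) huv

/-- The one-form `ψ^* θ` on `W`. -/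
def thetaW (A : GenConnection EG G E Q) (w : WSpace EG G E Q EB) :
    TangentSpace (cotModel E) w →L[ℝ] ℝ :=
  ContinuousLinearMap.comp
    (psiFib A EB w.base (w.eta, w.lam) : TangentSpace 𝓘(ℝ, E) w.base →L[ℝ] ℝ) (dbase w)

/-- The cotangent projection after `ψ` is the projection of `W` to `Q`; the chain rule does the
rest. -/
lemma thetaW_eq (hΨ : ∀ w, Ψ w = psi A w) (w : WSpace EG G E Q EB) :
    thetaW A w = (liouvilleMap (psi A w)).comp (mfderiv (cotModel E) (cotModel E) (psi A) w) := by
  have h1 := mfderiv_comp w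
    ((contMDiff_cotangent_proj (E := E) (M := Q)).contMDiffAt.mdifferentiableAt
      (x := psi A w) (by simp))
    ((contMDiff_psi hΨ).contMDiffAt.mdifferentiableAt (x := w) (by simp))
  have h2 : (TotalSpace.proj : CotangentBundle E Q → Q) ∘ psi A =
      (WSpace.base : WSpace EG G E Q EB → Q) := rfl
  rw [h2] at h1
  exact congrArg (fun L => ContinuousLinearMap.comp
    (psiFib A EB w.base (w.eta, w.lam) : TangentSpace 𝓘(ℝ, E) w.base →L[ℝ] ℝ) L) h1

lemma smoothOneForm_thetaW (hΨ : ∀ w, Ψ w = psi A w) :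
    SmoothOneForm (I := cotModel E) (thetaW A : ∀ _ : WSpace EG G E Q EB, _) := by
  rw [funext (thetaW_eq hΨ)]
  exact smoothOneForm_liouvilleMap.comp_mfderiv (contMDiff_psi hΨ)

lemma sigma_eq (hΨ : ∀ w, Ψ w = psi A w) (w : WSpace EG G E Q EB) :
    sigma A w = -extD (cotModel E) (oneForm (cotModel E) (thetaW A)) w := by
  have h1 := smoothOneForm_liouvilleMap.extD_pullback (contMDiff_psi hΨ) w
  rw [pullback_oneForm, ← funext (thetaW_eq hΨ)] at h1
  rw [h1]
  rfl

/-- `σ` is exact, with primitive `-ψ^*θ`, hence smooth and closed. Nondegeneracy is that of `Ω`,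
since `Tψ` is bijective. -/
lemma isSymplectic_sigma (hΨ : ∀ w, Ψ w = psi A w) :
    IsSymplectic (cotModel E) (sigma A (EB := EB)) := by
  have hθ := smoothOneForm_thetaW hΨ
  have h1 : sigma A (EB := EB) =
      extD (cotModel E) (oneForm (cotModel E) fun w => -thetaW A w) := by
    funext w
    rw [sigma_eq hΨ, hθ.extD_neg]
  refine ⟨?_, ?_, fun w u hu => ?_⟩
  · rw [h1]
    exact IsSmoothForm_extD hθ.neg
  · rw [h1]
    exact hθ.neg.extD_extD
  · have hb := mfderiv_psi_bijective hΨ w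
    have h2 : mfderiv (cotModel E) (cotModel E) (psi A) w u = 0 := by
      refine canonicalForm_nondegenerate (psi A w) _ fun v => ?_
      obtain ⟨v', rfl⟩ := hb.2 v
      refine Eq.trans ?_ (hu v')
      refine congrArg (canonicalForm E Q (psi A w)) (funext fun i => ?_)
      fin_cases i <;> rfl
    exact hb.1 (h2.trans (ContinuousLinearMap.map_zero _).symm)

/-- The one-form `B` on `W`. -/
def formBMap (A : GenConnection EG G E Q) (w : WSpace EG G E Q EB) :
    TangentSpace (cotModel E) w →L[ℝ] ℝ :=
  (muA A w).comp ((A.toFun w.base).comp (dbase w))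

lemma formB_eq : formB A (EB := EB) = oneForm (cotModel E) (formBMap A) := rfl

/-- The decomposition `ψ^*θ = p^*θ^{Q/G} + B`. The two summands of `ψ` contribute one term each, and
`Tπ` along `W → Q` equals the derivative of `W → T^*(Q/G) → Q/G`. -/
lemma formBMap_eq (hΨ : ∀ w, Ψ w = psi A w) (hπ : Manifold.IsSubmersion 𝓘(ℝ, E) 𝓘(ℝ, EB) ∞
      (orbitProj G : Q → MulAction.orbitRel.Quotient G Q)) (w : WSpace EG G E Q EB) :
    formBMap A w = thetaW A w - (liouvilleMap w.toCot).comp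
      (mfderiv (cotModel E) (cotModel EB) WSpace.toCot w) := by
  have h1 := mfderiv_comp w
    ((contMDiff_cotangent_proj (E := EB)
      (M := MulAction.orbitRel.Quotient G Q)).contMDiffAt.mdifferentiableAt
      (x := w.toCot) (by simp))
    ((contMDiff_toCot hΨ hπ).contMDiffAt.mdifferentiableAt (x := w) (by simp))
  have h2 := mfderiv_comp w (hπ.contMDiff.contMDiffAt.mdifferentiableAt (x := w.base) (by simp))
    ((contMDiff_base hΨ hπ).contMDiffAt.mdifferentiableAt (x := w) (by simp))
  have h3 : (TotalSpace.proj : CotangentBundle EB (MulAction.orbitRel.Quotient G Q) → _) ∘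
      WSpace.toCot = orbitProj G ∘ (WSpace.base : WSpace EG G E Q EB → Q) := rfl
  rw [h3, h2] at h1
  refine ContinuousLinearMap.ext fun ξ => ?_
  have h4 := congrArg (fun L : (E × (E →L[ℝ] ℝ)) →L[ℝ] EB => (w.eta : EB →L[ℝ] ℝ) (L ξ)) h1
  change muA A w (A.toFun w.base (dbase w ξ)) = ((w.eta : EB →L[ℝ] ℝ) (dproj w.base (dbase w ξ)) +
    (w.lam : EG →L[ℝ] ℝ) (A.toFun w.base (dbase w ξ))) - _
  rw [muA_eq_lam A hπ.contMDiff, eq_sub_iff_add_eq, add_comm]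
  refine congrArg (· + _) ?_
  exact h4.symm

lemma smoothOneForm_liouville_toCot (hΨ : ∀ w, Ψ w = psi A w)
    (hπ : Manifold.IsSubmersion 𝓘(ℝ, E) 𝓘(ℝ, EB) ∞
      (orbitProj G : Q → MulAction.orbitRel.Quotient G Q)) :
    SmoothOneForm (I := cotModel E) fun w : WSpace EG G E Q EB => (liouvilleMap w.toCot).comp
      (mfderiv (cotModel E) (cotModel EB) WSpace.toCot w) :=
  smoothOneForm_liouvilleMap.comp_mfderiv (contMDiff_toCot hΨ hπ)

lemma smoothOneForm_formBMap (hΨ : ∀ w, Ψ w = psi A w)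
    (hπ : Manifold.IsSubmersion 𝓘(ℝ, E) 𝓘(ℝ, EB) ∞
      (orbitProj G : Q → MulAction.orbitRel.Quotient G Q)) :
    SmoothOneForm (I := cotModel E) (formBMap A : ∀ _ : WSpace EG G E Q EB, _) := by
  rw [funext (formBMap_eq hΨ hπ)]
  exact (smoothOneForm_thetaW hΨ).sub (smoothOneForm_liouville_toCot hΨ hπ)

lemma sigma_eq_sub (hΨ : ∀ w, Ψ w = psi A w) (hπ : Manifold.IsSubmersion 𝓘(ℝ, E) 𝓘(ℝ, EB) ∞
      (orbitProj G : Q → MulAction.orbitRel.Quotient G Q)) (w : WSpace EG G E Q EB) :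
    sigma A w = pullback (cotModel E) (cotModel EB) WSpace.toCot
        (canonicalForm EB (MulAction.orbitRel.Quotient G Q)) w -
      extD (cotModel E) (formB A) w := by
  have h1 := smoothOneForm_liouvilleMap.extD_pullback (contMDiff_toCot hΨ hπ) w
  rw [pullback_oneForm] at h1
  have h2 : pullback (cotModel E) (cotModel EB) WSpace.toCot
        (canonicalForm EB (MulAction.orbitRel.Quotient G Q)) w =
      -extD (cotModel E) (oneForm (cotModel E) fun w : WSpace EG G E Q EB =>
        (liouvilleMap w.toCot).comp (mfderiv (cotModel E) (cotModel EB) WSpace.toCot w)) w := by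
    rw [h1]
    rfl
  rw [h2, formB_eq, funext (formBMap_eq hΨ hπ),
    (smoothOneForm_thetaW hΨ).extD_sub (smoothOneForm_liouville_toCot hΨ hπ), sigma_eq hΨ]
  abel

lemma extD_formB (hΨ : ∀ w, Ψ w = psi A w) (hπ : Manifold.IsSubmersion 𝓘(ℝ, E) 𝓘(ℝ, EB) ∞
      (orbitProj G : Q → MulAction.orbitRel.Quotient G Q)) (w : WSpace EG G E Q EB)
    (ξ : Fin 2 → TangentSpace (cotModel E) w) :
    extD (cotModel E) (formB A) w ξ =
      dmuA A w (ξ 0) (A.toFun w.base (dbase w (ξ 1))) -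
        dmuA A w (ξ 1) (A.toFun w.base (dbase w (ξ 0))) +
      muA A w (extD 𝓘(ℝ, E) A.form w.base fun i => dbase w (ξ i)) := by
  have hb := contMDiff_base hΨ hπ
  have h1 := SmoothOneForm.extD_pairing (A.smoothOneForm.comp_mfderiv hb)
    (contMDiff_muA hΨ hπ) w ξ
  have h2 := A.smoothOneForm.extD_pullback hb w
  rw [pullback_oneForm] at h2
  rw [h2] at h1
  exact h1

/-- Subtracting `½[A, A]^∧` in the curvature and adding it back separately recovers `dA`, so this is
the product rule of `extD_formB`. -/
lemma extD_formB_wedge (hΨ : ∀ w, Ψ w = psi A w) (hπ : Manifold.IsSubmersion 𝓘(ℝ, E) 𝓘(ℝ, EB) ∞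
      (orbitProj G : Q → MulAction.orbitRel.Quotient G Q)) (w : WSpace EG G E Q EB)
    (ξ : Fin 2 → TangentSpace (cotModel E) w) :
    extD (cotModel E) (formB A) w ξ =
      wedge (l := 1) (k := 1) (fun (lam : EG →L[ℝ] ℝ) (X : EG) => lam X)
          (oneForm (cotModel E) (dmuA A) w) (connW A w) ξ +
        muA A w (A.curv w.base fun i => dbase w (ξ i)) +
        muA A w ((1 / 2 : ℝ) • wedge (l := 1) (k := 1) (lieBr G) (connW A w) (connW A w) ξ) := by
  rw [extD_formB hΨ hπ, add_assoc, ← map_add]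
  refine congrArg₂ (· + ·) ?_ (congrArg (muA A w) ?_)
  · rw [wedge_one_one]
    rfl
  · rw [GenConnection.curv, wedge_one_one, wedge_one_one]
    exact (sub_add_cancel _ _).symm

end Structure

end GaugedCotangent

end

noncomputable section

namespace GaugedCotangent

/-! ### The action on `W` is smooth, symplectic and Hamiltonian -/

section HamiltonianAction

variable {EG : Type*} [NormedAddCommGroup EG] [NormedSpace ℝ EG]
  {G : Type*} [TopologicalSpace G] [ChartedSpace EG G] [Group G] [LieGroup 𝓘(ℝ, EG) ∞ G]
  {E Q : Type*} [NormedAddCommGroup E] [NormedSpace ℝ E] [FiniteDimensional ℝ E]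
  [TopologicalSpace Q] [ChartedSpace E Q] [IsManifold 𝓘(ℝ, E) ∞ Q]
  [MulAction G Q] [ContMDiffSMul 𝓘(ℝ, EG) 𝓘(ℝ, E) ∞ G Q]
  {EB : Type*} [NormedAddCommGroup EB] [NormedSpace ℝ EB] [FiniteDimensional ℝ EB]
  [ChartedSpace EB (MulAction.orbitRel.Quotient G Q)]
  [IsManifold 𝓘(ℝ, EB) ∞ (MulAction.orbitRel.Quotient G Q)]
  {A : GenConnection EG G E Q}
  [ChartedSpace (ModelProd E (E →L[ℝ] ℝ)) (WSpace EG G E Q EB)]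
  [IsManifold (cotModel E) ∞ (WSpace EG G E Q EB)]
  {Ψ : Diffeomorph (cotModel E) (cotModel E) (WSpace EG G E Q EB) (CotangentBundle E Q) ∞}

attribute [local instance] WSpace.mulAction

lemma contMDiffSMul_W (hΨ : ∀ w, Ψ w = psi A w) (hπ : Manifold.IsSubmersion 𝓘(ℝ, E) 𝓘(ℝ, EB) ∞
      (orbitProj G : Q → MulAction.orbitRel.Quotient G Q)) :
    ContMDiffSMul 𝓘(ℝ, EG) (cotModel E) ∞ G (WSpace EG G E Q EB) := by
  refine ⟨contMDiff_of_incl hΨ hπ ?_⟩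
  have h1 : ContMDiff (𝓘(ℝ, EG).prod (cotModel E)) 𝓘(ℝ, EG) ∞
    fun p : G × WSpace EG G E Q EB => p.1 := contMDiff_fst
  have h2 : ContMDiff (𝓘(ℝ, EG).prod (cotModel E)) (cotModel E) ∞
    fun p : G × WSpace EG G E Q EB => p.2 := contMDiff_snd
  have h3 : ContMDiff (𝓘(ℝ, EG).prod (cotModel E)) 𝓘(ℝ, E) ∞
      fun p : G × WSpace EG G E Q EB => p.1 • p.2.base :=
    (contMDiff_smul (I := 𝓘(ℝ, EG)) (I' := 𝓘(ℝ, E)) (n := ∞) (G := G) (M := Q)).comp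
      (h1.prodMk ((contMDiff_base hΨ hπ).comp h2))
  have h4 : ContMDiff (𝓘(ℝ, EG).prod (cotModel E)) 𝓘(ℝ, EG →L[ℝ] ℝ) ∞
      fun p : G × WSpace EG G E Q EB => coAd p.1 (p.2.lam : EG →L[ℝ] ℝ) :=
    contMDiff_coAd.comp (h1.prodMk ((contMDiff_lam hΨ hπ).comp h2))
  exact (h3.prodMk (((contMDiff_toCot hΨ hπ).comp h2).prodMk h4)).congr
    fun p => p.2.act_incl p.1

lemma dbase_smul (hΨ : ∀ w, Ψ w = psi A w) (hπ : Manifold.IsSubmersion 𝓘(ℝ, E) 𝓘(ℝ, EB) ∞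
      (orbitProj G : Q → MulAction.orbitRel.Quotient G Q)) (g : G) (w : WSpace EG G E Q EB)
    (ξ : TangentSpace (cotModel E) w) :
    dbase (g • w) (mfderiv (cotModel E) (cotModel E) (fun w : WSpace EG G E Q EB => g • w) w ξ) =
      mfderiv 𝓘(ℝ, E) 𝓘(ℝ, E) (fun x : Q => g • x) w.base (dbase w ξ) := by
  have := contMDiffSMul_W (EG := EG) hΨ hπ
  have h1 := mfderiv_comp w
    ((contMDiff_base hΨ hπ).contMDiffAt.mdifferentiableAt (x := g • w) (by simp))
    ((contMDiff_smul_left EG (cotModel E) g).contMDiffAt.mdifferentiableAt (x := w) (by simp))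
  have h2 := mfderiv_comp w
    ((contMDiff_smul_left EG 𝓘(ℝ, E) g).contMDiffAt.mdifferentiableAt (x := w.base) (by simp))
    ((contMDiff_base hΨ hπ).contMDiffAt.mdifferentiableAt (x := w) (by simp))
  have h3 : (WSpace.base : WSpace EG G E Q EB → Q) ∘ (fun w => g • w) =
      (fun x : Q => g • x) ∘ WSpace.base := rfl
  rw [h3, h2] at h1
  exact (congrArg (fun L : (E × (E →L[ℝ] ℝ)) →L[ℝ] E => L ξ) h1).symm

lemma dbase_zeta (hΨ : ∀ w, Ψ w = psi A w) (hπ : Manifold.IsSubmersion 𝓘(ℝ, E) 𝓘(ℝ, EB) ∞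
      (orbitProj G : Q → MulAction.orbitRel.Quotient G Q)) (w : WSpace EG G E Q EB) (X : EG) :
    dbase w (zeta G (cotModel E) w X) = zeta G 𝓘(ℝ, E) w.base X := by
  have := contMDiffSMul_W (EG := EG) hΨ hπ
  have h1 := mfderiv_comp (1 : G)
    ((contMDiff_base hΨ hπ).contMDiffAt.mdifferentiableAt (x := (1 : G) • w) (by simp))
    ((contMDiff_smul_right (EG := EG) (I := cotModel E) w).contMDiffAt.mdifferentiableAt
      (x := (1 : G)) (by simp))
  have h3 : (WSpace.base : WSpace EG G E Q EB → Q) ∘ (fun g : G => g • w) =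
      fun g : G => g • w.base := rfl
  rw [h3] at h1
  have h4 := congrArg (fun L : EG →L[ℝ] E => L X) h1
  have h5 : ∀ w' : WSpace EG G E Q EB, w' = w →
      (mfderiv (cotModel E) 𝓘(ℝ, E) (WSpace.base : WSpace EG G E Q EB → Q) w' :
        (E × (E →L[ℝ] ℝ)) →L[ℝ] E) (zeta G (cotModel E) w X) =
      (dbase w : (E × (E →L[ℝ] ℝ)) →L[ℝ] E) (zeta G (cotModel E) w X) := by
    rintro _ rfl
    rfl
  exact (h4.trans (h5 _ (one_smul G w))).symm

/-- `W → Q` is equivariant, and the pairing of `ψ` with vectors is invariant by `psiFib_act`. -/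
lemma thetaW_smul (hΨ : ∀ w, Ψ w = psi A w) (hπ : Manifold.IsSubmersion 𝓘(ℝ, E) 𝓘(ℝ, EB) ∞
      (orbitProj G : Q → MulAction.orbitRel.Quotient G Q)) (g : G) (w : WSpace EG G E Q EB)
    (ξ : TangentSpace (cotModel E) w) :
    thetaW A (g • w)
      (mfderiv (cotModel E) (cotModel E) (fun w : WSpace EG G E Q EB => g • w) w ξ) =
      thetaW A w ξ := by
  have h1 := psiFib_act A hπ.contMDiff g w (dbase w ξ)
  refine Eq.trans ?_ h1
  exact congrArg (psiFib A EB (w.act g).base ((w.act g).eta, (w.act g).lam) : E →L[ℝ] ℝ)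
    (dbase_smul hΨ hπ g w ξ)

lemma pullback_smul_sigma (hΨ : ∀ w, Ψ w = psi A w)
    (hπ : Manifold.IsSubmersion 𝓘(ℝ, E) 𝓘(ℝ, EB) ∞
      (orbitProj G : Q → MulAction.orbitRel.Quotient G Q)) (g : G) :
    pullback (cotModel E) (cotModel E) (fun w : WSpace EG G E Q EB => g • w) (sigma A) =
      sigma A := by
  have := contMDiffSMul_W (EG := EG) hΨ hπ
  have hg : ContMDiff (cotModel E) (cotModel E) ∞ (fun w : WSpace EG G E Q EB => g • w) :=
    contMDiff_smul_left EG (cotModel E) g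
  funext w
  have h1 := (smoothOneForm_thetaW hΨ).extD_pullback hg w
  have h2 : (fun w : WSpace EG G E Q EB => (thetaW A (g • w)).comp
      (mfderiv (cotModel E) (cotModel E) (fun w : WSpace EG G E Q EB => g • w) w)) = thetaW A :=
    funext fun w => ContinuousLinearMap.ext fun ξ => thetaW_smul hΨ hπ g w ξ
  rw [pullback_oneForm, h2] at h1
  rw [sigma_eq hΨ w, h1, pullback, sigma_eq hΨ (g • w)]
  rfl

/-- `ψ^*θ` is invariant and its value on the fundamental field of `X` is `⟨μ_A, X⟩`. Cartan's
formula then gives `-d(ψ^*θ)(ζ_X, ·) = d⟨μ_A, X⟩`. -/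
lemma isMomentumMap_muA (hΨ : ∀ w, Ψ w = psi A w)
    (hπ : Manifold.IsSubmersion 𝓘(ℝ, E) 𝓘(ℝ, EB) ∞
      (orbitProj G : Q → MulAction.orbitRel.Quotient G Q)) :
    IsMomentumMap G (cotModel E) (sigma A) (muA A : WSpace EG G E Q EB → (EG →L[ℝ] ℝ)) where
  smooth := contMDiff_muA hΨ hπ
  hamiltonian X w v := by
    have := contMDiffSMul_W (EG := EG) hΨ hπ
    have h1 : (fun w : WSpace EG G E Q EB => thetaW A w (zeta G (cotModel E) w X)) =
        fun w => muA A w X := by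
      funext w
      have h2 := psiFib_zeta A hπ.contMDiff w.base (w.eta, w.lam) X
      rw [muA_eq_lam A hπ.contMDiff]
      refine Eq.trans ?_ h2
      exact congrArg (psiFib A EB w.base (w.eta, w.lam) : E →L[ℝ] ℝ) (dbase_zeta hΨ hπ w X)
    have hs : ContMDiff (cotModel E) 𝓘(ℝ, ℝ) ∞ fun w : WSpace EG G E Q EB => muA A w X :=
      (contMDiff_muA hΨ hπ).clm_apply contMDiff_const
    have h3 := extD_invariant_zeta (smoothOneForm_thetaW hΨ) (thetaW_smul hΨ hπ) X w v
      (by rw [h1]; exact hs.contMDiffAt.mdifferentiableAt (by simp))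
    rw [h1] at h3
    rw [sigma_eq hΨ, ContinuousAlternatingMap.neg_apply, h3, neg_neg]
    rfl
  equivariant g w := by
    rw [muA_eq_lam A hπ.contMDiff, muA_eq_lam A hπ.contMDiff]
    rfl

end HamiltonianAction

end GaugedCotangent

end

noncomputable section

namespace GaugedCotangent

/-! ### Additivity of the mixed second derivative of the action -/

section HessianLinear

variable {EG : Type*} [NormedAddCommGroup EG] [NormedSpace ℝ EG]
  {G : Type*} [TopologicalSpace G] [ChartedSpace EG G] [Group G]
  {E H M : Type*} [NormedAddCommGroup E] [NormedSpace ℝ E] [TopologicalSpace H]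
  {I : ModelWithCorners ℝ E H} [TopologicalSpace M] [ChartedSpace H M]
  [MulAction G M]

lemma actHess_add_left (x : M) (X Y : EG) (u : E) :
    actHess G I x (X + Y) u = actHess G I x X u + actHess G I x Y u := by
  have h : ((X + Y, 0) : EG × E) = (X, 0) + (Y, 0) := by simp
  rw [actHess, h, map_add]
  rfl

lemma actHess_add_right (x : M) (X : EG) (u v : E) :
    actHess G I x X (u + v) = actHess G I x X u + actHess G I x X v := by
  have h : ((0, u + v) : EG × E) = (0, u) + (0, v) := by simp
  rw [actHess, h, map_add]
  rfl

end HessianLinear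

/-! ### The explicit formula for `dB` -/

section CurvatureFormula

variable {EG : Type*} [NormedAddCommGroup EG] [NormedSpace ℝ EG] [FiniteDimensional ℝ EG]
  {G : Type*} [TopologicalSpace G] [ChartedSpace EG G] [Group G] [LieGroup 𝓘(ℝ, EG) ∞ G]
  [T2Space G]
  {E Q : Type*} [NormedAddCommGroup E] [NormedSpace ℝ E] [FiniteDimensional ℝ E]
  [TopologicalSpace Q] [ChartedSpace E Q] [IsManifold 𝓘(ℝ, E) ∞ Q]
  [MulAction G Q] [ContMDiffSMul 𝓘(ℝ, EG) 𝓘(ℝ, E) ∞ G Q] [ProperSMul G Q]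
  {EB : Type*} [NormedAddCommGroup EB] [NormedSpace ℝ EB] [FiniteDimensional ℝ EB]
  [ChartedSpace EB (MulAction.orbitRel.Quotient G Q)]
  [IsManifold 𝓘(ℝ, EB) ∞ (MulAction.orbitRel.Quotient G Q)]
  {A : GenConnection EG G E Q}

local notation "dproj" => mfderiv 𝓘(ℝ, E) 𝓘(ℝ, EB) (orbitProj G : Q → MulAction.orbitRel.Quotient G Q)

/-- The isotropy group acts trivially on horizontal vectors. -/
lemma coframe_mfderiv_smul_of_hor (hπ : Manifold.IsSubmersion 𝓘(ℝ, E) 𝓘(ℝ, EB) ∞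
      (orbitProj G : Q → MulAction.orbitRel.Quotient G Q)) {q : Q} {v : TangentSpace 𝓘(ℝ, E) q}
    (hv : v ∈ A.hor q) {g : G} (hg : g • q = q) :
    coframe 𝓘(ℝ, E) q (g • q) (mfderiv 𝓘(ℝ, E) 𝓘(ℝ, E) (fun z : Q => g • z) q v) =
      coframe 𝓘(ℝ, E) q q v := by
  have hv' : zeta G 𝓘(ℝ, E) q (A.toFun q v) = 0 := hv
  set u : E := mfderiv 𝓘(ℝ, E) 𝓘(ℝ, E) (fun z : Q => g • z) q v with hu
  have h1 : zeta G 𝓘(ℝ, E) (g • q) (A.toFun (g • q)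
      (mfderiv 𝓘(ℝ, E) 𝓘(ℝ, E) (fun z : Q => g • z) q v)) = 0 := by
    rw [A.equivariant, ← mfderiv_smul_zeta_eq, hv']
    exact ContinuousLinearMap.map_zero _
  have h2 : zeta G 𝓘(ℝ, E) q (A.toFun q u) = 0 := by
    have h3 : ∀ q', q' = q → ((zeta G 𝓘(ℝ, E) q' ((A.toFun q' : E →L[ℝ] EG) u) : E) = 0) →
        (zeta G 𝓘(ℝ, E) q ((A.toFun q : E →L[ℝ] EG) u) : E) = 0 := by
      rintro _ rfl h
      exact h
    exact h3 _ hg h1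
  have h4 : (dproj q : E →L[ℝ] EB) u = (dproj q : E →L[ℝ] EB) v := by
    have h5 := mfderiv_orbitProj_smul EG hπ.contMDiff g q v
    have h6 : ∀ q' : Q, q' = q → (dproj q' : E →L[ℝ] EB) u = (dproj q : E →L[ℝ] EB) u := by
      rintro _ rfl
      rfl
    exact (h6 _ hg).symm.trans h5
  let v₀ : E := v
  -- The difference of the moved vector and `v` is vertical, because `π` is invariant, and
  -- horizontal, because `A` is equivariant. As `ζ ∘ A` is the identity on vertical vectors, it is
  -- zero.
  let d : E := u - v₀
  have h7 : (dproj q : E →L[ℝ] EB) d = 0 :=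
    (ContinuousLinearMap.map_sub (dproj q : E →L[ℝ] EB) u v₀).trans (sub_eq_zero.2 h4)
  obtain ⟨X, hX⟩ := exists_zeta_eq_of_mfderiv_orbitProj_eq_zero (EG := EG) hπ (v := d) h7
  have h8 : (zeta G 𝓘(ℝ, E) q : EG →L[ℝ] E) ((A.toFun q : E →L[ℝ] EG) d) = 0 := by
    have h12 := ContinuousLinearMap.map_sub
      ((zeta G 𝓘(ℝ, E) q : EG →L[ℝ] E).comp (A.toFun q : E →L[ℝ] EG)) u v₀
    exact h12.trans ((congrArg₂ (fun a b : E => a - b) h2 hv').trans (sub_self _))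
  have h9 : d = 0 := by
    have h12 := A.reproduces q X
    rw [hX] at h12
    exact h12.symm.trans h8
  have h10 : u = v₀ := sub_eq_zero.1 h9
  have h11 : ∀ q' : Q, q' = q → (coframe 𝓘(ℝ, E) q q' : E →L[ℝ] E) u =
      (coframe 𝓘(ℝ, E) q q : E →L[ℝ] E) u := by
    rintro _ rfl
    rfl
  exact (h11 _ hg).trans (congrArg (coframe 𝓘(ℝ, E) q q : E →L[ℝ] E) h10)

lemma actHess_hor_eq_zero (hπ : Manifold.IsSubmersion 𝓘(ℝ, E) 𝓘(ℝ, EB) ∞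
      (orbitProj G : Q → MulAction.orbitRel.Quotient G Q)) {q : Q} {v : TangentSpace 𝓘(ℝ, E) q}
    (hv : v ∈ A.hor q) {Y : EG} (hY : zeta G 𝓘(ℝ, E) q Y = 0) :
    actHess G 𝓘(ℝ, E) q Y (coframe 𝓘(ℝ, E) q q v) = 0 := by
  have : CompleteSpace EG := FiniteDimensional.complete ℝ EG
  exact actHess_eq_zero_of_fixed hY fun g hg => coframe_mfderiv_smul_of_hor hπ hv hg

variable (A) in
/-- The bilinear form on the Lie algebra whose antisymmetrization is `⟨λ, [X, Y]⟩`. -/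
def bracketForm (q : Q) (lam : EG →L[ℝ] ℝ) (X Y : EG) : ℝ :=
  lam (A.toFun q (frame 𝓘(ℝ, E) q q (actHess G 𝓘(ℝ, E) q X
    (coframe 𝓘(ℝ, E) q q (zeta G 𝓘(ℝ, E) q Y)))))

lemma bracketForm_add_left (q : Q) (lam : EG →L[ℝ] ℝ) (X X' Y : EG) :
    bracketForm A q lam (X + X') Y = bracketForm A q lam X Y + bracketForm A q lam X' Y := by
  simp only [bracketForm]
  rw [actHess_add_left, ContinuousLinearMap.map_add, ContinuousLinearMap.map_add,
    ContinuousLinearMap.map_add]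

lemma bracketForm_add_right (q : Q) (lam : EG →L[ℝ] ℝ) (X Y Y' : EG) :
    bracketForm A q lam X (Y + Y') = bracketForm A q lam X Y + bracketForm A q lam X Y' := by
  simp only [bracketForm]
  rw [ContinuousLinearMap.map_add, ContinuousLinearMap.map_add, actHess_add_right,
    ContinuousLinearMap.map_add, ContinuousLinearMap.map_add, ContinuousLinearMap.map_add]

lemma bracketForm_of_zeta_eq_zero (q : Q) (lam : EG →L[ℝ] ℝ) (X : EG) {Y : EG}
    (hY : zeta G 𝓘(ℝ, E) q Y = 0) : bracketForm A q lam X Y = 0 := by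
  -- The form depends on `Y` only through `ζ_Y(q) = 0`, so `Y + Y` and `Y` have the same value,
  -- while additivity doubles it.
  have h := bracketForm_add_right (A := A) q lam X Y Y
  have h2 : bracketForm A q lam X (Y + Y) = bracketForm A q lam X Y := by
    simp only [bracketForm]
    rw [ContinuousLinearMap.map_add, hY, add_zero]
  linarith

/-- `λ` does not distinguish `[X, Y]` from `A(ζ_{[X, Y]})`, and `coframe_zeta_lieBr` expands the
fundamental vector of the bracket. -/
lemma lam_lieBr {q : Q} (lam : annIsotropy EG G E q) (X Y : EG) :
    (lam : EG →L[ℝ] ℝ) (lieBr G X Y) = bracketForm A q lam X Y - bracketForm A q lam Y X := by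
  have : CompleteSpace EG := FiniteDimensional.complete ℝ EG
  have hq := mem_chart_source E q
  rw [← annIsotropy_apply_conn A lam (lieBr G X Y),
    ← frame_coframe hq (zeta G 𝓘(ℝ, E) q (lieBr G X Y)), coframe_zeta_lieBr,
    ContinuousLinearMap.map_sub, ContinuousLinearMap.map_sub, ContinuousLinearMap.map_sub]
  rfl

variable [ChartedSpace (ModelProd E (E →L[ℝ] ℝ)) (WSpace EG G E Q EB)]
  [IsManifold (cotModel E) ∞ (WSpace EG G E Q EB)]
  {Ψ : Diffeomorph (cotModel E) (cotModel E) (WSpace EG G E Q EB) (CotangentBundle E Q) ∞}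

lemma contMDiff_conn_zeta (A : GenConnection EG G E Q) (Y : EG) :
    ContMDiff 𝓘(ℝ, E) 𝓘(ℝ, EG) ∞ fun q : Q => A.toFun q (zeta G 𝓘(ℝ, E) q Y) := by
  intro q
  have hq := mem_chart_source E q
  refine ((contMDiffAt_connRep A hq).clm_apply ((contMDiffAt_zetaRep (EG := EG) (G := G)
    hq).clm_apply (contMDiffAt_const (c := Y)))).congr_of_eventuallyEq ?_
  filter_upwards [(chartAt E q).open_source.mem_nhds hq] with z hz
  exact congrArg (A.toFun z) (frame_coframe hz (zeta G 𝓘(ℝ, E) z Y)).symm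

/-- The derivative of the momentum map in the direction of the isotropy algebra. -/
lemma dmuA_apply_of_zeta_eq_zero (hΨ : ∀ w, Ψ w = psi A w)
    (hπ : Manifold.IsSubmersion 𝓘(ℝ, E) 𝓘(ℝ, EB) ∞
      (orbitProj G : Q → MulAction.orbitRel.Quotient G Q)) (w : WSpace EG G E Q EB)
    (ξ : TangentSpace (cotModel E) w) {v : TangentSpace 𝓘(ℝ, E) w.base} {Y Z : EG}
    (hv : v ∈ A.hor w.base) (hξ : dbase w ξ = v + zeta G 𝓘(ℝ, E) w.base Z)
    (hY : zeta G 𝓘(ℝ, E) w.base Y = 0) :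
    dmuA A w ξ Y = bracketForm A w.base w.lam Y Z := by
  have hμ := ((contMDiff_muA hΨ hπ).contMDiffAt.mdifferentiableAt (x := w)
    (by simp)).hasMFDerivAt
  have hf := ((contMDiff_conn_zeta A Y).contMDiffAt.mdifferentiableAt (x := w.base)
    (by simp)).hasMFDerivAt
  have hb := ((contMDiff_base hΨ hπ).contMDiffAt.mdifferentiableAt (x := w)
    (by simp)).hasMFDerivAt
  have hfb := hf.comp w hb
  have hB := (isBoundedBilinearMap_apply (𝕜 := ℝ) (E := EG) (F := ℝ)).hasFDerivAt
    (muA A w, A.toFun w.base (zeta G 𝓘(ℝ, E) w.base Y))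
  have hp : HasMFDerivAt (cotModel E) 𝓘(ℝ, (EG →L[ℝ] ℝ) × EG) (fun w : WSpace EG G E Q EB =>
      (muA A w, A.toFun w.base (zeta G 𝓘(ℝ, E) w.base Y))) w _ :=
    ⟨hμ.1.prodMk hfb.1, hμ.2.prodMk hfb.2⟩
  have h1 := HasMFDerivAt.comp w (g := fun p : (EG →L[ℝ] ℝ) × EG => p.1 p.2)
    (f := fun w : WSpace EG G E Q EB => (muA A w, A.toFun w.base (zeta G 𝓘(ℝ, E) w.base Y)))
    hB.hasMFDerivAt hp
  have h2 : HasMFDerivAt (cotModel E) 𝓘(ℝ, ℝ) (fun w : WSpace EG G E Q EB => muA A w Y) w _ :=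
    HasMFDerivAt.comp w (g := fun L : EG →L[ℝ] ℝ => L Y)
      (ContinuousLinearMap.apply ℝ ℝ Y).hasMFDerivAt hμ
  -- Two expressions for `⟨μ_A, Y⟩` on all of `W`. In the derivative of the second, the term with
  -- `dμ_A` vanishes because `ζ_Y` does at the base point; only the linearization of `ζ_Y` remains,
  -- and this kills `v`.
  have h3 : (fun w : WSpace EG G E Q EB => muA A w Y) =
      (fun p : (EG →L[ℝ] ℝ) × EG => p.1 p.2) ∘ fun w =>
        (muA A w, A.toFun w.base (zeta G 𝓘(ℝ, E) w.base Y)) := by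
    funext w
    rw [Function.comp_apply, muA_eq_lam A hπ.contMDiff, annIsotropy_apply_conn]
  rw [h3] at h2
  have h4 := hasMFDerivAt_unique h2 h1
  have h5 : dmuA A w ξ Y = muA A w (diff 𝓘(ℝ, E) (fun q : Q => A.toFun q (zeta G 𝓘(ℝ, E) q Y))
      w.base (dbase w ξ)) + dmuA A w ξ (A.toFun w.base (zeta G 𝓘(ℝ, E) w.base Y)) :=
    congrArg (fun L : (E × (E →L[ℝ] ℝ)) →L[ℝ] ℝ => L ξ) h4
  have h6 : dmuA A w ξ (A.toFun w.base (zeta G 𝓘(ℝ, E) w.base Y)) = 0 := by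
    rw [hY, ContinuousLinearMap.map_zero]
    exact ContinuousLinearMap.map_zero _
  have hd := diff_apply_zeta_of_zeta_eq_zero A.smoothOneForm hY
    ((contMDiff_conn_zeta A Y).contMDiffAt.mdifferentiableAt (x := w.base) (by simp)) (dbase w ξ)
  rw [h5, h6, add_zero, hd, muA_eq_lam A hπ.contMDiff, hξ, ContinuousLinearMap.map_add,
    actHess_add_right, actHess_hor_eq_zero hπ hv hY, zero_add]
  rfl

/-- The exterior derivative of `B` in terms of horizontal and vertical components. -/
lemma extD_formB_hor (hΨ : ∀ w, Ψ w = psi A w)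
    (hπ : Manifold.IsSubmersion 𝓘(ℝ, E) 𝓘(ℝ, EB) ∞
      (orbitProj G : Q → MulAction.orbitRel.Quotient G Q)) (w : WSpace EG G E Q EB)
    (ξ₁ ξ₂ : TangentSpace (cotModel E) w) (v₁ v₂ : TangentSpace 𝓘(ℝ, E) w.base) (Z₁ Z₂ : EG)
    (hv₁ : v₁ ∈ A.hor w.base) (hv₂ : v₂ ∈ A.hor w.base)
    (h₁ : dbase w ξ₁ = v₁ + zeta G 𝓘(ℝ, E) w.base Z₁)
    (h₂ : dbase w ξ₂ = v₂ + zeta G 𝓘(ℝ, E) w.base Z₂) :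
    extD (cotModel E) (formB A) w ![ξ₁, ξ₂] =
      dmuA A w ξ₁ Z₂ - dmuA A w ξ₂ Z₁ +
        (w.lam : EG →L[ℝ] ℝ) (A.curv w.base ![dbase w ξ₁, dbase w ξ₂]) +
        (w.lam : EG →L[ℝ] ℝ) (lieBr G Z₁ Z₂) := by
  -- `A(q')` agrees with `Z` only up to an element `Y` of the isotropy algebra, since neither `A(v)
  -- = 0` nor `A(ζ_Z) = Z` need hold exactly.
  have key : ∀ (q' v : TangentSpace 𝓘(ℝ, E) w.base) (Z : EG), v ∈ A.hor w.base →
      q' = v + zeta G 𝓘(ℝ, E) w.base Z →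
      ∃ Y, zeta G 𝓘(ℝ, E) w.base Y = 0 ∧ A.toFun w.base q' = Z + Y := by
    intro q' v Z hv hq
    refine ⟨A.toFun w.base q' - Z, ?_, (add_sub_cancel _ _).symm⟩
    have hv' : zeta G 𝓘(ℝ, E) w.base (A.toFun w.base v) = 0 := hv
    rw [ContinuousLinearMap.map_sub, hq, ContinuousLinearMap.map_add, ContinuousLinearMap.map_add,
      A.reproduces, hv', zero_add, sub_self]
  obtain ⟨Y₁, hY₁, e₁⟩ := key _ v₁ Z₁ hv₁ h₁
  obtain ⟨Y₂, hY₂, e₂⟩ := key _ v₂ Z₂ hv₂ h₂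
  have hd := extD_formB hΨ hπ w ![ξ₁, ξ₂]
  have hc : (fun i => dbase w ((![ξ₁, ξ₂] : Fin 2 → TangentSpace (cotModel E) w) i)) =
      ![dbase w ξ₁, dbase w ξ₂] := by
    funext i
    fin_cases i <;> rfl
  rw [hc] at hd
  have hcurv : A.curv w.base ![dbase w ξ₁, dbase w ξ₂] =
      extD 𝓘(ℝ, E) A.form w.base ![dbase w ξ₁, dbase w ξ₂] -
      (1 / 2 : ℝ) • (lieBr G (Z₁ + Y₁) (Z₂ + Y₂) - lieBr G (Z₂ + Y₂) (Z₁ + Y₁)) := by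
    rw [GenConnection.curv, wedge_one_one, ← e₁, ← e₂]
    rfl
  have hd' : extD (cotModel E) (formB A) w ![ξ₁, ξ₂] =
      dmuA A w ξ₁ (Z₂ + Y₂) - dmuA A w ξ₂ (Z₁ + Y₁) +
      (w.lam : EG →L[ℝ] ℝ) (extD 𝓘(ℝ, E) A.form w.base ![dbase w ξ₁, dbase w ξ₂]) := by
    rw [hd, muA_eq_lam A hπ.contMDiff, ← e₁, ← e₂]
    rfl
  rw [hd', hcurv, map_sub, map_smul, map_sub, lam_lieBr (A := A), lam_lieBr (A := A),
    lam_lieBr (A := A)]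
  have m₁ : dmuA A w ξ₁ (Z₂ + Y₂) = dmuA A w ξ₁ Z₂ + bracketForm A w.base w.lam Y₂ Z₁ := by
    rw [← dmuA_apply_of_zeta_eq_zero hΨ hπ w ξ₁ hv₁ h₁ hY₂]
    exact ContinuousLinearMap.map_add _ _ _
  have m₂ : dmuA A w ξ₂ (Z₁ + Y₁) = dmuA A w ξ₂ Z₁ + bracketForm A w.base w.lam Y₁ Z₂ := by
    rw [← dmuA_apply_of_zeta_eq_zero hΨ hπ w ξ₂ hv₂ h₂ hY₁]
    exact ContinuousLinearMap.map_add _ _ _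
  rw [m₁, m₂]
  -- With `b` the bracket form, `dμ_A` contributes the corrections `b(Y₂, Z₁) - b(Y₁, Z₂)`, and the
  -- bracket of the `Z_i + Y_i` in the curvature contributes their negatives. Terms with some `Y_i`
  -- in the second slot vanish.
  simp only [bracketForm_add_left, bracketForm_add_right, bracketForm_of_zeta_eq_zero _ _ _ hY₁,
    bracketForm_of_zeta_eq_zero _ _ _ hY₂, smul_eq_mul]
  ring

end CurvatureFormula

end GaugedCotangent

end

/-! ### The proposition -/

open GaugedCotangent in
theorem proposition5p1
    {EG : Type*} [NormedAddCommGroup EG] [NormedSpace ℝ EG] [FiniteDimensional ℝ EG]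
    {G : Type*} [TopologicalSpace G] [ChartedSpace EG G] [Group G] [LieGroup 𝓘(ℝ, EG) ∞ G]
    [T2Space G] [ParacompactSpace G]
    {E : Type*} [NormedAddCommGroup E] [NormedSpace ℝ E] [FiniteDimensional ℝ E]
    {Q : Type*} [TopologicalSpace Q] [ChartedSpace E Q] [IsManifold 𝓘(ℝ, E) ∞ Q]
    [T2Space Q] [ParacompactSpace Q]
    [MulAction G Q] [ContMDiffSMul 𝓘(ℝ, EG) 𝓘(ℝ, E) ∞ G Q] [ProperSMul G Q]
    -- `Q` is of single orbit type
    (K : Subgroup G)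
    (hK : ∀ q : Q, ∃ g : G, MulAction.stabilizer G q = K.map (MulAut.conj g).toMonoidHom)
    -- the smooth structure of the orbit space, for which `π` is a submersion
    {EB : Type*} [NormedAddCommGroup EB] [NormedSpace ℝ EB] [FiniteDimensional ℝ EB]
    [ChartedSpace EB (MulAction.orbitRel.Quotient G Q)]
    [IsManifold 𝓘(ℝ, EB) ∞ (MulAction.orbitRel.Quotient G Q)]
    (hπ : Manifold.IsSubmersion 𝓘(ℝ, E) 𝓘(ℝ, EB) ∞
      (orbitProj G : Q → MulAction.orbitRel.Quotient G Q))
    (A : GenConnection EG G E Q) :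
    -- `W` is an embedded submanifold of `Q × T^*(Q/G) × 𝔤^*`
    ∃ (_ : ChartedSpace (ModelProd E (E →L[ℝ] ℝ)) (WSpace EG G E Q EB))
      (_ : IsManifold (cotModel E) ∞ (WSpace EG G E Q EB)),
    IsEmbeddedVia (cotModel E) (𝓘(ℝ, E).prod ((cotModel EB).prod 𝓘(ℝ, EG →L[ℝ] ℝ)))
      (WSpace.incl : WSpace EG G E Q EB → _) ∧
    -- `ψ` is an isomorphism of bundles over `Q`
    (∀ q : Q, Function.Bijective (psiFib A EB q)) ∧
    (∃ Ψ : Diffeomorph (cotModel E) (cotModel E) (WSpace EG G E Q EB) (CotangentBundle E Q) ∞,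
      ∀ w, Ψ w = psi A w) ∧
    -- `σ = ψ^* Ω`, the induced action, and its momentum map `(q, η, λ) ↦ λ`
    IsSymplectic (cotModel E) (sigma A (EB := EB)) ∧
    (∀ w : WSpace EG G E Q EB, muA A w = w.lam) ∧
    (∃ _ : MulAction G (WSpace EG G E Q EB),
      (∀ (g : G) (w : WSpace EG G E Q EB), (g • w).base = g • w.base ∧
        (g • w).toCot = w.toCot ∧ ((g • w).lam : EG →L[ℝ] ℝ) = coAd g w.lam) ∧
      ContMDiffSMul 𝓘(ℝ, EG) (cotModel E) ∞ G (WSpace EG G E Q EB) ∧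
      (∀ (g : G) (w : WSpace EG G E Q EB), psi A (g • w) = cotangentLift g (psi A w)) ∧
      (∀ g : G, pullback (cotModel E) (cotModel E) (fun w : WSpace EG G E Q EB => g • w)
        (sigma A) = sigma A) ∧
      IsMomentumMap G (cotModel E) (sigma A) (muA A : WSpace EG G E Q EB → (EG →L[ℝ] ℝ))) ∧
    -- the formula for `σ`, and the formulas for `dB`
    IsSmoothForm (cotModel E) (formB A (EB := EB)) ∧
    (∀ w : WSpace EG G E Q EB, sigma A w =
      pullback (cotModel E) (cotModel EB) WSpace.toCot
        (canonicalForm EB (MulAction.orbitRel.Quotient G Q)) w -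
      extD (cotModel E) (formB A) w) ∧
    (∀ (w : WSpace EG G E Q EB) (ξ : Fin 2 → TangentSpace (cotModel E) w),
      extD (cotModel E) (formB A) w ξ =
        wedge (l := 1) (k := 1) (fun (lam : EG →L[ℝ] ℝ) (X : EG) => lam X)
          (oneForm (cotModel E) (dmuA A) w) (connW A w) ξ +
        muA A w (A.curv w.base fun i => dbase w (ξ i)) +
        muA A w ((1 / 2 : ℝ) • wedge (l := 1) (k := 1) (lieBr G) (connW A w) (connW A w) ξ)) ∧
    (∀ (w : WSpace EG G E Q EB) (ξ₁ ξ₂ : TangentSpace (cotModel E) w)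
      (v₁ v₂ : TangentSpace 𝓘(ℝ, E) w.base) (Z₁ Z₂ : EG),
      v₁ ∈ A.hor w.base → v₂ ∈ A.hor w.base →
      dbase w ξ₁ = v₁ + zeta G 𝓘(ℝ, E) w.base Z₁ →
      dbase w ξ₂ = v₂ + zeta G 𝓘(ℝ, E) w.base Z₂ →
      extD (cotModel E) (formB A) w ![ξ₁, ξ₂] =
        dmuA A w ξ₁ Z₂ - dmuA A w ξ₂ Z₁ +
        (w.lam : EG →L[ℝ] ℝ) (A.curv w.base ![dbase w ξ₁, dbase w ξ₂]) +
        (w.lam : EG →L[ℝ] ℝ) (lieBr G Z₁ Z₂)) := by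
  let e := psiHomeomorph A hπ
  -- `W` receives the structure making `ψ` a diffeomorphism. That it is the embedded submanifold
  -- structure is then proved through `isEmbeddedVia_incl`.
  let _ := pullChartedSpace (ModelProd E (E →L[ℝ] ℝ)) e
  have _ := isManifold_pullChartedSpace (I := cotModel E) e
  let Ψ : Diffeomorph (cotModel E) (cotModel E) (WSpace EG G E Q EB) (CotangentBundle E Q) ∞ :=
    pullDiffeomorph e
  have hΨ : ∀ w, Ψ w = psi A w := fun w => rfl
  exact ⟨inferInstance, inferInstance, isEmbeddedVia_incl hΨ hπ,
    fun q => ⟨psiFib_injective A hπ q, psiFib_surjective A hπ q⟩, ⟨Ψ, hΨ⟩, isSymplectic_sigma hΨ,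
    muA_eq_lam A hπ.contMDiff,
    ⟨WSpace.mulAction EG G E Q EB, fun g w => ⟨rfl, w.act_toCot g, rfl⟩, contMDiffSMul_W hΨ hπ,
      psi_act A hπ.contMDiff, pullback_smul_sigma hΨ hπ, isMomentumMap_muA hΨ hπ⟩,
    IsSmoothForm_oneForm (smoothOneForm_formBMap hΨ hπ), sigma_eq_sub hΨ hπ, extD_formB_wedge hΨ hπ,
    extD_formB_hor hΨ hπ⟩
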